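/- Let $T>0$ and let $(\Omega,\mathcal F,(\mathcal F_t)_{0\le t\le T},\mathbb P)$ be a filtered probability space satisfying the usual conditions of right continuity and completeness. Let $\lambda,\kappa,\gamma,\rho,\phi,\varrho,y>0$ be constants. Let $P=L+A$ be a semimartingale on $[0,T]$ with $P_0\in L^2$, where $L$ is a (local) martingale and $A$ is a predictable process of finite variation with $A_0=0$, such that $E[\langle L\rangle_T]+E\big[(\int_0^T|dA_s|)^2\big]<\infty$. Let $\mathcal A$ be the set of progressively measurable $v$ with $E[\int_0^Tv_s^2\,ds]<\infty$, two elements being identified if they agree $d\mathbb P\otimes dt$-a.e. Let $(x^i)_{i\in\mathbb N}\subset\mathbb R$ be such that $\tilde x=\lim_{N\to\infty}\frac1N\sum_{i=1}^Nx^i$ exists in $\mathbb R$. For $v,\nu\in\mathcal A$ and $i\in\mathbb N$ put $X^{v}_t=x^i-\int_0^tv_s\,ds$ (for agent $i$), $Y^\nu_t=e^{-\rho t}y+\gamma\int_0^te^{-\rho(t-s)}\nu_s\,ds$ and $$J^{i}(v;\nu)=E\Big[\int_0^T(P_t-\kappa Y^\nu_t)v_t\,dt-\lambda\int_0^Tv_t^2\,dt-\phi\int_0^T(X^v_t)^2dt+X^v_T(P_T-\varrho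 X^v_T)\Big].$$ A collection $(\hat v^i)_{i\in\mathbb N}\subset\mathcal A$ is a Nash equilibrium of the mean field game if there is $\hat\nu\in\mathcal A$ such that $\hat v^i$ maximizes $J^{i}(\cdot;\hat\nu)$ over $\mathcal A$ for every $i\in\mathbb N$ and the consistency condition $$\hat\nu_t=\lim_{N\to\infty}\frac1N\sum_{i=1}^N\hat v^i_t\qquad d\mathbb P\otimes dt\text{-a.e. on }\Omega\times[0,T]\qquad(\mathrm C)$$ holds. In the systems below, the equation for $v$ or $\nu$ is understood for a càdlàg adapted version of that process, the martingales are square-integrable (càdlàg) martingales on $[0,T]$, and all the other processes that solve the systems are càdlàg and adapted. 1. A collection $(\hat v^i)_{i\in\mathbb N}\subset\mathcal A$ is the unique Nash equilibrium if and only if there is $\hat\nu\in\mathcal A$ satisfying $(\mathrm C)$ such that for every $i\in\mathbb N$ the processes $(X,v,Y,\nu)=(X^{\hat v^i},\hat v^i,Y^{\hat\nu},\hat\nu)$ satisfy, for some square-integrable martingale $L^i$, $$\begin{cases}dX_t=-v_t\,dt,\quad X_0=x^i,\\ dY_t=-\rho Y_t\,dt+\gamma\nu_t\,dt,\quad Y_0=y,\\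 dv_t=\frac{dP_t}{2\lambda}+\frac{\kappa\rho}{2\lambda}Y_t\,dt-\frac{\kappa\gamma}{2\lambda}\nu_t\,dt-\frac{\phi}{\lambda}X_t\,dt+dL^i_t,\quad v_T=\frac{\varrho}{\lambda}X_T-\frac{\kappa}{2\lambda}Y_T.\end{cases}\qquad(\mathrm S_i)$$ 2. The aggregated linear FBSDE $$\begin{cases}d\tilde X_t=-\tilde\nu_t\,dt,\quad \tilde X_0=\tilde x,\\ d\tilde Y_t=-\rho\tilde Y_t\,dt+\gamma\tilde\nu_t\,dt,\quad\tilde Y_0=y,\\ d\tilde\nu_t=\frac{dP_t}{2\lambda}+\frac{\kappa\rho}{2\lambda}\tilde Y_t\,dt-\frac{\kappa\gamma}{2\lambda}\tilde\nu_t\,dt-\frac{\phi}{\lambda}\tilde X_t\,dt+d\tilde L_t,\quad\tilde\nu_T=\frac{\varrho}{\lambda}\tilde X_T-\frac{\kappa}{2\lambda}\tilde Y_T,\end{cases}$$ with a square-integrable martingale $\tilde L$, has a unique solution $(\tilde X,\tilde Y,\tilde\nu)$ with $\tilde\nu\in\mathcal A$. 3. For this solution and every $i\in\mathbb N$, the linear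 FBSDE $$\begin{cases}dX^i_t=-\hat v^i_t\,dt,\quad X^i_0=x^i,\\ d\hat v^i_t=\frac1{2\lambda}\big(dP_t-\kappa\,d\tilde Y_t\big)-\frac{\phi}{\lambda}X^i_t\,dt+dL^i_t,\quad\hat v^i_T=\frac{\varrho}{\lambda}X^i_T-\frac{\kappa}{2\lambda}\tilde Y_T,\end{cases}$$ with a square-integrable martingale $L^i$, has a unique solution $(X^i,\hat v^i)$ with $\hat v^i\in\mathcal A$. For every $i\in\mathbb N$ the processes $(X^i,\hat v^i,\tilde Y,\tilde\nu)$ satisfy $(\mathrm S_i)$, the consistency condition $\tilde\nu_t=\lim_{N\to\infty}\frac1N\sum_{i=1}^N\hat v^i_t$ holds $d\mathbb P\otimes dt$-a.e. on $\Omega\times[0,T]$, and $(\hat v^i)_{i\in\mathbb N}$ is the unique Nash equilibrium of the mean field game. -/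

import Mathlib

open MeasureTheory Filter Topology

noncomputable section

namespace PriceImpactGame

/-- The time interval `[0, T]`; `⊥` is the initial time `0` and `⊤` is the horizon `T`. It carries
the Borel structure and Lebesgue measure `volume` of a subset of `ℝ`. -/
abbrev Time (T : ℝ) : Type := Set.Icc (0 : ℝ) T

instance factNonneg {T : ℝ} [h : Fact (0 < T)] : Fact (0 ≤ T) := ⟨h.out.le⟩

instance timeMeasureSpace {T : ℝ} : MeasureSpace (Time T) := Measure.Subtype.measureSpace

/-- The strictly positive model parameters: slippage `lam` (λ), impact coefficients `kap` (κ) and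
`gam` (γ), resilience rate `rho` (ρ), running and terminal inventory penalties `phi` (φ) and `vrho`
(ϱ), initial price distortion `y`. -/
structure Params where
  (lam kap gam rho phi vrho y : ℝ)
  lam_pos : 0 < lam
  kap_pos : 0 < kap
  gam_pos : 0 < gam
  rho_pos : 0 < rho
  phi_pos : 0 < phi
  vrho_pos : 0 < vrho
  y_pos : 0 < y

section Processes

variable {Ω : Type*} [MeasurableSpace Ω] {T : ℝ} [Fact (0 < T)]

/-- The usual conditions: right continuity, and all null sets belong to `𝓕₀`. -/
structure UsualConditions (𝓕 : Filtration (Time T) ‹MeasurableSpace Ω›) (μ : Measure Ω) :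
    Prop where
  rightContinuous : 𝓕.IsRightContinuous
  complete : ∀ s : Set Ω, μ s = 0 → MeasurableSet[𝓕 ⊥] s

/-- Right-continuous paths with left limits. -/
def IsCadlag (f : Time T → ℝ) : Prop :=
  ∀ t, ContinuousWithinAt f (Set.Ici t) t ∧ ∃ l, Tendsto f (𝓝[<] t) (𝓝 l)

/-- Adapted processes with almost surely càdlàg paths. -/
structure CadlagAdapted (𝓕 : Filtration (Time T) ‹MeasurableSpace Ω›) (μ : Measure Ω)
    (X : Time T → Ω → ℝ) : Prop where
  adapted : StronglyAdapted 𝓕 X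
  cadlag : ∀ᵐ ω ∂μ, IsCadlag fun t => X t ω

/-- Square-integrable (càdlàg) martingales on `[0, T]`. -/
structure SqIntMartingale (𝓕 : Filtration (Time T) ‹MeasurableSpace Ω›) (μ : Measure Ω)
    (L : Time T → Ω → ℝ) : Prop where
  martingale : Martingale L 𝓕 μ
  cadlag : ∀ᵐ ω ∂μ, IsCadlag fun t => L t ω
  sqInt : ∀ t, MemLp (L t) 2 μ

/-- `L` is a local martingale and `Q` is its predictable quadratic variation `⟨L⟩`: a predictable
nondecreasing càdlàg process with `Q₀ = 0` such that `L ^ 2 - Q` is again a local martingale. The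
two local martingales are localized by one common sequence of stopping times. -/
structure IsPredictableBracket (𝓕 : Filtration (Time T) ‹MeasurableSpace Ω›) (μ : Measure Ω)
    (L Q : Time T → Ω → ℝ) : Prop where
  cadlag_left : CadlagAdapted 𝓕 μ L
  predictable : IsStronglyPredictable 𝓕 Q
  cadlag : ∀ᵐ ω ∂μ, IsCadlag fun t => Q t ω
  mono : ∀ᵐ ω ∂μ, Monotone fun t => Q t ω
  zero : ∀ᵐ ω ∂μ, Q ⊥ ω = 0
  locally_martingale :
    ProbabilityTheory.Locally
      (fun Z : Time T → Ω → ℝ × ℝ =>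
        Martingale (fun t ω => (Z t ω).1) 𝓕 μ ∧ Martingale (fun t ω => (Z t ω).2) 𝓕 μ)
      𝓕 (fun t ω => (L t ω, L t ω ^ 2 - Q t ω)) μ

/-- The class `ℋ²` of semimartingales `P = L + A` with `L` a local martingale, `A` a predictable
process of finite variation with `A₀ = 0`, and
`E[⟨L⟩_T] + E[(∫₀ᵀ |dA|)²] < ∞`; the initial value `P₀ = L₀` is square integrable. -/
def IsH2 (𝓕 : Filtration (Time T) ‹MeasurableSpace Ω›) (μ : Measure Ω)
    (P : Time T → Ω → ℝ) : Prop :=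
  MemLp (P ⊥) 2 μ ∧
  ∃ L A Q : Time T → Ω → ℝ,
    (∀ t ω, P t ω = L t ω + A t ω) ∧
    IsPredictableBracket 𝓕 μ L Q ∧
    Integrable (Q ⊤) μ ∧
    IsStronglyPredictable 𝓕 A ∧
    (∀ᵐ ω ∂μ, IsCadlag fun t => A t ω) ∧
    (∀ᵐ ω ∂μ, A ⊥ ω = 0) ∧
    ∫⁻ ω, (eVariationOn (fun t => A t ω) Set.univ) ^ 2 ∂μ < ⊤

/-- The set `𝒜` of admissible rates: progressively measurable with `E[∫₀ᵀ v² ds] < ∞`. -/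
def Admissible (𝓕 : Filtration (Time T) ‹MeasurableSpace Ω›) (μ : Measure Ω) :
    Set (Time T → Ω → ℝ) :=
  {v | IsStronglyProgressive 𝓕 v ∧
    MemLp (fun p : Time T × Ω => v p.1 p.2) 2 ((volume : Measure (Time T)).prod μ)}

/-- Equality of processes `dt ⊗ dμ`-almost everywhere. -/
def AEEq (μ : Measure Ω) (v w : Time T → Ω → ℝ) : Prop :=
  ∀ᵐ p ∂((volume : Measure (Time T)).prod μ), v p.1 p.2 = w p.1 p.2

/-- Equality of processes up to indistinguishability. -/
def Indist (μ : Measure Ω) (X X' : Time T → Ω → ℝ) : Prop :=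
  ∀ᵐ ω ∂μ, ∀ t, X t ω = X' t ω

/-! ### The mean field game -/

/-- The inventory `X^v_t = x - ∫₀ᵗ v_s ds`. -/
def inventory (x : ℝ) (v : Time T → Ω → ℝ) : Time T → Ω → ℝ :=
  fun t ω => x - ∫ s in Set.Iic t, v s ω

/-- The transient price distortion `Y^ν_t = e^{-ρt} y + γ ∫₀ᵗ e^{-ρ(t-s)} ν_s ds`. -/
def impact (θ : Params) (ν : Time T → Ω → ℝ) : Time T → Ω → ℝ :=
  fun t ω => Real.exp (-θ.rho * t) * θ.y +
    θ.gam * ∫ s in Set.Iic t, Real.exp (-θ.rho * ((t : ℝ) - s)) * ν s ω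

/-- The performance functional `J(v; ν)` of an agent with initial position `x` who trades at the
execution price `S^ν = P - κ Y^ν`. -/
def objective (θ : Params) (μ : Measure Ω) (P : Time T → Ω → ℝ) (x : ℝ)
    (v ν : Time T → Ω → ℝ) : ℝ :=
  ∫ ω, ((∫ t, (P t ω - θ.kap * impact θ ν t ω) * v t ω) - θ.lam * (∫ t, v t ω ^ 2)
    - θ.phi * (∫ t, inventory x v t ω ^ 2)
    + inventory x v ⊤ ω * (P ⊤ ω - θ.vrho * inventory x v ⊤ ω)) ∂μ

/-- The consistency condition: `ν = lim_N (1/N) ∑_{i<N} vⁱ`, `dt ⊗ dμ`-almost everywhere. -/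
def Consistent (μ : Measure Ω) (v : ℕ → Time T → Ω → ℝ) (ν : Time T → Ω → ℝ) : Prop :=
  ∀ᵐ p ∂((volume : Measure (Time T)).prod μ),
    Tendsto (fun N : ℕ => (N : ℝ)⁻¹ * ∑ i ∈ Finset.range N, v i p.1 p.2) atTop (𝓝 (ν p.1 p.2))

/-- Nash equilibria of the infinite player mean field game: for some admissible net trading flow
`ν`, every `vⁱ` maximizes `J(·; ν)` over the admissible rates, and `ν` is consistent. -/
def IsNash (θ : Params) (𝓕 : Filtration (Time T) ‹MeasurableSpace Ω›) (μ : Measure Ω)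
    (P : Time T → Ω → ℝ) (x : ℕ → ℝ) (v : ℕ → Time T → Ω → ℝ) : Prop :=
  (∀ i, v i ∈ Admissible 𝓕 μ) ∧
  ∃ ν ∈ Admissible 𝓕 μ,
    (∀ i, ∀ w ∈ Admissible 𝓕 μ, objective θ μ P (x i) w ν ≤ objective θ μ P (x i) (v i) ν) ∧
    Consistent μ v ν

/-- `v` is the unique Nash equilibrium (admissible rates are identified when they agree
`dt ⊗ dμ`-almost everywhere). -/
def IsUniqueNash (θ : Params) (𝓕 : Filtration (Time T) ‹MeasurableSpace Ω›) (μ : Measure Ω)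
    (P : Time T → Ω → ℝ) (x : ℕ → ℝ) (v : ℕ → Time T → Ω → ℝ) : Prop :=
  IsNash θ 𝓕 μ P x v ∧ ∀ w, IsNash θ 𝓕 μ P x w → ∀ i, AEEq μ (w i) (v i)

/-! ### The forward-backward systems -/

/-- `dX = - v dt`, `X₀ = x`. -/
structure SolvesInventory (𝓕 : Filtration (Time T) ‹MeasurableSpace Ω›) (μ : Measure Ω)
    (x : ℝ) (v X : Time T → Ω → ℝ) : Prop where
  cadlagAdapted : CadlagAdapted 𝓕 μ X
  eq : ∀ᵐ ω ∂μ, ∀ t, X t ω = x - ∫ s in Set.Iic t, v s ω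

/-- `dY = - ρ Y dt + γ ν dt`, `Y₀ = y`. -/
structure SolvesImpact (θ : Params) (𝓕 : Filtration (Time T) ‹MeasurableSpace Ω›)
    (μ : Measure Ω) (ν Y : Time T → Ω → ℝ) : Prop where
  cadlagAdapted : CadlagAdapted 𝓕 μ Y
  eq : ∀ᵐ ω ∂μ, ∀ t, Y t ω = θ.y + ∫ s in Set.Iic t, (-θ.rho * Y s ω + θ.gam * ν s ω)

/-- The backward equation `dv = dD + dL`, `v_T = ξ`, for some square-integrable martingale `L`.
Since admissible rates are identified when they agree `dt ⊗ dμ`-almost everywhere, the equation is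
required of a càdlàg adapted version `v'` of `v`. -/
def SolvesBackward (𝓕 : Filtration (Time T) ‹MeasurableSpace Ω›) (μ : Measure Ω)
    (v D : Time T → Ω → ℝ) (ξ : Ω → ℝ) : Prop :=
  ∃ v' L : Time T → Ω → ℝ,
    CadlagAdapted 𝓕 μ v' ∧ AEEq μ v' v ∧ SqIntMartingale 𝓕 μ L ∧
    (∀ᵐ ω ∂μ, ∀ t, v' t ω = v' ⊥ ω + (D t ω - D ⊥ ω) + (L t ω - L ⊥ ω)) ∧
    (∀ᵐ ω ∂μ, v' ⊤ ω = ξ ω)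

/-- The linear FBSDE of one agent with initial position `x`, for `(X, v, Y, ν)`:
`dX = - v dt`, `X₀ = x`; `dY = - ρ Y dt + γ ν dt`, `Y₀ = y`;
`dv = dP / (2λ) + (κρ / (2λ)) Y dt - (κγ / (2λ)) ν dt - (φ / λ) X dt + dL`,
`v_T = (ϱ / λ) X_T - (κ / (2λ)) Y_T`. -/
structure AgentFBSDE (θ : Params) (𝓕 : Filtration (Time T) ‹MeasurableSpace Ω›)
    (μ : Measure Ω) (P : Time T → Ω → ℝ) (x : ℝ) (X v Y ν : Time T → Ω → ℝ) : Prop where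
  inventory_eq : SolvesInventory 𝓕 μ x v X
  impact_eq : SolvesImpact θ 𝓕 μ ν Y
  backward : SolvesBackward 𝓕 μ v
    (fun t ω => P t ω / (2 * θ.lam) + ∫ s in Set.Iic t,
      (θ.kap * θ.rho / (2 * θ.lam) * Y s ω - θ.kap * θ.gam / (2 * θ.lam) * ν s ω
        - θ.phi / θ.lam * X s ω))
    (fun ω => θ.vrho / θ.lam * X ⊤ ω - θ.kap / (2 * θ.lam) * Y ⊤ ω)

/-- The aggregated three-dimensional linear FBSDE for `(X, Y, ν)`:
`dX = - ν dt`, `X₀ = x`; `dY = - ρ Y dt + γ ν dt`, `Y₀ = y`;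
`dν = dP / (2λ) + (κρ / (2λ)) Y dt - (κγ / (2λ)) ν dt - (φ / λ) X dt + dL`,
`ν_T = (ϱ / λ) X_T - (κ / (2λ)) Y_T`. -/
structure AggregatedFBSDE (θ : Params) (𝓕 : Filtration (Time T) ‹MeasurableSpace Ω›)
    (μ : Measure Ω) (P : Time T → Ω → ℝ) (x : ℝ) (X Y ν : Time T → Ω → ℝ) : Prop where
  inventory_eq : SolvesInventory 𝓕 μ x ν X
  impact_eq : SolvesImpact θ 𝓕 μ ν Y
  backward : SolvesBackward 𝓕 μ ν
    (fun t ω => P t ω / (2 * θ.lam) + ∫ s in Set.Iic t,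
      (θ.kap * θ.rho / (2 * θ.lam) * Y s ω - θ.kap * θ.gam / (2 * θ.lam) * ν s ω
        - θ.phi / θ.lam * X s ω))
    (fun ω => θ.vrho / θ.lam * X ⊤ ω - θ.kap / (2 * θ.lam) * Y ⊤ ω)

/-- The decoupled linear FBSDE for `(X, v)`, given the process `Y`:
`dX = - v dt`, `X₀ = x`; `dv = (dP - κ dY) / (2λ) - (φ / λ) X dt + dL`,
`v_T = (ϱ / λ) X_T - (κ / (2λ)) Y_T`. -/
structure DecoupledFBSDE (θ : Params) (𝓕 : Filtration (Time T) ‹MeasurableSpace Ω›)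
    (μ : Measure Ω) (P Y : Time T → Ω → ℝ) (x : ℝ) (X v : Time T → Ω → ℝ) : Prop where
  inventory_eq : SolvesInventory 𝓕 μ x v X
  backward : SolvesBackward 𝓕 μ v
    (fun t ω => (P t ω - θ.kap * Y t ω) / (2 * θ.lam) - ∫ s in Set.Iic t, θ.phi / θ.lam * X s ω)
    (fun ω => θ.vrho / θ.lam * X ⊤ ω - θ.kap / (2 * θ.lam) * Y ⊤ ω)

end Processes

end PriceImpactGame

end

set_option linter.unusedSectionVars false

noncomputable section

namespace PriceImpactGame

/-! ### Càdlàg paths on `[0, T]`, dyadic grids and upcrossings. -/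

section Paths

variable {T : ℝ} [Fact (0 < T)]

/-! Everything takes place in the Hilbert space `L²(dt ⊗ dμ)`, where the classes of admissible rates
form a closed subspace `H`, the `L²` space of the progressive σ-algebra. Rewriting the inventory
terms by integration by parts turns the objective into a quadratic functional of `v`, namely a
constant plus `⟨F, v⟩ - λ⟨v, v⟩ - ½⟨K v, v⟩`. Here `F = P - P_T - κ Y^ν + 2φx(T - t) + 2ϱx`, and `K`
acts on paths with the kernel `2φ(T - max(t, s)) + 2ϱ`. This kernel is symmetric with nonnegative
quadratic form, so `v` is a maximizer exactly when the gradient `F - 2λv - K v` (`gap`) is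
orthogonal to `H` (`firstOrder_iff_maximizes`). Lax–Milgram gives existence and uniqueness of such a
`v`.

The orthogonality condition is the backward equation in disguise (`firstOrder_iff_solvesBackward`).
The gradient is an adapted process plus an `𝓕_T`-measurable variable `Z` that does not depend on
`t`. It is orthogonal to all admissible rates iff the adapted part equals `-E[Z | 𝓕_t]`; the
martingale `E[Z | 𝓕_t] / (2λ)` is the one in the FBSDE, and its value at `T` yields the terminal
condition. A càdlàg version of this martingale is needed and is built by Doob's regularization along
dyadic times (`exists_cadlag_condExp`).

For the aggregated system `Y` depends linearly on `ν`, which adds `κγ` times the kernel `1_{s ≤ t}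
e^{-ρ(t - s)}` to `K`. The new kernel is not symmetric, but its quadratic form is still nonnegative
because `e^{-ρ|t - s|}` is a positive kernel (`isPosKernel_decay`). Lax–Milgram applies again.

The link between agents and aggregate is that, for fixed `ν`, the first order condition is affine in
the initial position. The optimal rates are therefore `a + xⁱ b` with `a`, `b` independent of `i`,
and their averages converge to `a + x̃ b`, the best response from position `x̃`. Hence consistency
means that `ν` is its own best response from `x̃`, which is the aggregated equation
(`consistent_iff`). Uniqueness of its solution forces any two equilibria to share `ν`, and then to
agree agent by agent (`IsNash.isUniqueNash`). -/

lemma bot_lt_top_time : (⊥ : Time T) < ⊤ := by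
  rw [← Subtype.coe_lt_coe]
  exact Fact.out (p := 0 < T)

instance nontrivialTime : Nontrivial (Time T) := ⟨⟨⊥, ⊤, bot_lt_top_time.ne⟩⟩

lemma coe_bot_time : ((⊥ : Time T) : ℝ) = 0 := rfl

lemma coe_top_time : ((⊤ : Time T) : ℝ) = T := rfl

/-! ### Dyadic grids -/

/-- The `j`-th point of the dyadic grid of mesh `T / 2 ^ K`, stopped at `T`. -/
def grid (T : ℝ) [h : Fact (0 < T)] (K j : ℕ) : Time T :=
  Set.projIcc 0 T h.out.le (j * T / 2 ^ K)

lemma grid_mono (K : ℕ) : Monotone (grid T K) := fun i j hij => by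
  have hT : 0 < T := Fact.out
  apply Set.monotone_projIcc
  gcongr

lemma grid_refine (K d j : ℕ) : grid T (K + d) (j * 2 ^ d) = grid T K j := by
  unfold grid
  congr 1
  push_cast
  rw [pow_add]
  field_simp

lemma grid_eq_top {K j : ℕ} (h : 2 ^ K ≤ j) : grid T K j = ⊤ := by
  have hT : 0 < T := Fact.out
  apply Set.projIcc_of_right_le
  rw [le_div_iff₀ (by positivity), mul_comm]
  have : ((2 ^ K : ℕ) : ℝ) ≤ j := by exact_mod_cast h
  push_cast at this
  gcongr

/-- The dyadic points of `[0, T]`. -/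
def dyadic (T : ℝ) [Fact (0 < T)] : Set (Time T) := {t | ∃ K j, t = grid T K j}

/-- The grids are nested. Finitely many dyadic points therefore lie on one common grid, where
discrete-time martingale inequalities apply. -/
lemma exists_grid_level {t : Time T} (ht : t ∈ dyadic T) :
    ∃ K₀, ∀ K ≥ K₀, t ∈ Set.range (grid T K) := by
  obtain ⟨K₀, j, rfl⟩ := ht
  refine ⟨K₀, fun K hK => ?_⟩
  obtain ⟨d, rfl⟩ := Nat.exists_eq_add_of_le hK
  exact ⟨_, grid_refine K₀ d j⟩

/-- The index of the first point of the `K`-th grid that lies strictly to the right of `t`. -/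
def gridIndex (K : ℕ) (t : Time T) : ℕ := ⌊(t : ℝ) * 2 ^ K / T⌋₊ + 1

/-- Rounding up moves `t` by at most one mesh. Strictness can fail only when the next grid point is
clipped to the horizon. -/
lemma coe_grid_gridIndex (K : ℕ) (t : Time T) :
    (grid T K (gridIndex K t) : ℝ) ≤ t + T / 2 ^ K ∧
      ((grid T K (gridIndex K t)) = ⊤ ∨ t < grid T K (gridIndex K t)) := by
  have hT : 0 < T := Fact.out
  have h0 : 0 ≤ (t : ℝ) * 2 ^ K / T := by have := t.2.1; positivity
  have h1 := Nat.floor_le h0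
  have h2 := Nat.lt_floor_add_one ((t : ℝ) * 2 ^ K / T)
  set m := ⌊(t : ℝ) * 2 ^ K / T⌋₊ with hm
  have e : (((gridIndex K t : ℕ) : ℝ)) = m + 1 := by simp [gridIndex, hm]
  have h3 : (m : ℝ) * T / 2 ^ K ≤ t := by
    rw [le_div_iff₀ hT] at h1
    rw [div_le_iff₀ (by positivity)]; exact h1
  have h4 : (t : ℝ) < (m + 1) * T / 2 ^ K := by
    rw [div_lt_iff₀ hT] at h2
    rw [lt_div_iff₀ (by positivity)]; exact h2
  have h5 : ((m : ℝ) + 1) * T / 2 ^ K = m * T / 2 ^ K + T / 2 ^ K := by ring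
  have hg : (grid T K (gridIndex K t) : ℝ) = max 0 (min T ((m + 1) * T / 2 ^ K)) := by
    unfold grid
    rw [Set.coe_projIcc, e]
  have hpos : 0 ≤ ((m : ℝ) + 1) * T / 2 ^ K := by positivity
  rw [max_eq_right (le_min hT.le hpos)] at hg
  refine ⟨?_, ?_⟩
  · rw [hg]
    exact (min_le_right _ _).trans (by linarith)
  · rcases le_total T ((m + 1) * T / 2 ^ K) with h | h
    · left
      apply Subtype.ext
      rw [hg, min_eq_left h, coe_top_time]
    · right
      rw [← Subtype.coe_lt_coe, hg, min_eq_right h]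
      exact h4

lemma tendsto_grid_gridIndex {t : Time T} (ht : t < ⊤) :
    Tendsto (fun K => grid T K (gridIndex K t)) atTop (𝓝[dyadic T ∩ Set.Ioi t] t) := by
  rw [tendsto_nhdsWithin_iff]
  constructor
  · rw [tendsto_subtype_rng]
    have h : Tendsto (fun K : ℕ => T / 2 ^ K) atTop (𝓝 0) :=
      tendsto_const_nhds.div_atTop (tendsto_pow_atTop_atTop_of_one_lt (by norm_num))
    refine tendsto_of_tendsto_of_tendsto_of_le_of_le tendsto_const_nhds
      (by simpa using h.const_add (t : ℝ)) (fun K => ?_) (fun K => (coe_grid_gridIndex K t).1)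
    rcases (coe_grid_gridIndex K t).2 with h | h
    · rw [Subtype.coe_le_coe, h]; exact le_top
    · exact h.le
  · refine Eventually.of_forall fun K => ⟨⟨K, _, rfl⟩, ?_⟩
    rcases (coe_grid_gridIndex K t).2 with h | h
    · rw [h]; exact ht
    · exact h

lemma neBot_dyadic_Ioi {t : Time T} (ht : t < ⊤) : (𝓝[dyadic T ∩ Set.Ioi t] t).NeBot :=
  (tendsto_grid_gridIndex ht).neBot

/-! ### Càdlàg regularization of a path given on the dyadic points -/

/-- The right limits of `f` along the dyadic points, with the value of `f` at the horizon. -/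
def rightLimits (f : Time T → ℝ) (t : Time T) : ℝ :=
  open Classical in if t = ⊤ then f ⊤ else limUnder (𝓝[dyadic T ∩ Set.Ioi t] t) f

lemma tendsto_rightLimits {f : Time T → ℝ} {t : Time T} (ht : t < ⊤)
    (h : ∃ c, Tendsto f (𝓝[dyadic T ∩ Set.Ioi t] t) (𝓝 c)) :
    Tendsto f (𝓝[dyadic T ∩ Set.Ioi t] t) (𝓝 (rightLimits f t)) := by
  have := neBot_dyadic_Ioi ht
  rw [rightLimits, if_neg ht.ne]
  exact tendsto_nhds_limUnder h

lemma isCadlag_rightLimits {f : Time T → ℝ}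
    (hr : ∀ t < ⊤, ∃ c, Tendsto f (𝓝[dyadic T ∩ Set.Ioi t] t) (𝓝 c))
    (hl : ∀ t, ⊥ < t → ∃ c, Tendsto f (𝓝[dyadic T ∩ Set.Iio t] t) (𝓝 c)) :
    IsCadlag (rightLimits f) := by
  -- Closed balls survive limits, so a bound for `f` at the dyadic points of an open interval is
  -- inherited by the right limits there. Both one-sided limits follow from this.
  have key : ∀ (c ε : ℝ) (l u : Time T), (∀ d ∈ dyadic T, l < d → d < u → f d ∈
      Metric.closedBall c ε) → ∀ s, l < s → s < u → rightLimits f s ∈ Metric.closedBall c ε := by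
    intro c ε l u h s hs hsu
    have := neBot_dyadic_Ioi (hsu.trans_le le_top)
    refine Metric.isClosed_closedBall.mem_of_tendsto
      (tendsto_rightLimits (hsu.trans_le le_top) (hr s (hsu.trans_le le_top))) ?_
    have h2 : ∀ᶠ d in 𝓝[dyadic T ∩ Set.Ioi s] s, d < u :=
      mem_nhdsWithin_of_mem_nhds (Iio_mem_nhds hsu)
    filter_upwards [self_mem_nhdsWithin, h2] with d hd hdu
    exact h d hd.1 (hs.trans hd.2) hdu
  intro t
  constructor
  · rcases eq_or_lt_of_le (le_top : t ≤ ⊤) with rfl | ht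
    · rw [Set.Ici_top]; exact continuousWithinAt_singleton
    · rw [← continuousWithinAt_Ioi_iff_Ici, ContinuousWithinAt, Metric.tendsto_nhds]
      intro ε hε
      have h1 := tendsto_rightLimits ht (hr t ht)
      have h2 := h1.eventually (Metric.closedBall_mem_nhds _ (half_pos hε))
      rw [eventually_nhdsWithin_iff] at h2
      obtain ⟨u, hu, hu'⟩ := exists_Ico_subset_of_mem_nhds h2 ⟨⊤, ht⟩
      filter_upwards [Ioo_mem_nhdsGT hu] with s hs
      have := key (rightLimits f t) (ε / 2) t u
        (fun d hd h3 h4 => hu' ⟨h3.le, h4⟩ ⟨hd, h3⟩) s hs.1 hs.2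
      exact lt_of_le_of_lt this (half_lt_self hε)
  · rcases eq_or_lt_of_le (bot_le : ⊥ ≤ t) with rfl | ht
    · exact ⟨0, by simp⟩
    · obtain ⟨c, hc⟩ := hl t ht
      refine ⟨c, ?_⟩
      rw [Metric.tendsto_nhds]
      intro ε hε
      have h2 := hc.eventually (Metric.closedBall_mem_nhds _ (half_pos hε))
      rw [eventually_nhdsWithin_iff] at h2
      obtain ⟨u, hu, hu'⟩ := exists_Ioc_subset_of_mem_nhds h2 ⟨⊥, ht⟩
      filter_upwards [Ioo_mem_nhdsLT hu] with s hs
      have := key c (ε / 2) u t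
        (fun d hd h3 h4 => hu' ⟨h3, h4.le⟩ ⟨hd, h4⟩) s hs.1 hs.2
      exact lt_of_le_of_lt this (half_lt_self hε)

/-- `f` has at least `n` upcrossings of `[a, b]` through points of `D` inside `(l, u)`. -/
def Upcrosses (f : Time T → ℝ) (D : Set (Time T)) (a b : ℝ) (u : Time T) : ℕ → Time T → Prop
  | 0, _ => True
  | n + 1, l => ∃ s ∈ D, ∃ r ∈ D, l < s ∧ s < r ∧ r < u ∧ f s < a ∧ b < f r ∧
      Upcrosses f D a b u n r

lemma Upcrosses.mono_left {f : Time T → ℝ} {D : Set (Time T)} {a b : ℝ} {u : Time T} {n : ℕ}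
    {l l' : Time T} (h : Upcrosses f D a b u n l) (hl : l' ≤ l) : Upcrosses f D a b u n l' := by
  cases n with
  | zero => trivial
  | succ n =>
    obtain ⟨s, hs, r, hr, h1, h2⟩ := h
    exact ⟨s, hs, r, hr, hl.trans_lt h1, h2⟩

lemma Upcrosses.mono_right {f : Time T → ℝ} {D : Set (Time T)} {a b : ℝ} {u u' : Time T}
    (hu : u ≤ u') {n : ℕ} {l : Time T} (h : Upcrosses f D a b u n l) :
    Upcrosses f D a b u' n l := by
  induction n generalizing l with
  | zero => trivial
  | succ n ih =>
    obtain ⟨s, hs, r, hr, h1, h2, h3, h4, h5, h6⟩ := h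
    exact ⟨s, hs, r, hr, h1, h2, h3.trans_le hu, h4, h5, ih h6⟩

/-- Near a right limit the points are chosen moving leftwards toward `t`, so a chain has to be
extendable at its right end, while the definition extends it at the left. -/
lemma Upcrosses.append {f : Time T → ℝ} {D : Set (Time T)} {a b : ℝ} {n : ℕ} {l s r u : Time T}
    (h : Upcrosses f D a b s n l) (hl : l < s) (hs : s ∈ D) (hr : r ∈ D) (hsr : s < r)
    (hru : r < u) (hfs : f s < a) (hfr : b < f r) : Upcrosses f D a b u (n + 1) l := by
  induction n generalizing l with
  | zero => exact ⟨s, hs, r, hr, hl, hsr, hru, hfs, hfr, trivial⟩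
  | succ n ih =>
    obtain ⟨s', hs', r', hr', h1, h2, h3, h4, h5, h6⟩ := h
    exact ⟨s', hs', r', hr', h1, h2, h3.trans (hsr.trans hru), h4, h5, ih h6 h3⟩

/-- If a one-sided limit failed to exist, rationals `a < b` would separate the liminf from the
limsup, and `f` would cross `[a, b]` arbitrarily often on that side of `t`. Boundedness makes the
limits finite. -/
lemma exists_limits_of_upcrosses {f : Time T → ℝ} (C : ℝ) (hC : ∀ d ∈ dyadic T, |f d| ≤ C)
    (h : ∀ a b : ℚ, a < b → ∃ n, ¬ Upcrosses f (dyadic T) a b ⊤ n ⊥) :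
    (∀ t < ⊤, ∃ c, Tendsto f (𝓝[dyadic T ∩ Set.Ioi t] t) (𝓝 c)) ∧
      (∀ t, ⊥ < t → ∃ c, Tendsto f (𝓝[dyadic T ∩ Set.Iio t] t) (𝓝 c)) := by
  have bdd : ∀ (S : Set (Time T)) (t : Time T),
      IsBoundedUnder (fun x1 x2 => x1 ≤ x2) (𝓝[dyadic T ∩ S] t) f ∧
      IsBoundedUnder (fun x1 x2 => x1 ≥ x2) (𝓝[dyadic T ∩ S] t) f := fun S t => by
    constructor
    · refine ⟨C, eventually_map.2 ?_⟩
      filter_upwards [self_mem_nhdsWithin] with d hd using (abs_le.1 (hC d hd.1)).2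
    · refine ⟨-C, eventually_map.2 ?_⟩
      filter_upwards [self_mem_nhdsWithin] with d hd using (abs_le.1 (hC d hd.1)).1
  constructor
  · intro t ht
    refine tendsto_of_no_upcrossings Rat.denseRange_cast ?_ (bdd _ t).1 (bdd _ t).2
    rintro _ ⟨a, rfl⟩ _ ⟨b, rfl⟩ hab ⟨ha, hb⟩
    obtain ⟨n, hn⟩ := h a b (by exact_mod_cast hab)
    have sel : ∀ {p : Time T → Prop}, (∃ᶠ d in 𝓝[dyadic T ∩ Set.Ioi t] t, p d) → ∀ u, t < u →
        ∃ d ∈ dyadic T, t < d ∧ d < u ∧ p d := by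
      intro p hp u hu
      have h2 : ∀ᶠ d in 𝓝[dyadic T ∩ Set.Ioi t] t, d < u :=
        mem_nhdsWithin_of_mem_nhds (Iio_mem_nhds hu)
      obtain ⟨d, h3, h4, h5⟩ := (hp.and_eventually (h2.and self_mem_nhdsWithin)).exists
      exact ⟨d, h5.1, h5.2, h4, h3⟩
    have : ∀ n u, t < u → Upcrosses f (dyadic T) a b u n t := by
      intro n
      induction n with
      | zero => intros; trivial
      | succ n ih =>
        intro u hu
        obtain ⟨r, hr, htr, hru, hbr⟩ := sel hb u hu
        obtain ⟨s, hs, hts, hsr, has⟩ := sel ha r htr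
        exact (ih s hts).append hts hs hr hsr hru has hbr
    exact hn ((this n ⊤ ht).mono_left bot_le)
  · intro t ht
    refine tendsto_of_no_upcrossings Rat.denseRange_cast ?_ (bdd _ t).1 (bdd _ t).2
    rintro _ ⟨a, rfl⟩ _ ⟨b, rfl⟩ hab ⟨ha, hb⟩
    obtain ⟨n, hn⟩ := h a b (by exact_mod_cast hab)
    have sel : ∀ {p : Time T → Prop}, (∃ᶠ d in 𝓝[dyadic T ∩ Set.Iio t] t, p d) → ∀ u, u < t →
        ∃ d ∈ dyadic T, u < d ∧ d < t ∧ p d := by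
      intro p hp u hu
      have h2 : ∀ᶠ d in 𝓝[dyadic T ∩ Set.Iio t] t, u < d :=
        mem_nhdsWithin_of_mem_nhds (Ioi_mem_nhds hu)
      obtain ⟨d, h3, h4, h5⟩ := (hp.and_eventually (h2.and self_mem_nhdsWithin)).exists
      exact ⟨d, h5.1, h4, h5.2, h3⟩
    have : ∀ n l, l < t → Upcrosses f (dyadic T) a b t n l := by
      intro n
      induction n with
      | zero => intros; trivial
      | succ n ih =>
        intro l hl
        obtain ⟨s, hs, hls, hst, has⟩ := sel ha l hl
        obtain ⟨r, hr, hsr, hrt, hbr⟩ := sel hb s hst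
        exact ⟨s, hs, r, hr, hls, hsr, hrt, has, hbr, ih r hrt⟩
    exact hn ((this n ⊥ ht).mono_right le_top)

lemma Upcrosses.exists_grid {f : Time T → ℝ} {a b : ℝ} {n : ℕ} {l u : Time T}
    (h : Upcrosses f (dyadic T) a b u n l) :
    ∃ K₀, ∀ K ≥ K₀, Upcrosses f (Set.range (grid T K)) a b u n l := by
  induction n generalizing l with
  | zero => exact ⟨0, fun _ _ => trivial⟩
  | succ n ih =>
    obtain ⟨s, hs, r, hr, h1, h2, h3, h4, h5, h6⟩ := h
    obtain ⟨K₁, hK₁⟩ := exists_grid_level hs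
    obtain ⟨K₂, hK₂⟩ := exists_grid_level hr
    obtain ⟨K₃, hK₃⟩ := ih h6
    refine ⟨max K₁ (max K₂ K₃), fun K hK => ?_⟩
    simp only [ge_iff_le, max_le_iff] at hK
    exact ⟨s, hK₁ K hK.1, r, hK₂ K hK.2.1, h1, h2, h3, h4, h5, hK₃ K hK.2.2⟩

/-- A chain of points on a grid is converted into the upcrossing count of a discrete-time process,
to which Doob's inequality applies. -/
lemma Upcrosses.le_upcrossings {Ω : Type*} {M : Time T → Ω → ℝ} {ω : Ω} {a b : ℝ} (hab : a < b)
    {K n : ℕ} {u : Time T}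
    (h : Upcrosses (fun t => M t ω) (Set.range (grid T K)) a b u n ⊥) :
    (n : ENNReal) ≤ upcrossings a b (fun j => M (grid T K j)) ω := by
  -- The index `N` records how much of the discrete path has been used: every grid point to the
  -- right of `l` has index at least `N`, so later upcrossings add to those counted before `N`.
  have key : ∀ (n N : ℕ) (l : Time T), (∀ j, l < grid T K j → N ≤ j) →
      Upcrosses (fun t => M t ω) (Set.range (grid T K)) a b u n l →
      ∃ N', upcrossingsBefore a b (fun j => M (grid T K j)) N ω + n ≤
        upcrossingsBefore a b (fun j => M (grid T K j)) N' ω := by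
    intro n
    induction n with
    | zero => intro N l _ _; exact ⟨N, by simp⟩
    | succ n ih =>
      rintro N l hN ⟨_, ⟨i, rfl⟩, _, ⟨j, rfl⟩, h1, h2, h3, h4, h5, h6⟩
      have hij : i < j := (grid_mono K).reflect_lt h2
      have := upcrossingsBefore_lt_of_exists_upcrossing (f := fun j => M (grid T K j)) hab
        (hN i h1) h4 hij.le h5
      obtain ⟨N', hN'⟩ := ih (j + 1) _ (fun j' hj' => (grid_mono K).reflect_lt hj') h6
      exact ⟨N', by omega⟩
  obtain ⟨N', hN'⟩ := key n 0 ⊥ (fun _ _ => Nat.zero_le _) h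
  have h1 : (n : ENNReal) ≤ (upcrossingsBefore a b (fun j => M (grid T K j)) N' ω : ENNReal) := by
    exact_mod_cast (Nat.le_add_left _ _).trans hN'
  exact h1.trans (le_iSup (fun N =>
    (upcrossingsBefore a b (fun j => M (grid T K j)) N ω : ENNReal)) N')

/-- The one-sided limits bound `f` near each point, and compactness of `[0, T]` makes the bound
global. -/
lemma IsCadlag.exists_bound {f : Time T → ℝ} (hf : IsCadlag f) : ∃ C, ∀ t, |f t| ≤ C := by
  have key : ∃ C, ∀ t ∈ (Set.univ : Set (Time T)), |f t| ≤ C := by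
    refine isCompact_univ.induction_on (p := fun s => ∃ C, ∀ t ∈ s, |f t| ≤ C) ⟨0, by simp⟩
      (fun s t hst ⟨C, hC⟩ => ⟨C, fun x hx => hC x (hst hx)⟩)
      (fun s t ⟨C, hC⟩ ⟨C', hC'⟩ => ⟨max C C', fun x hx => ?_⟩) (fun t _ => ?_)
    · rcases hx with hx | hx
      · exact (hC x hx).trans (le_max_left _ _)
      · exact (hC' x hx).trans (le_max_right _ _)
    · obtain ⟨h1, l, h2⟩ := hf t
      have e1 : ∀ᶠ s in 𝓝[≥] t, |f s| ≤ |f t| + 1 := by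
        have := (h1.abs).eventually_lt_const (lt_add_one |f t|)
        filter_upwards [this] with s hs using hs.le
      have e2 : ∀ᶠ s in 𝓝[<] t, |f s| ≤ |l| + 1 := by
        have := (h2.abs).eventually_lt_const (lt_add_one |l|)
        filter_upwards [this] with s hs using hs.le
      have e3 : ∀ᶠ s in 𝓝 t, |f s| ≤ max (|f t| + 1) (|l| + 1) := by
        rw [← nhdsLT_sup_nhdsGE t, eventually_sup]
        constructor
        · filter_upwards [e2] with s hs using hs.trans (le_max_right _ _)
        · filter_upwards [e1] with s hs using hs.trans (le_max_left _ _)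
      exact ⟨_, mem_nhdsWithin_of_mem_nhds e3, _, fun s hs => hs⟩
  obtain ⟨C, hC⟩ := key
  exact ⟨C, fun t => hC t trivial⟩

lemma isCadlag_of_continuous {f : Time T → ℝ} (hf : Continuous f) : IsCadlag f := fun t =>
  ⟨hf.continuousWithinAt, f t, hf.continuousAt.tendsto.mono_left nhdsWithin_le_nhds⟩

lemma IsCadlag.add {f g : Time T → ℝ} (hf : IsCadlag f) (hg : IsCadlag g) :
    IsCadlag (fun t => f t + g t) := fun t => by
  obtain ⟨h1, l, h2⟩ := hf t
  obtain ⟨h3, l', h4⟩ := hg t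
  exact ⟨h1.add h3, l + l', h2.add h4⟩

lemma IsCadlag.const_mul {f : Time T → ℝ} (hf : IsCadlag f) (c : ℝ) :
    IsCadlag (fun t => c * f t) := fun t => by
  obtain ⟨h1, l, h2⟩ := hf t
  exact ⟨h1.const_mul c, c * l, h2.const_mul c⟩

end Paths

/-! ### Progressive measurability and modifications under the usual conditions. -/

section Progressive

variable {Ω : Type*} {T : ℝ} [Fact (0 < T)]

lemma tendsto_grid_gridIndex_Ici (t : Time T) :
    Tendsto (fun K => grid T K (gridIndex K t)) atTop (𝓝[≥] t) := by
  rcases eq_or_lt_of_le (le_top : t ≤ ⊤) with h | h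
  · have : (fun K => grid T K (gridIndex K t)) = fun _ => t := by
      ext1 K
      rcases (coe_grid_gridIndex K t).2 with h' | h'
      · rw [h', h]
      · rw [h] at h'; exact absurd h' not_top_lt
    rw [this]
    exact tendsto_nhdsWithin_of_tendsto_nhds_of_eventually_within _ tendsto_const_nhds
      (Eventually.of_forall fun _ => Set.self_mem_Ici)
  · exact (tendsto_grid_gridIndex h).mono_right
      (nhdsWithin_mono _ fun _ h => Set.mem_Ici.2 (Set.mem_Ioi.1 h.2).le)

lemma measurable_gridIndex (K : ℕ) : Measurable (gridIndex (T := T) K) := by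
  unfold gridIndex
  exact (Nat.measurable_floor.comp ((measurable_subtype_coe.mul_const _).div_const _)).add_const _

/-- Time is approximated from the right by the next grid point, which takes countably many values.
Capping it at `i` ensures that only the values of `u` up to time `i` enter. -/
lemma stronglyMeasurable_of_rightContinuous [MeasurableSpace Ω] {u : Time T → Ω → ℝ} (i : Time T)
    (hu : ∀ t ≤ i, Measurable (u t))
    (hr : ∀ ω t, ContinuousWithinAt (fun t => u t ω) (Set.Ici t) t) :
    StronglyMeasurable fun p : Set.Iic i × Ω => u p.1 p.2 := by
  refine stronglyMeasurable_of_tendsto atTop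
    (f := fun K (p : Set.Iic i × Ω) => u (min (grid T K (gridIndex K (p.1 : Time T))) i) p.2) (fun K => ?_) ?_
  · have h1 : Measurable fun q : ℕ × Ω => u (min (grid T K q.1) i) q.2 :=
      measurable_from_prod_countable_right fun n =>
        hu (min (grid T K n) i) (min_le_right _ _)
    have h2 : Measurable fun p : Set.Iic i × Ω => (gridIndex K (p.1 : Time T), p.2) :=
      ((measurable_gridIndex K).comp (measurable_subtype_coe.comp measurable_fst)).prodMk
        measurable_snd
    exact (h1.comp h2).stronglyMeasurable
  · rw [tendsto_pi_nhds]
    rintro ⟨⟨t, ht⟩, ω⟩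
    have ht' : t ≤ i := ht
    refine (hr ω t).tendsto.comp ?_
    have h := tendsto_grid_gridIndex_Ici t
    rw [tendsto_nhdsWithin_iff] at h ⊢
    refine ⟨?_, ?_⟩
    · have := h.1.min (tendsto_const_nhds (x := i))
      rwa [min_eq_left ht'] at this
    · filter_upwards [h.2] with K hK using le_min hK ht'

variable {mΩ : MeasurableSpace Ω} {𝓕 : Filtration (Time T) mΩ} {μ : Measure Ω}

lemma isStronglyProgressive_of_isCadlag {u : Time T → Ω → ℝ} (hu : StronglyAdapted 𝓕 u)
    (hc : ∀ ω, IsCadlag fun t => u t ω) : IsStronglyProgressive 𝓕 u := fun i =>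
  @stronglyMeasurable_of_rightContinuous Ω T _ (𝓕 i) u i
    (fun t ht => ((hu t).mono (𝓕.mono ht)).measurable) (fun ω t => (hc ω t).1)

lemma IsCadlag.measurable {f : Time T → ℝ} (hf : IsCadlag f) : Measurable f := by
  have h := (stronglyMeasurable_of_rightContinuous (Ω := Unit) (u := fun t _ => f t) ⊤
    (fun t _ => measurable_const) (fun _ t => (hf t).1)).measurable
  have h2 : Measurable fun t : Time T => ((⟨t, Set.mem_Iic.2 le_top⟩ : Set.Iic (⊤ : Time T)), ()) :=
    (Measurable.subtype_mk measurable_id).prodMk measurable_const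
  exact h.comp h2

lemma UsualConditions.measurableSet_of_ae (h : UsualConditions 𝓕 μ) {p : Ω → Prop}
    (hp : ∀ᵐ ω ∂μ, p ω) (t : Time T) : MeasurableSet[𝓕 t] {ω | p ω} := by
  have h1 : MeasurableSet[𝓕 ⊥] {ω | p ω}ᶜ := h.complete _ (ae_iff.1 hp)
  exact (𝓕.mono bot_le) _ (MeasurableSet.compl_iff.1 h1)

lemma UsualConditions.stronglyMeasurable_of_ae_eq (h : UsualConditions 𝓕 μ) {f g : Ω → ℝ}
    {t : Time T} (hf : StronglyMeasurable[𝓕 t] f) (hfg : f =ᵐ[μ] g) :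
    StronglyMeasurable[𝓕 t] g := by
  refine @Measurable.stronglyMeasurable _ _ _ (𝓕 t) _ _ _ _ _ ?_
  intro s hs
  have h1 : MeasurableSet[𝓕 t] {ω | f ω = g ω} := h.measurableSet_of_ae hfg t
  have h2 : MeasurableSet[𝓕 t] (g ⁻¹' s ∩ {ω | f ω = g ω}ᶜ) := by
    refine (𝓕.mono bot_le) _ (h.complete _ (measure_mono_null Set.inter_subset_right ?_))
    exact hfg
  have h3 : g ⁻¹' s = (f ⁻¹' s ∩ {ω | f ω = g ω}) ∪ (g ⁻¹' s ∩ {ω | f ω = g ω}ᶜ) := by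
    ext ω
    by_cases hω : f ω = g ω
    · simp [hω]
    · simp [hω]
  rw [h3]
  exact ((hf.measurable hs).inter h1).union h2

/-- The bad paths are replaced by zero. They form a null set, so completeness preserves adaptedness.
-/
lemma CadlagAdapted.exists_isCadlag (h : UsualConditions 𝓕 μ) {X : Time T → Ω → ℝ}
    (hX : CadlagAdapted 𝓕 μ X) : ∃ X' : Time T → Ω → ℝ, IsStronglyProgressive 𝓕 X' ∧
      (∀ ω, IsCadlag fun t => X' t ω) ∧ Indist μ X X' := by
  classical
  let X' : Time T → Ω → ℝ := fun t ω => if IsCadlag fun t => X t ω then X t ω else 0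
  have hc : ∀ ω, IsCadlag fun t => X' t ω := fun ω => by
    by_cases hω : IsCadlag fun t => X t ω
    · simpa only [X', if_pos hω] using hω
    · simpa only [X', if_neg hω] using isCadlag_of_continuous continuous_const
  have hi : Indist μ X X' := by
    filter_upwards [hX.cadlag] with ω hω t
    simp only [X', if_pos hω]
  refine ⟨X', isStronglyProgressive_of_isCadlag (fun t => ?_) hc, hc, hi⟩
  refine h.stronglyMeasurable_of_ae_eq (hX.adapted t) ?_
  filter_upwards [hi] with ω hω using hω t

/-- The σ-algebra of progressively measurable sets. -/
abbrev progressiveSigma (𝓕 : Filtration (Time T) mΩ) : MeasurableSpace (Time T × Ω) :=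
  ⨅ i : Time T, MeasurableSpace.map (fun p : Set.Iic i × Ω => ((p.1 : Time T), p.2))
    (Subtype.instMeasurableSpace.prod (𝓕 i))

/-- Progressive measurability becomes measurability for a single σ-algebra, so that admissible rates
form an `L²` space of a sub-σ-algebra and hence a closed subspace. -/
lemma measurable_progressiveSigma_iff {f : Time T × Ω → ℝ} :
    Measurable[progressiveSigma 𝓕] f ↔ IsStronglyProgressive 𝓕 (fun t ω => f (t, ω)) := by
  rw [measurable_iff_comap_le, progressiveSigma, le_iInf_iff]
  refine forall_congr' fun i => ?_
  rw [← MeasurableSpace.comap_le_iff_le_map, MeasurableSpace.comap_comp, ← measurable_iff_comap_le]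
  exact ⟨fun h => @Measurable.stronglyMeasurable _ _ _
    (Subtype.instMeasurableSpace.prod (𝓕 i)) _ _ _ _ _ h, fun h => StronglyMeasurable.measurable h⟩

lemma progressiveSigma_le (𝓕 : Filtration (Time T) mΩ) :
    progressiveSigma 𝓕 ≤ (inferInstance : MeasurableSpace (Time T × Ω)) := by
  intro s hs
  have h1 : MeasurableSet[Subtype.instMeasurableSpace.prod (𝓕 ⊤)]
      ((fun p : Set.Iic (⊤ : Time T) × Ω => ((p.1 : Time T), p.2)) ⁻¹' s) :=
    (iInf_le (fun i : Time T => MeasurableSpace.map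
      (fun p : Set.Iic i × Ω => ((p.1 : Time T), p.2)) (Subtype.instMeasurableSpace.prod (𝓕 i))) ⊤)
      s hs
  have h2 : MeasurableSet ((fun p : Set.Iic (⊤ : Time T) × Ω => ((p.1 : Time T), p.2)) ⁻¹' s) :=
    (sup_le_sup_left (MeasurableSpace.comap_mono (𝓕.le ⊤)) _) _ h1
  have h3 : Measurable fun p : Time T × Ω =>
      (((⟨p.1, Set.mem_Iic.2 le_top⟩ : Set.Iic (⊤ : Time T))), p.2) :=
    (Measurable.subtype_mk measurable_fst).prodMk measurable_snd
  exact h3 h2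

lemma stronglyMeasurable_uncurry {v : Time T → Ω → ℝ} (hv : IsStronglyProgressive 𝓕 v) :
    StronglyMeasurable fun p : Time T × Ω => v p.1 p.2 :=
  ((measurable_progressiveSigma_iff (f := fun p => v p.1 p.2)).2 hv |>.mono
    (progressiveSigma_le 𝓕) le_rfl).stronglyMeasurable

end Progressive

/-! ### Càdlàg versions of closed martingales. -/

section CadlagVersion

variable {Ω : Type*} {T : ℝ} [Fact (0 < T)]
  {mΩ : MeasurableSpace Ω} {𝓕 : Filtration (Time T) mΩ} {μ : Measure Ω} [IsProbabilityMeasure μ]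

/-- The discrete filtration obtained by restricting `𝓕` to a dyadic grid. -/
def gridFiltration (𝓕 : Filtration (Time T) mΩ) (K : ℕ) : Filtration ℕ mΩ where
  seq j := 𝓕 (grid T K j)
  mono' _ _ hij := 𝓕.mono (grid_mono K hij)
  le' _ := 𝓕.le _

lemma martingale_grid (Z : Ω → ℝ) (K : ℕ) :
    Martingale (fun j => μ[Z | 𝓕 (grid T K j)]) (gridFiltration 𝓕 K) μ :=
  martingale_condExp Z (gridFiltration 𝓕 K) μ

/-- Doob's upcrossing inequality bounds the expected number of upcrossings on every grid by `(‖Z‖₁ +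
|a|) / (b - a)`, uniformly in the mesh. By Fatou the liminf over the grids is a.s. finite, and it
dominates the length of every dyadic chain. -/
lemma ae_exists_not_upcrosses (Z : Ω → ℝ) (hZ : Integrable Z μ) {a b : ℝ} (hab : a < b) :
    ∀ᵐ ω ∂μ, ∃ n, ¬ Upcrosses (fun t => (μ[Z | 𝓕 t]) ω) (dyadic T) a b ⊤ n ⊥ := by
  let M : Time T → Ω → ℝ := fun t => μ[Z | 𝓕 t]
  let U : ℕ → Ω → ENNReal := fun K => upcrossings a b (fun j => M (grid T K j))
  have hU : ∀ K, Measurable (U K) := fun K =>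
    (martingale_grid (𝓕 := 𝓕) (μ := μ) Z K).1.measurable_upcrossings hab
  let C : ENNReal := (eLpNorm Z 1 μ + ‖a‖ₑ) / ENNReal.ofReal (b - a)
  have hb : ENNReal.ofReal (b - a) ≠ 0 := by simpa using hab
  have hC : C < ⊤ := by
    refine ENNReal.div_lt_top ?_ hb
    exact ENNReal.add_ne_top.2 ⟨(memLp_one_iff_integrable.2 hZ).eLpNorm_ne_top, enorm_ne_top⟩
  have hUC : ∀ K, ∫⁻ ω, U K ω ∂μ ≤ C := fun K => by
    rw [ENNReal.le_div_iff_mul_le (Or.inl hb) (Or.inl ENNReal.ofReal_ne_top), mul_comm]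
    refine ((martingale_grid (𝓕 := 𝓕) (μ := μ) Z
      K).submartingale.mul_lintegral_upcrossings_le_lintegral_pos_part a b).trans (iSup_le fun N => ?_)
    calc ∫⁻ ω, ENNReal.ofReal (M (grid T K N) ω - a)⁺ ∂μ
        ≤ ∫⁻ ω, (‖M (grid T K N) ω‖ₑ + ‖a‖ₑ) ∂μ := by
          refine lintegral_mono fun ω => ?_
          rw [← ofReal_norm, ← ofReal_norm,
            ← ENNReal.ofReal_add (norm_nonneg _) (norm_nonneg _)]
          refine ENNReal.ofReal_le_ofReal (sup_le ?_ (by positivity))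
          have h1 := le_abs_self (M (grid T K N) ω)
          have h2 := neg_le_abs a
          simp only [Real.norm_eq_abs]
          linarith
      _ = eLpNorm (M (grid T K N)) 1 μ + ‖a‖ₑ := by
          rw [lintegral_add_right _ measurable_const, eLpNorm_one_eq_lintegral_enorm]
          simp
      _ ≤ eLpNorm Z 1 μ + ‖a‖ₑ := by
          gcongr
          exact eLpNorm_condExp_le_eLpNorm _ le_rfl
  have hlim : ∫⁻ ω, liminf (fun K => U K ω) atTop ∂μ < ⊤ := by
    refine ((lintegral_liminf_le hU).trans ?_).trans_lt hC
    exact (liminf_le_liminf (Eventually.of_forall hUC)).trans (by simp)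
  have hfin := ae_lt_top (Measurable.liminf hU) hlim.ne
  filter_upwards [hfin] with ω hω
  by_contra! hcon
  refine (lt_irrefl _ (hω.trans_le (le_of_eq (ENNReal.eq_top_of_forall_nnreal_le fun r => ?_).symm)))
  obtain ⟨n, hn⟩ := exists_nat_ge r
  obtain ⟨K₀, hK₀⟩ := (hcon n).exists_grid
  have h1 : (n : ENNReal) ≤ liminf (fun K => U K ω) atTop := by
    refine le_liminf_of_le (by isBoundedDefault) ?_
    filter_upwards [eventually_ge_atTop K₀] with K hK
    exact (hK₀ K hK).le_upcrossings (M := M) hab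
  exact (by exact_mod_cast hn : (r : ENNReal) ≤ n).trans h1

/-- Doob's maximal inequality for `|E[Z | 𝓕_t]|` gives a bound `‖Z‖₁ / n` on the probability of
reaching level `n`, the same for all grids. -/
lemma ae_bounded_dyadic (Z : Ω → ℝ) (hZ : Integrable Z μ) :
    ∀ᵐ ω ∂μ, ∃ C, ∀ d ∈ dyadic T, |(μ[Z | 𝓕 d]) ω| ≤ C := by
  let M : Time T → Ω → ℝ := fun t => μ[Z | 𝓕 t]
  let f : ℕ → ℕ → Ω → ℝ := fun K j ω => |M (grid T K j) ω|
  have hsub : ∀ K, Submartingale (f K) (gridFiltration 𝓕 K) μ := fun K => by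
    have h := martingale_grid (𝓕 := 𝓕) (μ := μ) Z K
    exact h.submartingale.sup h.neg.submartingale
  let A : ℕ → ℕ → Set Ω := fun n K => {ω | ((n : NNReal) : ℝ) ≤
    (Finset.range (2 ^ K + 1)).sup' Finset.nonempty_range_add_one fun k => f K k ω}
  have hA : ∀ n K : ℕ, (n : ENNReal) * μ (A n K) ≤ eLpNorm Z 1 μ := fun n K => by
    have h1 := maximal_ineq (hsub K) (fun j ω => abs_nonneg _) (ε := n) (2 ^ K)
    have h2 : ENNReal.ofReal (∫ ω in A n K, f K (2 ^ K) ω ∂μ) ≤ eLpNorm Z 1 μ := by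
      have hint : Integrable (f K (2 ^ K)) μ := (hsub K).integrable _
      calc ENNReal.ofReal (∫ ω in A n K, f K (2 ^ K) ω ∂μ)
          ≤ ENNReal.ofReal (∫ ω, f K (2 ^ K) ω ∂μ) := ENNReal.ofReal_le_ofReal
            (setIntegral_le_integral hint (Eventually.of_forall fun _ => abs_nonneg _))
        _ = eLpNorm (M (grid T K (2 ^ K))) 1 μ := by
            rw [eLpNorm_one_eq_lintegral_enorm, ofReal_integral_eq_lintegral_ofReal hint
              (Eventually.of_forall fun _ => abs_nonneg _)]
            refine lintegral_congr fun ω => ?_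
            rw [← ofReal_norm]; rfl
        _ ≤ eLpNorm Z 1 μ := eLpNorm_condExp_le_eLpNorm _ le_rfl
    refine le_trans (le_of_eq ?_) (h1.trans h2)
    simp [A]
  -- A dyadic point where the level `n` is exceeded belongs to all sufficiently fine grids, so the
  -- bad `ω` lie in the increasing union of these sets, whose measure obeys the same bound.
  let S : ℕ → ℕ → Set Ω := fun n K₀ => ⋂ K ≥ K₀, A n K
  have hS : ∀ n : ℕ, (n : ENNReal) * μ (⋃ K₀, S n K₀) ≤ eLpNorm Z 1 μ := fun n => by
    have hmono : Monotone (S n) := fun i j hij =>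
      Set.biInter_subset_biInter_left fun K (hK : K ≥ j) => le_trans hij hK
    rw [hmono.measure_iUnion, ENNReal.mul_iSup]
    refine iSup_le fun K₀ => le_trans ?_ (hA n K₀)
    gcongr
    exact Set.biInter_subset_of_mem (le_refl K₀)
  have hnull : μ (⋂ n, ⋃ K₀, S n K₀) = 0 := by
    by_contra hne
    have hlt : eLpNorm Z 1 μ / μ (⋂ n, ⋃ K₀, S n K₀) < ⊤ :=
      ENNReal.div_lt_top (memLp_one_iff_integrable.2 hZ).eLpNorm_ne_top hne
    obtain ⟨n, hn⟩ := ENNReal.exists_nat_gt hlt.ne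
    rw [ENNReal.div_lt_iff (Or.inl hne) (Or.inl (measure_ne_top _ _))] at hn
    have h3 : (n : ENNReal) * μ (⋂ n, ⋃ K₀, S n K₀) ≤ eLpNorm Z 1 μ :=
      le_trans (by gcongr; exact Set.iInter_subset _ n) (hS n)
    exact absurd hn (not_lt.2 h3)
  refine measure_mono_null (fun ω hω => ?_) hnull
  have hω' : ¬ ∃ C, ∀ d ∈ dyadic T, |M d ω| ≤ C := hω
  push Not at hω'
  rw [Set.mem_iInter]
  intro n
  obtain ⟨d, hd, hnd⟩ := hω' n
  obtain ⟨K₀, hK₀⟩ := exists_grid_level hd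
  refine Set.mem_iUnion.2 ⟨K₀, Set.mem_iInter₂.2 fun K hK => ?_⟩
  obtain ⟨j, hj⟩ := hK₀ K hK
  -- The maximal inequality covers only the indices up to `2 ^ K`; all later grid points equal `T`,
  -- so capping the index changes nothing.
  have hmin : grid T K (min j (2 ^ K)) = d := by
    rcases le_total j (2 ^ K) with h | h
    · rw [min_eq_left h, hj]
    · rw [min_eq_right h, grid_eq_top le_rfl, ← hj, grid_eq_top h]
  change ((n : NNReal) : ℝ) ≤ _
  rw [Finset.le_sup'_iff]
  refine ⟨min j (2 ^ K), by simp, ?_⟩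
  simp only [f, hmin]
  simpa using hnd.le

/-- Under the usual conditions every martingale closed by a random variable has a càdlàg version. -/
theorem exists_cadlag_condExp (h𝓕 : UsualConditions 𝓕 μ) {Z : Ω → ℝ} (hZ : Integrable Z μ) :
    ∃ M : Time T → Ω → ℝ, StronglyAdapted 𝓕 M ∧ (∀ ω, IsCadlag fun t => M t ω) ∧
      ∀ t, M t =ᵐ[μ] μ[Z | 𝓕 t] := by
  classical
  let N : Time T → Ω → ℝ := fun t => μ[Z | 𝓕 t]
  let good : Ω → Prop := fun ω =>
    (∀ t < ⊤, ∃ c, Tendsto (fun s => N s ω) (𝓝[dyadic T ∩ Set.Ioi t] t) (𝓝 c)) ∧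
    (∀ t, ⊥ < t → ∃ c, Tendsto (fun s => N s ω) (𝓝[dyadic T ∩ Set.Iio t] t) (𝓝 c))
  have hgood : ∀ᵐ ω ∂μ, good ω := by
    have h1 : ∀ᵐ ω ∂μ, ∀ a b : ℚ, a < b →
        ∃ n, ¬ Upcrosses (fun t => N t ω) (dyadic T) a b ⊤ n ⊥ := by
      rw [ae_all_iff]; intro a
      rw [ae_all_iff]; intro b
      by_cases hab : a < b
      · filter_upwards [ae_exists_not_upcrosses (𝓕 := 𝓕) Z hZ
          (show (a : ℝ) < b by exact_mod_cast hab)] with ω hω _ using hω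
      · exact Eventually.of_forall fun ω h => absurd h hab
    filter_upwards [h1, ae_bounded_dyadic (𝓕 := 𝓕) Z hZ] with ω hω ⟨C, hC⟩
    exact exists_limits_of_upcrosses C hC hω
  let M : Time T → Ω → ℝ := fun t ω => if good ω then rightLimits (fun s => N s ω) t else 0
  have hMc : ∀ ω, IsCadlag fun t => M t ω := fun ω => by
    by_cases hω : good ω
    · simp only [M, if_pos hω]
      exact isCadlag_rightLimits hω.1 hω.2
    · simp only [M, if_neg hω]
      exact isCadlag_of_continuous continuous_const
  have hMlim : ∀ t < ⊤, ∀ ω, Tendsto (fun K => if good ω then N (grid T K (gridIndex K t)) ω else 0)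
      atTop (𝓝 (M t ω)) := fun t ht ω => by
    by_cases hω : good ω
    · simp only [M, if_pos hω]
      exact (tendsto_rightLimits ht (hω.1 t ht)).comp (tendsto_grid_gridIndex ht)
    · simp only [M, if_neg hω]
      exact tendsto_const_nhds
  have hMtop : M ⊤ =ᵐ[μ] N ⊤ := by
    filter_upwards [hgood] with ω hω
    simp only [M, if_pos hω, rightLimits, if_true]
  have hM : ∀ t, StronglyMeasurable[𝓕 t] (M t) := fun t => by
    rcases eq_or_lt_of_le (le_top : t ≤ ⊤) with rfl | ht
    · exact h𝓕.stronglyMeasurable_of_ae_eq stronglyMeasurable_condExp hMtop.symm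
    · refine @Measurable.stronglyMeasurable _ _ _ (𝓕 t) _ _ _ _ _ ?_
      -- By right continuity it suffices to be `𝓕_u`-measurable for every `u > t`. From some level
      -- on the grid points that approximate `t` are at most `u`, so the sequence is shifted by that
      -- level.
      have := h𝓕.rightContinuous
      have hne : (𝓝[>] t).NeBot := (neBot_dyadic_Ioi ht).mono
        (nhdsWithin_mono _ Set.inter_subset_right)
      rw [← Filtration.IsRightContinuous.eq (𝓕 := 𝓕), Filtration.rightCont_eq_of_neBot_nhdsGT,
        measurable_iff_comap_le]
      refine le_iInf₂ fun u hu => ?_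
      rw [← measurable_iff_comap_le]
      have hev : ∀ᶠ K in atTop, grid T K (gridIndex K t) ≤ u :=
        ((tendsto_nhdsWithin_iff.1 (tendsto_grid_gridIndex ht)).1.eventually_lt_const hu).mono
          fun _ h => h.le
      obtain ⟨K₀, hK₀⟩ := eventually_atTop.1 hev
      refine @measurable_of_tendsto_metrizable _ _ (𝓕 u) _ _ _ _
        (fun K ω => if good ω then N (grid T (K + K₀) (gridIndex (K + K₀) t)) ω else 0) _
        (fun K => ?_) (tendsto_pi_nhds.2 fun ω =>
          (hMlim t ht ω).comp (tendsto_add_atTop_nat K₀))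
      refine Measurable.ite (h𝓕.measurableSet_of_ae hgood u) ?_ measurable_const
      exact (stronglyMeasurable_condExp.mono (𝓕.mono (hK₀ _ (Nat.le_add_left _ _)))).measurable
  refine ⟨M, hM, hMc, fun t => ?_⟩
  rcases eq_or_lt_of_le (le_top : t ≤ ⊤) with rfl | ht
  · exact hMtop
  let d : ℕ → Time T := fun K => grid T K (gridIndex K t)
  have htd : ∀ K, t ≤ d K := fun K => by
    rcases (coe_grid_gridIndex K t).2 with h | h
    · simp only [d, h]; exact le_top
    · exact h.le
  -- Uniform integrability upgrades the a.s. limit along `d K` to an `L¹` limit. The integral over a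
  -- set of `𝓕 t` is that of `Z` for every `K`, hence also for `M t`.
  have hUI : UniformIntegrable (fun K => μ[Z | 𝓕 (d K)]) 1 μ :=
    hZ.uniformIntegrable_condExp fun K => 𝓕.le (d K)
  have hlim : ∀ᵐ ω ∂μ, Tendsto (fun K => N (d K) ω) atTop (𝓝 (M t ω)) := by
    filter_upwards [hgood] with ω hω
    simpa only [if_pos hω] using hMlim t ht ω
  have hMm : AEStronglyMeasurable (M t) μ := ((hM t).mono (𝓕.le t)).aestronglyMeasurable
  have hMint : Integrable (M t) μ := hUI.integrable_of_ae_tendsto hlim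
  have hL1 := tendsto_Lp_finite_of_tendsto_ae le_rfl ENNReal.one_ne_top hUI.1
    (memLp_one_iff_integrable.2 hMint) hUI.2.1 hlim
  refine ae_eq_condExp_of_forall_setIntegral_eq (𝓕.le t) hZ (fun s _ _ => hMint.integrableOn)
    (fun s hs _ => ?_) (hM t).aestronglyMeasurable
  refine tendsto_nhds_unique (tendsto_setIntegral_of_L1' (M t) hMm
    (Eventually.of_forall fun K => integrable_condExp) hL1 s) ?_
  refine tendsto_const_nhds.congr fun K => ?_
  exact (setIntegral_condExp (𝓕.le _) hZ (𝓕.mono (htd K) _ hs)).symm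

end CadlagVersion

/-! ### Bounded integral kernels on `[0, T]` and their quadratic forms. -/

section Kernels

variable {T : ℝ} [Fact (0 < T)]

instance isFiniteMeasure_time : IsFiniteMeasure (volume : Measure (Time T)) := by
  constructor
  have h : (volume : Measure (Time T)) Set.univ = volume (Set.Icc (0 : ℝ) T) :=
    Measure.Subtype.volume_univ measurableSet_Icc.nullMeasurableSet
  rw [h]
  exact isCompact_Icc.measure_lt_top

lemma volume_singleton_time (t : Time T) : (volume : Measure (Time T)) {t} = 0 := by
  have h : (volume : Measure (Time T)) {t} = volume ((↑) '' ({t} : Set (Time T)) : Set ℝ) :=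
    comap_subtype_coe_apply measurableSet_Icc volume _
  rw [h, Set.image_singleton, Real.volume_singleton]

lemma ae_ne_time (t : Time T) : ∀ᵐ s : Time T, s ≠ t := by
  rw [ae_iff]
  simpa using volume_singleton_time t

lemma setIntegral_time (S : Set (Time T)) (g : ℝ → ℝ) :
    ∫ s in S, g s = ∫ s in ((↑) '' S : Set ℝ), g s := by
  have he := MeasurableEmbedding.subtype_coe (measurableSet_Icc (a := (0 : ℝ)) (b := T))
  have h1 : S = ((↑) : Time T → ℝ) ⁻¹' ((↑) '' S) :=
    (Set.preimage_image_eq S Subtype.val_injective).symm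
  have h2 : Measure.map ((↑) : Time T → ℝ) volume = volume.restrict (Set.Icc 0 T) :=
    map_comap_subtype_coe measurableSet_Icc volume
  conv_lhs => rw [h1]
  rw [← he.setIntegral_map, h2, Measure.restrict_restrict_of_subset]
  rintro _ ⟨s, _, rfl⟩
  exact s.2

lemma integral_Icc_time {a b : Time T} (hab : a ≤ b) (g : ℝ → ℝ) :
    ∫ s in Set.Icc a b, g s = ∫ s in (a : ℝ)..b, g s := by
  rw [setIntegral_time, intervalIntegral.integral_of_le (Subtype.coe_le_coe.2 hab),
    ← integral_Icc_eq_integral_Ioc]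
  congr 2
  ext r
  constructor
  · rintro ⟨s, hs, rfl⟩
    exact ⟨hs.1, hs.2⟩
  · rintro hr
    exact ⟨⟨r, a.2.1.trans hr.1, hr.2.trans b.2.2⟩, ⟨hr.1, hr.2⟩, rfl⟩

/-- Bounded measurable kernels on `[0, T]`. -/
structure IsBddKernel (k : Time T → Time T → ℝ) : Prop where
  measurable : Measurable fun p : Time T × Time T => k p.1 p.2
  bdd : ∃ C, ∀ t s, |k t s| ≤ C

lemma IsBddKernel.swap {k : Time T → Time T → ℝ} (hk : IsBddKernel k) :
    IsBddKernel fun t s => k s t :=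
  ⟨hk.measurable.comp measurable_swap, hk.bdd.imp fun _ h t s => h s t⟩

lemma IsBddKernel.add {k k' : Time T → Time T → ℝ} (hk : IsBddKernel k) (hk' : IsBddKernel k') :
    IsBddKernel fun t s => k t s + k' t s := by
  obtain ⟨C, hC⟩ := hk.bdd
  obtain ⟨C', hC'⟩ := hk'.bdd
  exact ⟨hk.measurable.add hk'.measurable, C + C', fun t s =>
    (abs_add_le _ _).trans (add_le_add (hC t s) (hC' t s))⟩

lemma IsBddKernel.const_mul {k : Time T → Time T → ℝ} (hk : IsBddKernel k) (c : ℝ) :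
    IsBddKernel fun t s => c * k t s := by
  obtain ⟨C, hC⟩ := hk.bdd
  refine ⟨hk.measurable.const_mul c, |c| * C, fun t s => ?_⟩
  rw [abs_mul]
  exact mul_le_mul_of_nonneg_left (hC t s) (abs_nonneg _)

lemma isBddKernel_of_continuous {k : Time T → Time T → ℝ}
    (hk : Continuous fun p : Time T × Time T => k p.1 p.2) : IsBddKernel k := by
  refine ⟨hk.measurable, ?_⟩
  obtain ⟨C, hC⟩ := isCompact_univ.exists_bound_of_continuousOn hk.continuousOn
  exact ⟨C, fun t s => hC (t, s) trivial⟩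

lemma IsBddKernel.indicator_le {k : Time T → Time T → ℝ} (hk : IsBddKernel k) :
    IsBddKernel fun t s => (Set.Iic t).indicator (k t) s := by
  obtain ⟨C, hC⟩ := hk.bdd
  constructor
  · have : (fun p : Time T × Time T => (Set.Iic p.1).indicator (k p.1) p.2) =
        {p : Time T × Time T | p.2 ≤ p.1}.indicator (fun p => k p.1 p.2) := by
      ext p
      simp only [Set.indicator_apply, Set.mem_Iic, Set.mem_ofPred_eq]
    rw [this]
    exact hk.measurable.indicator (measurableSet_le measurable_snd measurable_fst)
  · refine ⟨C, fun t s => ?_⟩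
    by_cases h : s ∈ Set.Iic t
    · rw [Set.indicator_of_mem h]; exact hC t s
    · rw [Set.indicator_of_notMem h, abs_zero]; exact (abs_nonneg _).trans (hC t t)

lemma IsBddKernel.integrable_mul {k : Time T → Time T → ℝ} (hk : IsBddKernel k)
    {f : Time T → ℝ} (hf : Integrable f) (t : Time T) : Integrable fun s => k t s * f s := by
  obtain ⟨C, hC⟩ := hk.bdd
  exact hf.bdd_mul (c := C) (hk.measurable.comp measurable_prodMk_left).aestronglyMeasurable
    (Eventually.of_forall fun s => hC t s)

lemma IsBddKernel.abs_integral_le {k : Time T → Time T → ℝ} {C : ℝ}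
    (hC : ∀ t s, |k t s| ≤ C) {f : Time T → ℝ} (hf : Integrable f) (t : Time T) :
    |∫ s, k t s * f s| ≤ C * ∫ s, |f s| := by
  rw [← integral_const_mul, ← Real.norm_eq_abs]
  refine norm_integral_le_of_norm_le (hf.abs.const_mul C) (Eventually.of_forall fun s => ?_)
  rw [Real.norm_eq_abs, abs_mul]
  exact mul_le_mul_of_nonneg_right (hC t s) (abs_nonneg _)

lemma IsBddKernel.integrable_integral {k : Time T → Time T → ℝ} (hk : IsBddKernel k)
    {f : Time T → ℝ} (hf : Integrable f) : Integrable fun t => ∫ s, k t s * f s := by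
  obtain ⟨C, hC⟩ := hk.bdd
  refine Integrable.of_bound (C := C * ∫ s, |f s|) ?_
    (Eventually.of_forall fun t => IsBddKernel.abs_integral_le hC hf t)
  have h1 : AEStronglyMeasurable (fun p : Time T × Time T => k p.1 p.2 * f p.2)
      ((volume : Measure (Time T)).prod volume) :=
    hk.measurable.aestronglyMeasurable.mul hf.1.comp_snd
  exact h1.integral_prod_right'

lemma IsBddKernel.integral_swap {k : Time T → Time T → ℝ} (hk : IsBddKernel k)
    {f g : Time T → ℝ} (hf : Integrable f) (hg : Integrable g) :
    ∫ t, g t * ∫ s, k t s * f s = ∫ s, f s * ∫ t, k t s * g t := by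
  obtain ⟨C, hC⟩ := hk.bdd
  have h1 : Integrable (fun p : Time T × Time T => k p.1 p.2 * (g p.1 * f p.2))
      ((volume : Measure (Time T)).prod volume) :=
    (hg.mul_prod hf).bdd_mul (c := C) hk.measurable.aestronglyMeasurable
      (Eventually.of_forall fun p => hC p.1 p.2)
  simp_rw [← integral_const_mul]
  have h2 := integral_integral_swap (f := fun t s => k t s * (g t * f s)) h1
  calc ∫ t, ∫ s, g t * (k t s * f s) = ∫ t, ∫ s, k t s * (g t * f s) := by
        congr with t; congr with s; ring
    _ = ∫ s, ∫ t, k t s * (g t * f s) := h2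
    _ = ∫ s, ∫ t, f s * (k t s * g t) := by
        congr with t; congr with s; ring

/-- Kernels with nonnegative quadratic form. -/
def IsPosKernel (k : Time T → Time T → ℝ) : Prop :=
  ∀ f : Time T → ℝ, Integrable f → 0 ≤ ∫ t, f t * ∫ s, k t s * f s

lemma IsPosKernel.add {k k' : Time T → Time T → ℝ} (hk : IsBddKernel k) (hk' : IsBddKernel k')
    (h : IsPosKernel k) (h' : IsPosKernel k') : IsPosKernel fun t s => k t s + k' t s := by
  intro f hf
  have hbd : ∀ {k : Time T → Time T → ℝ}, IsBddKernel k →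
      Integrable fun t => f t * ∫ s, k t s * f s := fun {k} hk => by
    obtain ⟨C, hC⟩ := hk.bdd
    exact hf.mul_bdd (c := C * ∫ s, |f s|) (hk.integrable_integral hf).1
      (Eventually.of_forall fun t => IsBddKernel.abs_integral_le hC hf t)
  have e : ∀ t, f t * ∫ s, (k t s + k' t s) * f s =
      f t * (∫ s, k t s * f s) + f t * ∫ s, k' t s * f s := fun t => by
    rw [← mul_add, ← integral_add (hk.integrable_mul hf t) (hk'.integrable_mul hf t)]
    simp_rw [add_mul]
  simp_rw [e]
  rw [integral_add (hbd hk) (hbd hk')]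
  exact add_nonneg (h f hf) (h' f hf)

lemma IsPosKernel.const_mul {k : Time T → Time T → ℝ} (h : IsPosKernel k) {c : ℝ} (hc : 0 ≤ c) :
    IsPosKernel fun t s => c * k t s := by
  intro f hf
  have e : ∀ t, f t * ∫ s, c * k t s * f s = c * (f t * ∫ s, k t s * f s) := fun t => by
    simp_rw [mul_assoc]
    rw [integral_const_mul]; ring
  simp_rw [e]
  rw [integral_const_mul]
  exact mul_nonneg hc (h f hf)

lemma IsPosKernel.congr {k k' : Time T → Time T → ℝ} (h : IsPosKernel k)
    (e : ∀ t, ∀ᵐ s : Time T, k' t s = k t s) : IsPosKernel k' := by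
  intro f hf
  have : ∀ t, ∫ s, k' t s * f s = ∫ s, k t s * f s := fun t =>
    integral_congr_ae (by filter_upwards [e t] with s hs; rw [hs])
  simp_rw [this]
  exact h f hf

/-- Transposing a kernel does not change its quadratic form, by Fubini, so the symmetrization has
twice the form. -/
lemma IsPosKernel.of_symmetrization {k : Time T → Time T → ℝ} (hk : IsBddKernel k)
    (h : IsPosKernel fun t s => k t s + k s t) : IsPosKernel k := by
  intro f hf
  have hbd : ∀ {k : Time T → Time T → ℝ}, IsBddKernel k →
      Integrable fun t => f t * ∫ s, k t s * f s := fun {k} hk => by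
    obtain ⟨C, hC⟩ := hk.bdd
    exact hf.mul_bdd (c := C * ∫ s, |f s|) (hk.integrable_integral hf).1
      (Eventually.of_forall fun t => IsBddKernel.abs_integral_le hC hf t)
  have e : ∀ t, f t * ∫ s, (k t s + k s t) * f s =
      f t * (∫ s, k t s * f s) + f t * ∫ s, k s t * f s := fun t => by
    rw [← mul_add, ← integral_add (hk.integrable_mul hf t) (hk.swap.integrable_mul hf t)]
    simp_rw [add_mul]
  have h1 := h f hf
  simp_rw [e] at h1
  rw [integral_add (hbd hk) (hbd hk.swap), ← hk.integral_swap hf hf] at h1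
  linarith

/-- Fubini diagonalizes the form of a superposition of rank-one kernels into a weighted integral of
squares. It yields positivity and also the exact value of the running inventory penalty. -/
lemma integral_mul_integral_superposition {Φ : Time T → Time T → ℝ} (hΦ : IsBddKernel Φ)
    {q : Time T → ℝ} (hq : Continuous q) {f : Time T → ℝ} (hf : Integrable f) :
    ∫ t, f t * ∫ s, (∫ u, q u * (Φ u t * Φ u s)) * f s =
      ∫ u, q u * ((∫ s, Φ u s * f s) * ∫ s, Φ u s * f s) := by
  obtain ⟨C, hC⟩ := hΦ.bdd
  let c : Time T → ℝ := fun u => ∫ s, Φ u s * f s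
  have hc : Integrable c := hΦ.integrable_integral hf
  have hqΦ : ∀ t, Integrable fun u => q u * Φ u t := fun t => by
    obtain ⟨C', hC'⟩ := (isBddKernel_of_continuous (T := T)
      (k := fun u _ => q u) (hq.comp continuous_fst)).bdd
    refine Integrable.of_bound (C := C' * C)
      (hq.measurable.mul (hΦ.measurable.comp measurable_prodMk_right)).aestronglyMeasurable
      (Eventually.of_forall fun u => ?_)
    rw [Real.norm_eq_abs, abs_mul]
    exact mul_le_mul (hC' u u) (hC u t) (abs_nonneg _) ((abs_nonneg _).trans (hC' u u))
  have hqc : Integrable fun u => q u * c u := by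
    obtain ⟨C', hC'⟩ := (isBddKernel_of_continuous (T := T)
      (k := fun u _ => q u) (hq.comp continuous_fst)).bdd
    exact hc.bdd_mul (c := C') hq.measurable.aestronglyMeasurable
      (Eventually.of_forall fun u => hC' u u)
  have e1 : ∀ t, ∫ s, (∫ u, q u * (Φ u t * Φ u s)) * f s = ∫ u, Φ u t * (q u * c u) := fun t => by
    have := hΦ.integral_swap hf (hqΦ t)
    calc ∫ s, (∫ u, q u * (Φ u t * Φ u s)) * f s
        = ∫ s, f s * ∫ u, Φ u s * (q u * Φ u t) := by
          congr with s
          rw [mul_comm]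
          congr 2 with u; ring
      _ = ∫ u, q u * Φ u t * ∫ s, Φ u s * f s := this.symm
      _ = _ := by congr with u; ring
  simp_rw [e1]
  rw [hΦ.swap.integral_swap hqc hf]
  congr with u
  change q u * c u * c u = q u * (c u * c u)
  ring

lemma isPosKernel_integral {Φ : Time T → Time T → ℝ} (hΦ : IsBddKernel Φ) {q : Time T → ℝ}
    (hq : Continuous q) (hq0 : ∀ u, 0 ≤ q u) :
    IsPosKernel fun t s => ∫ u, q u * (Φ u t * Φ u s) := by
  intro f hf
  rw [integral_mul_integral_superposition hΦ hq hf]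
  exact integral_nonneg fun u => mul_nonneg (hq0 u) (mul_self_nonneg _)

/-! ### The kernels of the game -/

lemma isPosKernel_one : IsPosKernel fun _ _ : Time T => (1 : ℝ) := by
  intro f _
  simp only [one_mul]
  rw [integral_mul_const]
  exact mul_self_nonneg _

lemma isPosKernel_mul_mul {k : Time T → Time T → ℝ} (h : IsPosKernel k) {q : Time T → ℝ}
    (hq : Continuous q) : IsPosKernel fun t s => q t * q s * k t s := by
  intro f hf
  obtain ⟨C, hC⟩ := (isBddKernel_of_continuous (T := T)
    (k := fun u _ => q u) (hq.comp continuous_fst)).bdd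
  have h1 : Integrable fun t => q t * f t :=
    hf.bdd_mul (c := C) hq.measurable.aestronglyMeasurable (Eventually.of_forall fun u => hC u u)
  have e : ∀ t, f t * ∫ s, q t * q s * k t s * f s =
      q t * f t * ∫ s, k t s * (q s * f s) := fun t => by
    rw [← integral_const_mul, ← integral_const_mul]
    congr with s; ring
  simp_rw [e]
  exact h _ h1

lemma integral_indicator_max (q : ℝ → ℝ) (t s : Time T) :
    ∫ u : Time T, q u * ((Set.Iic u).indicator (fun _ => (1 : ℝ)) t *
      (Set.Iic u).indicator (fun _ => (1 : ℝ)) s) = ∫ u in (max (t : ℝ) s)..T, q u := by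
  have h1 : ∀ u : Time T, q u * ((Set.Iic u).indicator (fun _ => (1 : ℝ)) t *
      (Set.Iic u).indicator (fun _ => (1 : ℝ)) s) =
      (Set.Icc (max t s) ⊤).indicator (fun u : Time T => q u) u := fun u => by
    by_cases h : t ≤ u <;> by_cases h' : s ≤ u <;> simp [h, h', Set.indicator]
  simp_rw [h1]
  rw [integral_indicator measurableSet_Icc, integral_Icc_time le_top, coe_top_time]
  congr 1

lemma isBddKernel_indicator_one :
    IsBddKernel fun u t : Time T => (Set.Iic u).indicator (fun _ => (1 : ℝ)) t :=
  (isBddKernel_of_continuous (k := fun _ _ : Time T => (1 : ℝ)) continuous_const).indicator_le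

lemma integral_indicator_mul_indicator (t s : Time T) :
    ∫ u : Time T, (1 : ℝ) * ((Set.Iic u).indicator (fun _ => (1 : ℝ)) t *
      (Set.Iic u).indicator (fun _ => (1 : ℝ)) s) = T - max (t : ℝ) s := by
  have := integral_indicator_max (T := T) (fun _ => 1) t s
  simpa using this

/-- `T - max(t, s)` is the integral over `u` of the rank-one kernels `1_{t ≤ u} 1_{s ≤ u}`. -/
lemma isPosKernel_sub_max : IsPosKernel fun t s : Time T => T - max (t : ℝ) s := by
  have h := isPosKernel_integral (T := T) isBddKernel_indicator_one
    (q := fun _ => 1) continuous_const (fun _ => zero_le_one)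
  simpa only [integral_indicator_mul_indicator] using h

/-- The kernel `1_{s ≤ t} e^{-r (t - s)}`. -/
def decayKernel (r : ℝ) (t s : Time T) : ℝ :=
  (Set.Iic t).indicator (fun s : Time T => Real.exp (-r * ((t : ℝ) - s))) s

lemma isBddKernel_decay (r : ℝ) : IsBddKernel (decayKernel (T := T) r) :=
  IsBddKernel.indicator_le (k := fun t s : Time T => Real.exp (-r * ((t : ℝ) - s)))
    (isBddKernel_of_continuous (by fun_prop))

/-- Off the diagonal the symmetrization is `e^{-r|t - s|} = e^{rt} e^{rs} e^{-2r max(t, s)}`, and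
`e^{-2r max(t, s)}` is `e^{-2rT}` plus the superposition of `1_{t ≤ u} 1_{s ≤ u}` with weight `2r
e^{-2ru}`. -/
lemma isPosKernel_decay {r : ℝ} (hr : 0 ≤ r) : IsPosKernel (decayKernel (T := T) r) := by
  refine IsPosKernel.of_symmetrization (isBddKernel_decay r) ?_
  have hc : Continuous fun u : Time T => 2 * r * Real.exp (-2 * r * u) := by fun_prop
  have h1 := isPosKernel_integral (T := T) isBddKernel_indicator_one hc (fun u => by positivity)
  have h2 : IsPosKernel fun t s : Time T => Real.exp (-2 * r * T) * 1 :=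
    isPosKernel_one.const_mul (Real.exp_pos _).le
  have e1 : ∀ t s : Time T, ∫ u : Time T, 2 * r * Real.exp (-2 * r * u) *
      ((Set.Iic u).indicator (fun _ => (1 : ℝ)) t * (Set.Iic u).indicator (fun _ => (1 : ℝ)) s) =
      Real.exp (-2 * r * max (t : ℝ) s) - Real.exp (-2 * r * T) := fun t s => by
    rw [integral_indicator_max (fun u => 2 * r * Real.exp (-2 * r * u)) t s]
    have : ∀ u ∈ Set.uIcc (max (t : ℝ) s) T, HasDerivAt (fun u => -Real.exp (-2 * r * u))
        (2 * r * Real.exp (-2 * r * u)) u := fun u _ => by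
      have := (((hasDerivAt_id u).const_mul (-2 * r)).exp).neg
      exact this.congr_deriv (by simp only [id]; ring)
    rw [intervalIntegral.integral_eq_sub_of_hasDerivAt this
      (Continuous.intervalIntegrable (by fun_prop) _ _)]
    ring
  simp only [e1] at h1
  have hcont : ∀ {g : Time T → Time T → ℝ}, (Continuous fun p : Time T × Time T => g p.1 p.2) →
      IsBddKernel g := isBddKernel_of_continuous
  have h3 := isPosKernel_mul_mul (T := T) (IsPosKernel.add (hcont (by fun_prop))
    (hcont (by fun_prop)) h1 h2)
    (q := fun t => Real.exp (r * t)) (by fun_prop)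
  refine h3.congr fun t => ?_
  -- On the diagonal both halves of the symmetrization contribute, so the kernels agree only almost
  -- everywhere.
  filter_upwards [ae_ne_time t] with s hs
  rcases lt_or_gt_of_ne hs with h | h
  · have h' : (s : ℝ) ≤ t := h.le
    simp only [decayKernel, Set.indicator, Set.mem_Iic, h.le, if_true, not_le.2 h, if_false,
      max_eq_left h']
    rw [add_zero, mul_one, sub_add_cancel, ← Real.exp_add, ← Real.exp_add]
    congr 1; ring
  · have h' : (t : ℝ) ≤ s := h.le
    have h'' : t < s := h
    simp only [decayKernel, Set.indicator, Set.mem_Iic, h''.le, if_true, not_le.2 h'', if_false,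
      max_eq_right h']
    rw [zero_add, mul_one, sub_add_cancel, ← Real.exp_add, ← Real.exp_add]
    congr 1; ring

end Kernels

/-! ### Coercive variational equations in a Hilbert space -/

section Hilbert

variable {E : Type*} [NormedAddCommGroup E] [InnerProductSpace ℝ E] (H : Submodule ℝ E)

/-- `V ∈ H` solves `c V + K V = F` weakly on `H`. -/
def IsWeakSol (c : ℝ) (K : E →L[ℝ] E) (F V : E) : Prop :=
  V ∈ H ∧ ∀ W ∈ H, inner ℝ (c • V + K V) W = inner ℝ F W

variable {H} {c : ℝ} {K : E →L[ℝ] E}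

/-- Lax–Milgram on `H`. Symmetry of `K` is not needed, which matters for the aggregated system, and
`K` need not map `H` to itself because the equation is tested only against `H`. -/
lemma exists_isWeakSol [CompleteSpace H] (hc : 0 < c) (hK : ∀ V, 0 ≤ inner ℝ (K V) V) (F : E) :
    ∃ V, IsWeakSol H c K F V := by
  let A : E →L[ℝ] E := c • ContinuousLinearMap.id ℝ E + K
  let B : H →L[ℝ] H →L[ℝ] ℝ := ((innerSL ℝ).bilinearComp (A ∘L H.subtypeL) H.subtypeL)
  have hB : IsCoercive B := by
    refine ⟨c, hc, fun u => ?_⟩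
    have : B u u = c * (‖u‖ * ‖u‖) + inner ℝ (K u) (u : E) := by
      simp only [B, A, ContinuousLinearMap.bilinearComp_apply, ContinuousLinearMap.comp_apply,
        Submodule.subtypeL_apply, innerSL_apply_apply, _root_.add_apply,
        _root_.smul_apply, ContinuousLinearMap.id_apply, inner_add_left,
        inner_smul_left, real_inner_self_eq_norm_mul_norm]
      simp
    rw [this]
    have := hK u
    linarith
  let ℓ : H →L[ℝ] ℝ := (innerSL ℝ F) ∘L H.subtypeL
  obtain ⟨G, hG⟩ : ∃ G : H, ∀ W : H, inner ℝ G W = inner ℝ F (W : E) :=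
    ⟨(InnerProductSpace.toDual ℝ H).symm ℓ, fun W => by
      rw [InnerProductSpace.toDual_symm_apply]; rfl⟩
  obtain ⟨V, hV⟩ := hB.continuousLinearEquivOfBilin.surjective G
  refine ⟨V, V.2, fun W hW => ?_⟩
  rw [← hG ⟨W, hW⟩, ← hV, hB.continuousLinearEquivOfBilin_apply]
  rfl

lemma IsWeakSol.unique (hc : 0 < c) (hK : ∀ V, 0 ≤ inner ℝ (K V) V) {F V V' : E}
    (h : IsWeakSol H c K F V) (h' : IsWeakSol H c K F V') : V = V' := by
  have hD : V - V' ∈ H := H.sub_mem h.1 h'.1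
  have h1 := (h.2 _ hD).trans (h'.2 _ hD).symm
  have h2 : c * inner ℝ (V - V') (V - V') + inner ℝ (K (V - V')) (V - V') = 0 := by
    rw [map_sub, inner_sub_left V, inner_sub_left (K V)]
    simp only [inner_add_left, inner_smul_left, RCLike.conj_to_real] at h1
    linarith
  have h3 := hK (V - V')
  have h4 : inner ℝ (V - V') (V - V') = (0 : ℝ) := by
    have h5 := real_inner_self_nonneg (x := V - V')
    nlinarith
  exact sub_eq_zero.1 (inner_self_eq_zero.1 h4)

/-- Symmetry of `K` makes the equation the Euler equation of a concave quadratic functional; along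
any line through `V` the functional is an exact parabola. -/
lemma isWeakSol_iff_maximizes (hc : 0 < c) (hK : ∀ V, 0 ≤ inner ℝ (K V) V)
    (hs : ∀ V W, inner ℝ (K V) W = inner ℝ (K W) V) {F V : E} (hV : V ∈ H) :
    IsWeakSol H c K F V ↔ ∀ W ∈ H,
      inner ℝ F W - c / 2 * inner ℝ W W - 1 / 2 * inner ℝ (K W) W ≤
      inner ℝ F V - c / 2 * inner ℝ V V - 1 / 2 * inner ℝ (K V) V := by
  have expand : ∀ (W : E) (e : ℝ),
      inner ℝ F (V + e • W) - c / 2 * inner ℝ (V + e • W) (V + e • W)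
        - 1 / 2 * inner ℝ (K (V + e • W)) (V + e • W) =
      (inner ℝ F V - c / 2 * inner ℝ V V - 1 / 2 * inner ℝ (K V) V)
      + e * (inner ℝ F W - inner ℝ (c • V + K V) W)
      - e ^ 2 / 2 * (c * inner ℝ W W + inner ℝ (K W) W) := fun W e => by
    simp only [map_add, map_smul, inner_add_left, inner_add_right, inner_smul_left,
      inner_smul_right, RCLike.conj_to_real]
    rw [hs W V, real_inner_comm V W]
    ring
  have hq : ∀ W, 0 ≤ c * inner ℝ W W + inner ℝ (K W) W := fun W =>
    add_nonneg (mul_nonneg hc.le real_inner_self_nonneg) (hK W)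
  constructor
  · rintro ⟨-, h⟩ W hW
    have e1 := expand (W - V) 1
    rw [one_smul, add_sub_cancel, h _ (H.sub_mem hW hV)] at e1
    rw [e1]
    have := hq (W - V)
    linarith
  · intro h
    refine ⟨hV, fun W hW => ?_⟩
    set g := inner ℝ F W - inner ℝ (c • V + K V) W with hg
    set q := c * inner ℝ W W + inner ℝ (K W) W with hqd
    have hq0 : 0 ≤ q := hq W
    -- The step `g / (q + 1)` nearly maximizes the parabola `e g - e² q / 2`; the extra `1` covers
    -- `q = 0`. The gain is a positive multiple of `g²`, so `g` must vanish.
    have h1 := h (V + (g / (q + 1)) • W) (H.add_mem hV (H.smul_mem _ hW))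
    rw [expand W (g / (q + 1)), ← hg, ← hqd] at h1
    have h2 : g / (q + 1) * g - (g / (q + 1)) ^ 2 / 2 * q ≤ 0 := by linarith
    have h3 : g / (q + 1) * g - (g / (q + 1)) ^ 2 / 2 * q =
        g ^ 2 * ((q + 2) / (2 * (q + 1) ^ 2)) := by
      field_simp; ring
    rw [h3] at h2
    have h4 : 0 < (q + 2) / (2 * (q + 1) ^ 2) := by positivity
    have h5 : g ^ 2 ≤ 0 := by
      by_contra hcon
      push Not at hcon
      exact absurd h2 (not_le.2 (mul_pos hcon h4))
    have h6 : g = 0 := by nlinarith [sq_nonneg g]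
    linarith

end Hilbert

lemma eLpNorm_two_sq {α : Type*} {m : MeasurableSpace α} (ν : Measure α) (f : α → ℝ) :
    eLpNorm f 2 ν ^ 2 = ∫⁻ a, ‖f a‖ₑ ^ 2 ∂ν := by
  rw [eLpNorm_eq_lintegral_rpow_enorm_toReal (by norm_num) (by norm_num), ← ENNReal.rpow_natCast,
    ← ENNReal.rpow_mul]
  simp

lemma lintegral_sq_le {α : Type*} {m : MeasurableSpace α} (ν : Measure α) {g : α → ENNReal}
    (hg : AEMeasurable g ν) : (∫⁻ a, g a ∂ν) ^ 2 ≤ ν Set.univ * ∫⁻ a, g a ^ 2 ∂ν := by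
  have h := ENNReal.lintegral_mul_le_Lp_mul_Lq ν (p := 2) (q := 2)
    (Real.HolderConjugate.two_two) hg (g := fun _ => 1) aemeasurable_const
  have h2 := pow_le_pow_left' h 2
  rw [mul_pow, ← ENNReal.rpow_natCast, ← ENNReal.rpow_natCast, ← ENNReal.rpow_natCast,
    ← ENNReal.rpow_mul, ← ENNReal.rpow_mul] at h2
  simp only [Pi.mul_apply, mul_one, ENNReal.one_rpow, lintegral_one] at h2
  norm_num at h2
  rw [mul_comm]
  exact h2

/-! ### Kernel operators on `L²(dt ⊗ dμ)` and the Hilbert space of admissible rates. -/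

section KernelOperator

variable {Ω : Type*} {T : ℝ} [Fact (0 < T)] {mΩ : MeasurableSpace Ω}

/-- The measure `dt ⊗ dμ`. -/
abbrev timeProd (T : ℝ) [Fact (0 < T)] (μ : Measure Ω) : Measure (Time T × Ω) :=
  (volume : Measure (Time T)).prod μ

/-- Square integrability with respect to `dt ⊗ dμ`. -/
abbrev SqInt (μ : Measure Ω) (v : Time T → Ω → ℝ) : Prop :=
  MemLp (fun p : Time T × Ω => v p.1 p.2) 2 (timeProd T μ)

/-- The integral operator with kernel `k`, acting on the paths of a process. -/
def kop (k : Time T → Time T → ℝ) (v : Time T → Ω → ℝ) : Time T → Ω → ℝ :=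
  fun t ω => ∫ s, k t s * v s ω

variable {μ : Measure Ω} [IsProbabilityMeasure μ]

lemma ae_ae_of_ae_timeProd {p : Time T → Ω → Prop}
    (h : ∀ᵐ q ∂(timeProd T μ), p q.1 q.2) : ∀ᵐ ω ∂μ, ∀ᵐ t : Time T, p t ω := by
  have h1 : ∀ᵐ q ∂(μ.prod (volume : Measure (Time T))), p q.2 q.1 :=
    (Measure.measurePreserving_swap (μ := μ) (ν := (volume : Measure (Time T)))
      ).quasiMeasurePreserving.ae h
  exact Measure.ae_ae_of_ae_prod h1

lemma ae_timeProd_of_ae {p : Time T → Ω → Prop} (h : ∀ᵐ ω ∂μ, ∀ t, p t ω) :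
    ∀ᵐ q ∂(timeProd T μ), p q.1 q.2 := by
  have := (Measure.quasiMeasurePreserving_snd (μ := (volume : Measure (Time T))) (ν := μ)).ae h
  filter_upwards [this] with q hq using hq q.1

lemma AEEq.trans {u v w : Time T → Ω → ℝ} (h : AEEq μ u v) (h' : AEEq μ v w) : AEEq μ u w :=
  EventuallyEq.trans h h'

lemma AEEq.symm {u v : Time T → Ω → ℝ} (h : AEEq μ u v) : AEEq μ v u :=
  EventuallyEq.symm h

lemma SqInt.integrable {v : Time T → Ω → ℝ} (hv : SqInt μ v) :
    Integrable (fun p : Time T × Ω => v p.1 p.2) (timeProd T μ) :=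
  MemLp.integrable one_le_two hv

lemma SqInt.ae_integrable {v : Time T → Ω → ℝ} (hv : SqInt μ v) :
    ∀ᵐ ω ∂μ, Integrable fun t => v t ω := hv.integrable.prod_left_ae

lemma ae_eq_kop {k : Time T → Time T → ℝ} {v w : Time T → Ω → ℝ} (h : AEEq μ v w) :
    Indist μ (kop k v) (kop k w) := by
  filter_upwards [ae_ae_of_ae_timeProd (p := fun t ω => v t ω = w t ω) h] with ω hω t
  exact integral_congr_ae (by filter_upwards [hω] with s hs; rw [hs])

lemma Indist.aeEq {v w : Time T → Ω → ℝ} (h : Indist μ v w) : AEEq μ v w := ae_timeProd_of_ae h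

lemma aestronglyMeasurable_kop {k : Time T → Time T → ℝ} (hk : IsBddKernel k)
    {v : Time T → Ω → ℝ}
    (hv : AEStronglyMeasurable (fun p : Time T × Ω => v p.1 p.2) (timeProd T μ)) :
    AEStronglyMeasurable (fun p : Time T × Ω => kop k v p.1 p.2) (timeProd T μ) := by
  have h1 : StronglyMeasurable fun p : Time T × Ω =>
      kop k (fun s ω => hv.mk _ (s, ω)) p.1 p.2 := by
    have : StronglyMeasurable fun q : (Time T × Ω) × Time T =>
        k q.1.1 q.2 * hv.mk _ (q.2, q.1.2) :=
      ((hk.measurable.comp ((measurable_fst.comp measurable_fst).prodMk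
        measurable_snd)).stronglyMeasurable).mul (hv.stronglyMeasurable_mk.comp_measurable
        (measurable_snd.prodMk (measurable_snd.comp measurable_fst)))
    exact this.integral_prod_right'
  refine ⟨_, h1, ?_⟩
  exact (ae_eq_kop (w := fun s ω => hv.mk _ (s, ω)) hv.ae_eq_mk).aeEq

/-- The operator acts path by path, so Cauchy–Schwarz in time gives the constant `sup |k|` times the
length of the interval, uniformly in `ω`. -/
lemma exists_lintegral_kop_le {k : Time T → Time T → ℝ} (hk : IsBddKernel k) :
    ∃ D : NNReal, ∀ v : Time T → Ω → ℝ,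
      AEStronglyMeasurable (fun p : Time T × Ω => v p.1 p.2) (timeProd T μ) →
      eLpNorm (fun p : Time T × Ω => kop k v p.1 p.2) 2 (timeProd T μ) ≤
        D * eLpNorm (fun p : Time T × Ω => v p.1 p.2) 2 (timeProd T μ) := by
  obtain ⟨C, hC⟩ := hk.bdd
  have hC0 : 0 ≤ C := (abs_nonneg _).trans (hC ⊥ ⊥)
  lift C to NNReal using hC0
  set V : ENNReal := (volume : Measure (Time T)) Set.univ with hV
  have hVt : V ≠ ⊤ := measure_ne_top _ _
  refine ⟨C * V.toNNReal, fun v hv => ?_⟩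
  have hDV : ((C * V.toNNReal : NNReal) : ENNReal) = C * V := by
    rw [ENNReal.coe_mul, ENNReal.coe_toNNReal hVt]
  rw [hDV, ← ENNReal.pow_le_pow_left_iff two_ne_zero, mul_pow, eLpNorm_two_sq, eLpNorm_two_sq,
    lintegral_prod_symm _ ((aestronglyMeasurable_kop hk hv).enorm.pow_const 2),
    lintegral_prod_symm _ (hv.enorm.pow_const 2)]
  rw [← lintegral_const_mul'' _ (hv.enorm.pow_const 2).lintegral_prod_left']
  have hsec : ∀ᵐ ω ∂μ, AEStronglyMeasurable (fun t : Time T => v t ω) volume :=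
    hv.prodMk_right
  refine lintegral_mono_ae ?_
  filter_upwards [hsec] with ω hω
  have hpt : ∀ t, ‖kop k v t ω‖ₑ ^ 2 ≤ C ^ 2 * (V * ∫⁻ s, ‖v s ω‖ₑ ^ 2) := fun t => by
    have h1 : ‖kop k v t ω‖ₑ ≤ C * ∫⁻ s, ‖v s ω‖ₑ := by
      rw [← lintegral_const_mul'' _ hω.enorm]
      refine (enorm_integral_le_lintegral_enorm _).trans (lintegral_mono fun s => ?_)
      rw [enorm_mul]
      gcongr
      rw [← ofReal_norm, Real.norm_eq_abs, ← ENNReal.ofReal_coe_nnreal]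
      exact ENNReal.ofReal_le_ofReal (hC t s)
    calc ‖kop k v t ω‖ₑ ^ 2 ≤ (C * ∫⁻ s, ‖v s ω‖ₑ) ^ 2 := by gcongr
      _ = C ^ 2 * (∫⁻ s, ‖v s ω‖ₑ) ^ 2 := mul_pow _ _ _
      _ ≤ _ := by
        gcongr
        exact lintegral_sq_le _ hω.enorm
  calc ∫⁻ t, ‖kop k v t ω‖ₑ ^ 2 ≤ ∫⁻ _ : Time T, C ^ 2 * (V * ∫⁻ s, ‖v s ω‖ₑ ^ 2) :=
        lintegral_mono hpt
    _ = (C * V) ^ 2 * ∫⁻ s, ‖v s ω‖ₑ ^ 2 := by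
        rw [lintegral_const, ← hV]; ring

lemma SqInt.kernel {k : Time T → Time T → ℝ} (hk : IsBddKernel k) {v : Time T → Ω → ℝ}
    (hv : SqInt μ v) : SqInt μ (kop k v) := by
  obtain ⟨D, hD⟩ := exists_lintegral_kop_le (μ := μ) hk
  exact ⟨aestronglyMeasurable_kop hk hv.1,
    (hD v hv.1).trans_lt (ENNReal.mul_lt_top ENNReal.coe_lt_top hv.2)⟩

/-- The process represented by an element of `L²(dt ⊗ dμ)`. -/
def ofLp (V : Lp ℝ 2 (timeProd T μ)) : Time T → Ω → ℝ := fun t ω => V (t, ω)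

lemma sqInt_ofLp (V : Lp ℝ 2 (timeProd T μ)) : SqInt μ (ofLp V) := Lp.memLp V

/-- The element of `L²(dt ⊗ dμ)` represented by a process. -/
def toL2 (v : Time T → Ω → ℝ) (hv : SqInt μ v) : Lp ℝ 2 (timeProd T μ) := MemLp.toLp _ hv

lemma toL2_eq_iff {v w : Time T → Ω → ℝ} (hv : SqInt μ v) (hw : SqInt μ w) :
    toL2 v hv = toL2 w hw ↔ AEEq μ v w := MemLp.toLp_eq_toLp_iff hv hw

lemma ofLp_toL2 {v : Time T → Ω → ℝ} (hv : SqInt μ v) : AEEq μ (ofLp (toL2 v hv)) v :=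
  MemLp.coeFn_toLp hv

lemma toL2_ofLp (V : Lp ℝ 2 (timeProd T μ)) : toL2 (ofLp V) (sqInt_ofLp V) = V :=
  Lp.toLp_coeFn V _

lemma kop_add_indist {k : Time T → Time T → ℝ} (hk : IsBddKernel k) {v w : Time T → Ω → ℝ}
    (hv : SqInt μ v) (hw : SqInt μ w) :
    Indist μ (kop k fun t ω => v t ω + w t ω) (fun t ω => kop k v t ω + kop k w t ω) := by
  filter_upwards [hv.ae_integrable, hw.ae_integrable] with ω h1 h2 t
  simp only [kop, mul_add]
  exact integral_add (hk.integrable_mul h1 t) (hk.integrable_mul h2 t)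

/-- The integral operator with kernel `k` on `L²(dt ⊗ dμ)`. -/
def kernelOp {k : Time T → Time T → ℝ} (hk : IsBddKernel k) (μ : Measure Ω)
    [IsProbabilityMeasure μ] : Lp ℝ 2 (timeProd T μ) →L[ℝ] Lp ℝ 2 (timeProd T μ) :=
  LinearMap.mkContinuousOfExistsBound
    { toFun := fun V => toL2 (kop k (ofLp V)) ((sqInt_ofLp V).kernel hk)
      map_add' := fun V W => by
        have h1 : AEEq μ (ofLp (V + W)) (fun t ω => ofLp V t ω + ofLp W t ω) := Lp.coeFn_add V W
        have h2 := (ae_eq_kop (k := k) h1).aeEq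
        have h3 := (kop_add_indist hk (sqInt_ofLp V) (sqInt_ofLp W)).aeEq
        unfold toL2
        rw [← MemLp.toLp_add, MemLp.toLp_eq_toLp_iff]
        exact AEEq.trans h2 h3
      map_smul' := fun c V => by
        have h1 : AEEq μ (ofLp (c • V)) (fun t ω => c * ofLp V t ω) := Lp.coeFn_smul c V
        have h2 := (ae_eq_kop (k := k) h1).aeEq
        unfold toL2
        rw [RingHom.id_apply, ← MemLp.toLp_const_smul, MemLp.toLp_eq_toLp_iff]
        refine AEEq.trans (w := fun t ω => c * kop k (ofLp V) t ω) h2 (Eventually.of_forall fun p => ?_)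
        simp only [kop]
        rw [← integral_const_mul]
        congr with s; ring }
    (by
      obtain ⟨D, hD⟩ := exists_lintegral_kop_le (μ := μ) hk
      refine ⟨D, fun V => ?_⟩
      have h := hD (ofLp V) (sqInt_ofLp V).1
      have h2 : ‖toL2 (kop k (ofLp V)) ((sqInt_ofLp V).kernel hk)‖ =
          (eLpNorm (fun p : Time T × Ω => kop k (ofLp V) p.1 p.2) 2 (timeProd T μ)).toReal :=
        Lp.norm_toLp _ _
      have h3 : ‖V‖ = (eLpNorm (fun p : Time T × Ω => ofLp V p.1 p.2) 2 (timeProd T μ)).toReal :=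
        Lp.norm_def V
      change ‖toL2 (kop k (ofLp V)) ((sqInt_ofLp V).kernel hk)‖ ≤ _
      rw [h2, h3, ← ENNReal.coe_toReal, ← ENNReal.toReal_mul]
      exact ENNReal.toReal_mono (ENNReal.mul_ne_top ENNReal.coe_ne_top (sqInt_ofLp V).2.ne) h)

lemma kernelOp_toL2 {k : Time T → Time T → ℝ} (hk : IsBddKernel k) {v : Time T → Ω → ℝ}
    (hv : SqInt μ v) : kernelOp hk μ (toL2 v hv) = toL2 (kop k v) (hv.kernel hk) :=
  (toL2_eq_iff ((sqInt_ofLp _).kernel hk) (hv.kernel hk)).2 (ae_eq_kop (ofLp_toL2 hv)).aeEq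

lemma inner_toL2 {v w : Time T → Ω → ℝ} (hv : SqInt μ v) (hw : SqInt μ w) :
    inner ℝ (toL2 v hv) (toL2 w hw) = ∫ p, v p.1 p.2 * w p.1 p.2 ∂(timeProd T μ) := by
  rw [L2.inner_def]
  refine integral_congr_ae ?_
  filter_upwards [ofLp_toL2 hv, ofLp_toL2 hw] with p h1 h2
  change inner ℝ (ofLp (toL2 v hv) p.1 p.2) (ofLp (toL2 w hw) p.1 p.2) = _
  rw [h1, h2]
  simp [mul_comm]

lemma SqInt.integrable_mul {v w : Time T → Ω → ℝ} (hv : SqInt μ v) (hw : SqInt μ w) :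
    Integrable (fun p : Time T × Ω => v p.1 p.2 * w p.1 p.2) (timeProd T μ) :=
  MemLp.integrable_mul hv hw

lemma inner_toL2_eq_integral {v w : Time T → Ω → ℝ} (hv : SqInt μ v) (hw : SqInt μ w) :
    inner ℝ (toL2 v hv) (toL2 w hw) = ∫ ω, (∫ t, v t ω * w t ω) ∂μ := by
  rw [inner_toL2]
  exact integral_prod_symm _ (hv.integrable_mul hw)

lemma inner_kernelOp_comm {k : Time T → Time T → ℝ} (hk : IsBddKernel k)
    (hs : ∀ t s, k t s = k s t) (V W : Lp ℝ 2 (timeProd T μ)) :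
    inner ℝ (kernelOp hk μ V) W = inner ℝ (kernelOp hk μ W) V := by
  rw [← toL2_ofLp V, ← toL2_ofLp W, kernelOp_toL2, kernelOp_toL2, inner_toL2_eq_integral,
    inner_toL2_eq_integral]
  refine integral_congr_ae ?_
  filter_upwards [(sqInt_ofLp V).ae_integrable, (sqInt_ofLp W).ae_integrable] with ω h1 h2
  simp only [kop]
  simp_rw [mul_comm _ (ofLp _ _ _)]
  have := hk.integral_swap h1 h2
  simp_rw [mul_comm _ (k _ _)]
  rw [this]
  simp_rw [hs]

lemma inner_kernelOp_nonneg {k : Time T → Time T → ℝ} (hk : IsBddKernel k) (hp : IsPosKernel k)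
    (V : Lp ℝ 2 (timeProd T μ)) : 0 ≤ inner ℝ (kernelOp hk μ V) V := by
  rw [← toL2_ofLp V, kernelOp_toL2, inner_toL2_eq_integral]
  refine integral_nonneg_of_ae ?_
  filter_upwards [(sqInt_ofLp V).ae_integrable] with ω h1
  have := hp _ h1
  simp_rw [mul_comm (ofLp V _ ω)] at this
  simpa only [kop, Pi.zero_apply, mul_comm (ofLp V _ ω)] using this

/-! ### Admissible rates as a Hilbert space -/

variable {𝓕 : Filtration (Time T) mΩ}

instance factProgressive : Fact (progressiveSigma 𝓕 ≤ (inferInstance :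
    MeasurableSpace (Time T × Ω))) := ⟨progressiveSigma_le 𝓕⟩

/-- The closed subspace of `L²(dt ⊗ dμ)` of the classes of admissible rates. -/
def progL2 (𝓕 : Filtration (Time T) mΩ) (μ : Measure Ω) :
    Submodule ℝ (Lp ℝ 2 (timeProd T μ)) :=
  lpMeas ℝ ℝ (progressiveSigma 𝓕) 2 (timeProd T μ)

instance completeSpace_progL2 : CompleteSpace (progL2 𝓕 μ) :=
  inferInstanceAs (CompleteSpace (lpMeas ℝ ℝ (progressiveSigma 𝓕) 2 (timeProd T μ)))

lemma toL2_mem_progL2 {v : Time T → Ω → ℝ} (hv : v ∈ Admissible 𝓕 μ) :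
    toL2 v hv.2 ∈ progL2 𝓕 μ := by
  refine mem_lpMeas_iff_aestronglyMeasurable.2 ?_
  refine ⟨fun p => v p.1 p.2, ?_, MemLp.coeFn_toLp hv.2⟩
  exact @Measurable.stronglyMeasurable _ _ _ (progressiveSigma 𝓕) _ _ _ _ _
    (measurable_progressiveSigma_iff.2 hv.1)

lemma exists_admissible_of_mem {V : Lp ℝ 2 (timeProd T μ)} (hV : V ∈ progL2 𝓕 μ) :
    ∃ v, ∃ hv : v ∈ Admissible 𝓕 μ, toL2 v hv.2 = V := by
  obtain ⟨g, hg, hVg⟩ := mem_lpMeas_iff_aestronglyMeasurable.1 hV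
  have h1 : IsStronglyProgressive 𝓕 fun t ω => g (t, ω) :=
    measurable_progressiveSigma_iff.1 hg.measurable
  have h2 : SqInt μ fun t ω => g (t, ω) := (memLp_congr_ae hVg).1 (Lp.memLp V)
  refine ⟨fun t ω => g (t, ω), ⟨h1, h2⟩, ?_⟩
  rw [← toL2_ofLp V, toL2_eq_iff]
  exact hVg.symm

end KernelOperator

/-! ### Square integrability of the price process. -/

section Price

variable {Ω : Type*} {T : ℝ} [Fact (0 < T)] {mΩ : MeasurableSpace Ω} {μ : Measure Ω}
  [IsProbabilityMeasure μ] {𝓕 : Filtration (Time T) mΩ}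

lemma CadlagAdapted.aestronglyMeasurable (h𝓕 : UsualConditions 𝓕 μ) {X : Time T → Ω → ℝ}
    (hX : CadlagAdapted 𝓕 μ X) :
    AEStronglyMeasurable (fun p : Time T × Ω => X p.1 p.2) (timeProd T μ) := by
  obtain ⟨X', h1, -, h2⟩ := hX.exists_isCadlag h𝓕
  exact (stronglyMeasurable_uncurry h1).aestronglyMeasurable.congr h2.aeEq.symm

lemma CadlagAdapted.sqInt (h𝓕 : UsualConditions 𝓕 μ) {X : Time T → Ω → ℝ}
    (hX : CadlagAdapted 𝓕 μ X) {C : ENNReal} (hC : C < ⊤) (h : ∀ t, eLpNorm (X t) 2 μ ≤ C) :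
    SqInt μ X := by
  have hm := hX.aestronglyMeasurable h𝓕
  refine ⟨hm, ?_⟩
  have h1 : eLpNorm (fun p : Time T × Ω => X p.1 p.2) 2 (timeProd T μ) ^ 2 < ⊤ := by
    rw [eLpNorm_two_sq, lintegral_prod _ (hm.enorm.pow_const 2)]
    calc ∫⁻ t : Time T, ∫⁻ ω, ‖X t ω‖ₑ ^ 2 ∂μ ≤ ∫⁻ _ : Time T, C ^ 2 := by
          refine lintegral_mono fun t => ?_
          rw [← eLpNorm_two_sq]
          exact pow_le_pow_left' (h t) 2
      _ = C ^ 2 * (volume : Measure (Time T)) Set.univ := lintegral_const _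
      _ < ⊤ := ENNReal.mul_lt_top (ENNReal.pow_lt_top hC) (measure_lt_top _ _)
  by_contra hcon
  rw [not_lt, top_le_iff] at hcon
  rw [hcon] at h1
  simp at h1

/-- Along the localizing sequence the stopped `L² - Q` is a martingale, which bounds the second
moment of the stopped `L` by `E[L₀²] + E[Q_T]`. Fatou removes the localization. -/
lemma IsPredictableBracket.exists_bound {L Q : Time T → Ω → ℝ}
    (h : IsPredictableBracket 𝓕 μ L Q) (hQ : Integrable (Q ⊤) μ) (hL : MemLp (L ⊥) 2 μ) :
    ∃ C < ⊤, ∀ t, eLpNorm (L t) 2 μ ^ 2 ≤ C := by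
  obtain ⟨τ, hτ, hmart⟩ := h.locally_martingale
  refine ⟨ENNReal.ofReal ((∫ ω, L ⊥ ω ^ 2 ∂μ) + ∫ ω, Q ⊤ ω ∂μ), ENNReal.ofReal_lt_top,
    fun t => ?_⟩
  let σ : ℕ → Time T → Ω → Time T := fun n t ω => (min (t : WithTop (Time T)) (τ n ω)).untopA
  let l : ℕ → Time T → Ω → ℝ := fun n t ω =>
    ({ω | ⊥ < τ n ω}.indicator (fun ω' => (L (σ n t ω) ω', L (σ n t ω) ω' ^ 2
      - Q (σ n t ω) ω')) ω).1
  let q : ℕ → Time T → Ω → ℝ := fun n t ω =>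
    ({ω | ⊥ < τ n ω}.indicator (fun ω' => (L (σ n t ω) ω', L (σ n t ω) ω' ^ 2
      - Q (σ n t ω) ω')) ω).2
  have hl : ∀ n, Martingale (l n) 𝓕 μ := fun n => (hmart n).1
  have hq : ∀ n, Martingale (q n) 𝓕 μ := fun n => (hmart n).2
  have hσbot : ∀ n ω, σ n ⊥ ω = ⊥ := fun n ω => by
    have : min ((⊥ : Time T) : WithTop (Time T)) (τ n ω) = ((⊥ : Time T) : WithTop (Time T)) :=
      min_eq_left bot_le
    simp only [σ, this]
    rfl
  have hbound : ∀ n, eLpNorm (l n t) 2 μ ^ 2 ≤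
      ENNReal.ofReal ((∫ ω, L ⊥ ω ^ 2 ∂μ) + ∫ ω, Q ⊤ ω ∂μ) := fun n => by
    have h1 : ∀ᵐ ω ∂μ, l n t ω ^ 2 ≤ q n t ω + Q ⊤ ω := by
      filter_upwards [h.mono, h.zero] with ω hm h0
      have h2 : Q (σ n t ω) ω ≤ Q ⊤ ω := hm le_top
      have h3 : 0 ≤ Q ⊤ ω := h0.symm.trans_le (hm bot_le)
      by_cases hω : ω ∈ {ω | ⊥ < τ n ω}
      · simp only [l, q, Set.indicator_of_mem hω]
        linarith
      · simp only [l, q, Set.indicator_of_notMem hω, Prod.fst_zero, Prod.snd_zero]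
        linarith
    -- Only an inequality holds, since the localized process is set to zero where the stopping time
    -- is `0`.
    have h2 : q n ⊥ ≤ᵐ[μ] fun ω => L ⊥ ω ^ 2 := by
      filter_upwards [h.zero] with ω h0
      by_cases hω : ω ∈ {ω | ⊥ < τ n ω}
      · simp only [q, Set.indicator_of_mem hω, hσbot, h0]
        linarith
      · simp only [q, Set.indicator_of_notMem hω, Prod.snd_zero]
        positivity
    have hint : Integrable (fun ω => q n t ω + Q ⊤ ω) μ := ((hq n).integrable t).add hQ
    have h3 : ∫ ω, q n t ω ∂μ = ∫ ω, q n ⊥ ω ∂μ := by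
      have := (hq n).setIntegral_eq (bot_le : ⊥ ≤ t) (s := Set.univ) MeasurableSet.univ
      simpa using this.symm
    calc eLpNorm (l n t) 2 μ ^ 2 = ∫⁻ ω, ENNReal.ofReal (l n t ω ^ 2) ∂μ := by
          rw [eLpNorm_two_sq]
          refine lintegral_congr fun ω => ?_
          rw [← ofReal_norm, ← ENNReal.ofReal_pow (norm_nonneg _), Real.norm_eq_abs, sq_abs]
      _ ≤ ∫⁻ ω, ENNReal.ofReal (q n t ω + Q ⊤ ω) ∂μ :=
          lintegral_mono_ae (h1.mono fun ω hω => ENNReal.ofReal_le_ofReal hω)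
      _ = ENNReal.ofReal (∫ ω, (q n t ω + Q ⊤ ω) ∂μ) :=
          (ofReal_integral_eq_lintegral_ofReal hint
            (h1.mono fun ω hω => (sq_nonneg _).trans hω)).symm
      _ ≤ _ := by
          refine ENNReal.ofReal_le_ofReal ?_
          rw [integral_add ((hq n).integrable t) hQ, h3]
          exact add_le_add (integral_mono_ae ((hq n).integrable ⊥) hL.integrable_sq h2) le_rfl
  have hlim : ∀ᵐ ω ∂μ, ‖L t ω‖ₑ ^ 2 = liminf (fun n => ‖l n t ω‖ₑ ^ 2) atTop := by
    filter_upwards [hτ.tendsto_top] with ω hω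
    have h1 : ∀ᶠ n in atTop, (t : WithTop (Time T)) < τ n ω :=
      hω.eventually_const_lt (WithTop.coe_lt_top t)
    have h2 : ∀ᶠ n in atTop, ‖L t ω‖ₑ ^ 2 = ‖l n t ω‖ₑ ^ 2 := by
      filter_upwards [h1] with n hn
      have hmem : ω ∈ {ω | ⊥ < τ n ω} := lt_of_le_of_lt bot_le hn
      have hst : σ n t ω = t := by
        simp only [σ, min_eq_left hn.le]
        rfl
      simp only [l, Set.indicator_of_mem hmem, hst]
    exact ((tendsto_const_nhds.congr' h2).liminf_eq).symm
  rw [eLpNorm_two_sq, lintegral_congr_ae hlim]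
  refine (lintegral_liminf_le' fun n => ?_).trans ?_
  · exact (((hl n).1 t).mono (𝓕.le t)).aestronglyMeasurable.enorm.pow_const 2
  · refine (liminf_le_liminf (Eventually.of_forall fun n => ?_)).trans
      (liminf_const (ENNReal.ofReal ((∫ ω, L ⊥ ω ^ 2 ∂μ) + ∫ ω, Q ⊤ ω ∂μ)) (f := atTop (α := ℕ))).le
    rw [← eLpNorm_two_sq]
    exact hbound n

lemma IsH2.cadlagAdapted {P : Time T → Ω → ℝ} (hP : IsH2 𝓕 μ P) : CadlagAdapted 𝓕 μ P := by
  obtain ⟨-, L, A, Q, hLA, hL, -, hA, hAc, -, -⟩ := hP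
  have e : P = fun t ω => L t ω + A t ω := by ext t ω; exact hLA t ω
  subst e
  refine ⟨fun t => (hL.cadlag_left.adapted t).add (hA.stronglyAdapted t), ?_⟩
  filter_upwards [hL.cadlag_left.cadlag, hAc] with ω h1 h2 using h1.add h2

lemma IsH2.exists_bound {P : Time T → Ω → ℝ} (hP : IsH2 𝓕 μ P) :
    ∃ C < ⊤, ∀ t, eLpNorm (P t) 2 μ ≤ C := by
  obtain ⟨hP0, L, A, Q, hLA, hL, hQ, hA, -, hA0, hV⟩ := hP
  have e : P = fun t ω => L t ω + A t ω := by ext t ω; exact hLA t ω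
  subst e
  have hL0 : MemLp (L ⊥) 2 μ := by
    refine (memLp_congr_ae ?_).1 hP0
    filter_upwards [hA0] with ω hω
    simp [hω]
  obtain ⟨C, hC, hLC⟩ := hL.exists_bound hQ hL0
  have hAC : ∀ t, eLpNorm (A t) 2 μ ^ 2 ≤
      ∫⁻ ω, (eVariationOn (fun t => A t ω) Set.univ) ^ 2 ∂μ := fun t => by
    rw [eLpNorm_two_sq]
    refine lintegral_mono_ae ?_
    filter_upwards [hA0] with ω hω
    refine pow_le_pow_left' ?_ 2
    have := eVariationOn.edist_le (fun t => A t ω) (s := Set.univ) (Set.mem_univ t)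
      (Set.mem_univ ⊥)
    simpa [hω, edist_zero_right] using this
  have key : ∀ {a c : ENNReal}, a ^ 2 ≤ c → a ≤ 1 + c := fun {a c} h => by
    rcases le_total a 1 with h1 | h1
    · exact h1.trans le_self_add
    · exact (le_self_pow h1 two_ne_zero).trans (h.trans le_add_self)
  refine ⟨(1 + C) + (1 + _), ?_, fun t => (eLpNorm_add_le
    ((hL.cadlag_left.adapted t).mono (𝓕.le t)).aestronglyMeasurable
    ((hA.stronglyAdapted t).mono (𝓕.le t)).aestronglyMeasurable one_le_two).trans
    (add_le_add (key (hLC t)) (key (hAC t)))⟩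
  exact ENNReal.add_lt_top.2 ⟨ENNReal.add_lt_top.2 ⟨ENNReal.one_lt_top, hC⟩,
    ENNReal.add_lt_top.2 ⟨ENNReal.one_lt_top, hV⟩⟩

lemma IsH2.sqInt (h𝓕 : UsualConditions 𝓕 μ) {P : Time T → Ω → ℝ} (hP : IsH2 𝓕 μ P) :
    SqInt μ P := by
  obtain ⟨C, hC, h⟩ := hP.exists_bound
  exact hP.cadlagAdapted.sqInt h𝓕 hC h

lemma IsH2.memLp {P : Time T → Ω → ℝ} (hP : IsH2 𝓕 μ P) (t : Time T) : MemLp (P t) 2 μ := by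
  obtain ⟨C, hC, h⟩ := hP.exists_bound
  exact ⟨((hP.cadlagAdapted.adapted t).mono (𝓕.le t)).aestronglyMeasurable, (h t).trans_lt hC⟩

end Price

/-! ### Pathwise integral identities behind the state equations. -/

section PathIntegrals

variable {T : ℝ} [Fact (0 < T)]

lemma integral_decayKernel (r : ℝ) (f : Time T → ℝ) (t : Time T) :
    ∫ s, decayKernel r t s * f s = ∫ s in Set.Iic t, Real.exp (-r * ((t : ℝ) - s)) * f s := by
  rw [← integral_indicator measurableSet_Iic]
  congr with s
  by_cases h : s ∈ Set.Iic t
  · simp only [decayKernel, Set.indicator_of_mem h]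
  · simp only [decayKernel, Set.indicator_of_notMem h, zero_mul]

lemma integral_decayKernel_zero (f : Time T → ℝ) (t : Time T) :
    ∫ s, decayKernel 0 t s * f s = ∫ s in Set.Iic t, f s := by
  rw [integral_decayKernel]
  simp

lemma integrable_of_bounded_continuous {g : Time T → ℝ} (hg : Continuous g) :
    Integrable g := by
  obtain ⟨C, hC⟩ := (isBddKernel_of_continuous (T := T)
    (k := fun u _ => g u) (hg.comp continuous_fst)).bdd
  exact Integrable.of_bound (C := C) hg.measurable.aestronglyMeasurable
    (Eventually.of_forall fun u => hC u u)

lemma continuous_setIntegral_Iic {g : Time T → ℝ} (hg : Integrable g) :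
    Continuous fun t : Time T => ∫ s in Set.Iic t, g s := by
  simp_rw [← integral_indicator measurableSet_Iic]
  rw [continuous_iff_continuousAt]
  intro t₀
  refine tendsto_integral_filter_of_dominated_convergence (fun s => |g s|)
    (Eventually.of_forall fun t => (hg.1.indicator measurableSet_Iic))
    (Eventually.of_forall fun t => Eventually.of_forall fun s => ?_) hg.abs ?_
  · rw [Real.norm_eq_abs]
    by_cases h : s ∈ Set.Iic t
    · rw [Set.indicator_of_mem h]
    · rw [Set.indicator_of_notMem h, abs_zero]; exact abs_nonneg _
  · filter_upwards [ae_ne_time t₀] with s hs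
    refine tendsto_const_nhds.congr' ?_
    rcases lt_or_gt_of_ne hs with h | h
    · filter_upwards [Ioi_mem_nhds h] with t ht
      rw [Set.indicator_of_mem (Set.mem_Iic.2 h.le),
        Set.indicator_of_mem (Set.mem_Iic.2 (Set.mem_Ioi.1 ht).le)]
    · filter_upwards [Iio_mem_nhds h] with t ht
      rw [Set.indicator_of_notMem (fun h' => absurd (Set.mem_Iic.1 h') (not_le.2 h)),
        Set.indicator_of_notMem (fun h' => absurd (Set.mem_Iic.1 h') (not_le.2 ht))]

lemma continuous_integral_decayKernel (r : ℝ) {f : Time T → ℝ} (hf : Integrable f) :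
    Continuous fun t : Time T => ∫ s, decayKernel r t s * f s := by
  have h1 : Integrable fun s : Time T => Real.exp (r * s) * f s := by
    have hb : IsBddKernel fun _ s : Time T => Real.exp (r * s) :=
      isBddKernel_of_continuous (by fun_prop)
    exact hb.integrable_mul hf ⊥
  have h2 := continuous_setIntegral_Iic h1
  have e : (fun t : Time T => ∫ s, decayKernel r t s * f s) =
      fun t : Time T => Real.exp (-r * t) * ∫ s in Set.Iic t, Real.exp (r * s) * f s := by
    ext t
    rw [integral_decayKernel, ← integral_const_mul]
    congr with s
    rw [← mul_assoc, ← Real.exp_add]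
    congr 2; ring
  rw [e]
  exact (by fun_prop : Continuous fun t : Time T => Real.exp (-r * t)).mul h2

lemma integral_exp_Icc {r : ℝ} (hr : r ≠ 0) {a b : Time T} (hab : a ≤ b) :
    ∫ s in Set.Icc a b, Real.exp (-r * ((s : ℝ) - a)) =
      (1 - Real.exp (-r * ((b : ℝ) - a))) / r := by
  rw [integral_Icc_time hab (fun s => Real.exp (-r * (s - a)))]
  have : ∀ u ∈ Set.uIcc (a : ℝ) b, HasDerivAt (fun u : ℝ => -Real.exp (-r * (u - a)) / r)
      (Real.exp (-r * (u - a))) u := fun u _ => by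
    have := (((((hasDerivAt_id u).sub_const (a : ℝ)).const_mul (-r)).exp).neg).div_const r
    refine this.congr_deriv ?_
    simp only [id]
    field_simp
  rw [intervalIntegral.integral_eq_sub_of_hasDerivAt this
    (Continuous.intervalIntegrable (by fun_prop) _ _)]
  simp only [sub_self, mul_zero, Real.exp_zero]
  ring

/-- Fubini, with `∫_u^t r e^{-r(s - u)} ds = 1 - e^{-r(t - u)}` as the inner integral. -/
lemma setIntegral_integral_decayKernel {r : ℝ} (hr : r ≠ 0) {f : Time T → ℝ} (hf : Integrable f)
    (t : Time T) : ∫ s in Set.Iic t, r * ∫ u, decayKernel r s u * f u =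
      (∫ s in Set.Iic t, f s) - ∫ s, decayKernel r t s * f s := by
  have hg : Integrable ((Set.Iic t).indicator fun _ : Time T => r) :=
    (integrable_const r).indicator measurableSet_Iic
  have h1 := (isBddKernel_decay r).integral_swap hf hg
  have e1 : ∀ s, (Set.Iic t).indicator (fun _ : Time T => r) s * ∫ u, decayKernel r s u * f u =
      (Set.Iic t).indicator (fun s => r * ∫ u, decayKernel r s u * f u) s := fun s => by
    rw [Set.indicator_mul_left]
  simp_rw [e1] at h1
  rw [integral_indicator measurableSet_Iic] at h1
  rw [h1, ← integral_decayKernel_zero, ← integral_sub]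
  rotate_left
  · exact (isBddKernel_decay 0).integrable_mul hf t
  · exact (isBddKernel_decay r).integrable_mul hf t
  congr with u
  have e2 : ∫ s, decayKernel r s u * (Set.Iic t).indicator (fun _ => r) s =
      decayKernel 0 t u - decayKernel r t u := by
    by_cases hu : u ≤ t
    · have e3 : ∀ s, decayKernel r s u * (Set.Iic t).indicator (fun _ => r) s =
          (Set.Icc u t).indicator (fun s : Time T => Real.exp (-r * ((s : ℝ) - u)) * r) s :=
        fun s => by
        by_cases h1 : u ≤ s <;> by_cases h2 : s ≤ t <;>
          simp [decayKernel, Set.indicator, h1, h2]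
      simp_rw [e3]
      rw [integral_indicator measurableSet_Icc, integral_mul_const, integral_exp_Icc hr hu]
      simp only [decayKernel, Set.indicator_of_mem (Set.mem_Iic.2 hu)]
      field_simp
      simp
    · have e3 : ∀ s, decayKernel r s u * (Set.Iic t).indicator (fun _ => r) s = 0 := fun s => by
        by_cases h1 : u ≤ s
        · have h2 : ¬ s ≤ t := fun h => hu (h1.trans h)
          simp [Set.indicator, h2]
        · simp [decayKernel, Set.indicator, h1]
      simp_rw [e3]
      simp [decayKernel, Set.indicator, hu]
  rw [e2]; ring

lemma relaxation_eq {r : ℝ} (hr : r ≠ 0) (y g : ℝ) {f : Time T → ℝ} (hf : Integrable f)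
    (t : Time T) :
    Real.exp (-r * t) * y + g * ∫ s, decayKernel r t s * f s =
      y + ∫ s in Set.Iic t, (-r * (Real.exp (-r * s) * y + g * ∫ u, decayKernel r s u * f u)
        + g * f s) := by
  have i1 : Integrable fun s : Time T => Real.exp (-r * s) * (-r * y) :=
    integrable_of_bounded_continuous (by fun_prop)
  have i2 : Integrable fun s : Time T => r * ∫ u, decayKernel r s u * f u :=
    ((isBddKernel_decay r).integrable_integral hf).const_mul r
  have e : ∀ s : Time T, -r * (Real.exp (-r * s) * y + g * ∫ u, decayKernel r s u * f u) + g * f s =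
      (Real.exp (-r * s) * (-r * y) + (-g) * (r * ∫ u, decayKernel r s u * f u)) + g * f s :=
    fun s => by ring
  have i3 : Integrable fun s : Time T => Real.exp (-r * s) * (-r * y)
      + (-g) * (r * ∫ u, decayKernel r s u * f u) := i1.add (i2.const_mul (-g))
  have hsd := setIntegral_integral_decayKernel hr hf t
  rw [integral_const_mul] at hsd
  simp_rw [e]
  rw [integral_add i3.integrableOn (hf.const_mul g).integrableOn,
    integral_add i1.integrableOn (i2.const_mul (-g)).integrableOn, integral_const_mul,
    integral_const_mul, hsd, integral_mul_const, integral_const_mul]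
  have h3 := integral_exp_Icc (T := T) hr (a := ⊥) (b := t) bot_le
  rw [Set.Icc_bot] at h3
  simp only [coe_bot_time, sub_zero] at h3
  rw [h3]
  field_simp
  ring

/-- Positivity replaces Gronwall: the kernel `1_{s ≤ t}` has nonnegative form, while the equation
makes the form of `Z` equal to `-(1/r) ∫ Z²`. So `Z` vanishes a.e., and the equation then gives it
everywhere. -/
lemma eq_zero_of_eq_neg_integral {r : ℝ} (hr : 0 < r) {Z : Time T → ℝ} (hZ : Integrable Z)
    (hZ2 : Integrable fun t => Z t ^ 2) (h : ∀ t, Z t = -r * ∫ s in Set.Iic t, Z s) :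
    ∀ t, Z t = 0 := by
  have h1 := isPosKernel_decay (T := T) le_rfl Z hZ
  have e : ∀ t, Z t * ∫ s, decayKernel 0 t s * Z s = -(1 / r) * Z t ^ 2 := fun t => by
    have h2 : ∫ s, decayKernel 0 t s * Z s = -(1 / r) * Z t := by
      rw [integral_decayKernel_zero]
      rw [h t]
      field_simp
    rw [h2]; ring
  simp_rw [e] at h1
  rw [integral_const_mul] at h1
  have h3 : 0 ≤ ∫ t, Z t ^ 2 := integral_nonneg fun t => sq_nonneg _
  have h4 : ∫ t, Z t ^ 2 = 0 := by
    have : 0 < 1 / r := by positivity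
    nlinarith
  have h5 := (integral_eq_zero_iff_of_nonneg (fun t => sq_nonneg (Z t)) hZ2).1 h4
  intro t
  rw [h t]
  have h6 : ∫ s in Set.Iic t, Z s = 0 := by
    refine integral_eq_zero_of_ae (ae_restrict_of_ae ?_)
    filter_upwards [h5] with s hs
    exact pow_eq_zero_iff two_ne_zero |>.1 hs
  rw [h6, mul_zero]

/-- Integration by parts for `X = x - ∫ f`: one has `∫_t^T X ds = x(T - t) - ∫ (T - max(t, s)) f(s)
ds`. This is where the kernel of the game comes from. -/
lemma integral_sub_primitive (x c d : ℝ) {f : Time T → ℝ} (hf : Integrable f) (t : Time T) :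
    c * x * (T - t) + d * x - ∫ s : Time T, (c * (T - max (t : ℝ) s) + d) * f s =
      c * ((∫ s, (x - ∫ u in Set.Iic s, f u)) - ∫ s in Set.Iic t, (x - ∫ u in Set.Iic s, f u))
        + d * (x - ∫ u in Set.Iic (⊤ : Time T), f u) := by
  have hX : Integrable fun s : Time T => x - ∫ u in Set.Iic s, f u :=
    integrable_of_bounded_continuous (continuous_const.sub (continuous_setIntegral_Iic hf))
  have hq : IsBddKernel fun u t : Time T => (Set.Iic u).indicator (fun _ => (1 : ℝ)) t :=
    isBddKernel_indicator_one
  have hg : Integrable fun u : Time T => (Set.Iic u).indicator (fun _ => (1 : ℝ)) t := by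
    obtain ⟨C, hC⟩ := hq.bdd
    exact Integrable.of_bound (C := C) (hq.measurable.comp
      measurable_prodMk_right).aestronglyMeasurable (Eventually.of_forall fun u => hC u t)
  have hm : IsBddKernel fun t s : Time T => T - max (t : ℝ) s :=
    isBddKernel_of_continuous (by fun_prop)
  have h1 : (∫ s, (x - ∫ u in Set.Iic s, f u)) - ∫ s in Set.Iic t, (x - ∫ u in Set.Iic s, f u) =
      ∫ s in Set.Ici t, (x - ∫ u in Set.Iic s, f u) := by
    rw [← integral_add_compl measurableSet_Iic hX, Set.compl_Iic, add_sub_cancel_left]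
    refine setIntegral_congr_set ?_
    filter_upwards [ae_ne_time t] with s hs
    exact propext ⟨fun h : t < s => h.le, fun h : t ≤ s => lt_of_le_of_ne h hs.symm⟩
  have h2 : ∫ s in Set.Ici t, (x - ∫ u in Set.Iic s, f u) =
      x * (T - t) - ∫ s : Time T, (T - max (t : ℝ) s) * f s := by
    have hc : Integrable fun s : Time T => ∫ u in Set.Iic s, f u :=
      integrable_of_bounded_continuous (continuous_setIntegral_Iic hf)
    rw [integral_sub (integrable_const x).integrableOn hc.integrableOn]
    congr 1
    · have := integral_Icc_time (T := T) (a := t) (b := ⊤) le_top (fun _ => x)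
      rw [Set.Icc_top] at this
      rw [this, coe_top_time]
      simp [mul_comm]
    · have h3 := (isBddKernel_decay (T := T) 0).integral_swap hf hg
      have e1 : ∀ s : Time T, (Set.Iic s).indicator (fun _ => (1 : ℝ)) t *
          ∫ u, decayKernel 0 s u * f u = (Set.Ici t).indicator (fun s => ∫ u in Set.Iic s, f u) s :=
        fun s => by
        rw [integral_decayKernel_zero]
        by_cases h : t ≤ s <;> simp [Set.indicator, h]
      simp_rw [e1] at h3
      rw [integral_indicator measurableSet_Ici] at h3
      rw [h3]
      congr with s
      have h4 := integral_indicator_max (T := T) (fun _ => 1) t s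
      rw [mul_comm]
      congr 1
      rw [intervalIntegral.integral_const, smul_eq_mul, mul_one] at h4
      rw [← h4]
      congr with u
      simp only [decayKernel, neg_zero, zero_mul, Real.exp_zero]
      ring
  rw [h1, h2]
  have e : ∀ s : Time T, (c * (T - max (t : ℝ) s) + d) * f s =
      c * ((T - max (t : ℝ) s) * f s) + d * f s := fun s => by ring
  simp_rw [e]
  rw [integral_add ((hm.integrable_mul hf t).const_mul c) (hf.const_mul d), integral_const_mul,
    integral_const_mul, Set.Iic_top, Measure.restrict_univ]
  ring

end PathIntegrals

/-! ### Inventory and price impact: adaptedness, integrability, uniqueness. -/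

section StateProcesses

variable {Ω : Type*} {T : ℝ} [Fact (0 < T)]

lemma stronglyMeasurable_setIntegral_Iic [MeasurableSpace Ω] {t : Time T} {v : Time T → Ω → ℝ}
    (hv : StronglyMeasurable fun p : Set.Iic t × Ω => v p.1 p.2) {q : Time T → ℝ}
    (hq : Measurable q) : StronglyMeasurable fun ω => ∫ s in Set.Iic t, q s * v s ω := by
  have h1 : Measurable fun p : Ω × Time T =>
      ((⟨min p.2 t, Set.mem_Iic.2 (min_le_right _ _)⟩ : Set.Iic t), p.1) :=
    (Measurable.subtype_mk (measurable_snd.min measurable_const)).prodMk measurable_fst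
  have h2 : StronglyMeasurable fun p : Ω × Time T => q p.2 * v (min p.2 t) p.1 :=
    ((hq.comp measurable_snd).stronglyMeasurable).mul (hv.comp_measurable h1)
  -- Freezing time at `t` leaves the integral unchanged and expresses it through the restriction of
  -- `v` to `[0, t]`, the only part known to be measurable for the σ-algebra at `t`.
  have h3 : (fun ω => ∫ s in Set.Iic t, q s * v s ω) =
      fun ω => ∫ s in Set.Iic t, q s * v (min s t) ω := by
    ext ω
    refine setIntegral_congr_fun measurableSet_Iic fun s hs => ?_
    simp only [min_eq_left (Set.mem_Iic.1 hs)]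
  rw [h3]
  exact StronglyMeasurable.integral_prod_right' (f := fun p : Ω × Time T =>
    q p.2 * v (min p.2 t) p.1) h2

variable {mΩ : MeasurableSpace Ω} {μ : Measure Ω} [IsProbabilityMeasure μ]
  {𝓕 : Filtration (Time T) mΩ}

lemma kop_decayKernel_zero (v : Time T → Ω → ℝ) (t : Time T) (ω : Ω) :
    kop (decayKernel 0) v t ω = ∫ s in Set.Iic t, v s ω := integral_decayKernel_zero _ t

lemma inventory_eq_kop (x : ℝ) (v : Time T → Ω → ℝ) (t : Time T) (ω : Ω) :
    inventory x v t ω = x - kop (decayKernel 0) v t ω := by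
  rw [kop_decayKernel_zero]; rfl

lemma impact_eq_kop (θ : Params) (ν : Time T → Ω → ℝ) (t : Time T) (ω : Ω) :
    impact θ ν t ω = Real.exp (-θ.rho * t) * θ.y + θ.gam * kop (decayKernel θ.rho) ν t ω := by
  unfold impact kop
  rw [integral_decayKernel]

lemma stronglyAdapted_kop {v : Time T → Ω → ℝ} (hv : IsStronglyProgressive 𝓕 v) (r : ℝ) :
    StronglyAdapted 𝓕 (kop (decayKernel r) v) := fun t => by
  have h := @stronglyMeasurable_setIntegral_Iic Ω T _ (𝓕 t) t v (hv t)
    (fun s => Real.exp (-r * ((t : ℝ) - s)))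
    (by fun_prop : Continuous fun s : Time T => Real.exp (-r * ((t : ℝ) - s))).measurable
  have e : kop (decayKernel r) v t =
      fun ω => ∫ s in Set.Iic t, Real.exp (-r * ((t : ℝ) - s)) * v s ω := by
    ext ω; exact integral_decayKernel r _ t
  rw [e]
  exact h

lemma SqInt.ae_continuous_kop {v : Time T → Ω → ℝ} (hv : SqInt μ v) (r : ℝ) :
    ∀ᵐ ω ∂μ, Continuous fun t => kop (decayKernel r) v t ω := by
  filter_upwards [hv.ae_integrable] with ω hω
  exact continuous_integral_decayKernel r hω

lemma cadlagAdapted_kop {v : Time T → Ω → ℝ} (hv : v ∈ Admissible 𝓕 μ) (r : ℝ) :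
    CadlagAdapted 𝓕 μ (kop (decayKernel r) v) :=
  ⟨stronglyAdapted_kop hv.1 r, (SqInt.ae_continuous_kop hv.2 r).mono
    fun _ h => isCadlag_of_continuous h⟩

lemma CadlagAdapted.add {X Y : Time T → Ω → ℝ} (hX : CadlagAdapted 𝓕 μ X)
    (hY : CadlagAdapted 𝓕 μ Y) : CadlagAdapted 𝓕 μ fun t ω => X t ω + Y t ω := by
  refine ⟨fun t => (hX.adapted t).add (hY.adapted t), ?_⟩
  filter_upwards [hX.cadlag, hY.cadlag] with ω h1 h2 using h1.add h2

lemma CadlagAdapted.const_mul {X : Time T → Ω → ℝ} (hX : CadlagAdapted 𝓕 μ X) (c : ℝ) :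
    CadlagAdapted 𝓕 μ fun t ω => c * X t ω := by
  refine ⟨fun t => (hX.adapted t).const_mul c, ?_⟩
  filter_upwards [hX.cadlag] with ω h1 using h1.const_mul c

lemma cadlagAdapted_continuous {q : Time T → ℝ} (hq : Continuous q) :
    CadlagAdapted 𝓕 μ fun t _ => q t :=
  ⟨fun _ => stronglyMeasurable_const, Eventually.of_forall fun _ => isCadlag_of_continuous hq⟩

lemma cadlagAdapted_inventory (x : ℝ) {v : Time T → Ω → ℝ} (hv : v ∈ Admissible 𝓕 μ) :
    CadlagAdapted 𝓕 μ (inventory x v) := by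
  have e : inventory x v = fun t ω => x + (-1) * kop (decayKernel 0) v t ω := by
    ext t ω; rw [inventory_eq_kop]; ring
  rw [e]
  exact (cadlagAdapted_continuous continuous_const).add ((cadlagAdapted_kop hv 0).const_mul _)

lemma cadlagAdapted_impact (θ : Params) {ν : Time T → Ω → ℝ} (hν : ν ∈ Admissible 𝓕 μ) :
    CadlagAdapted 𝓕 μ (impact θ ν) := by
  have e : impact θ ν = fun (t : Time T) ω => Real.exp (-θ.rho * t) * θ.y
      + θ.gam * kop (decayKernel θ.rho) ν t ω := by
    ext t ω; rw [impact_eq_kop]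
  rw [e]
  exact (cadlagAdapted_continuous (by fun_prop)).add ((cadlagAdapted_kop hν _).const_mul _)

lemma SqInt.add {v w : Time T → Ω → ℝ} (hv : SqInt μ v) (hw : SqInt μ w) :
    SqInt μ fun t ω => v t ω + w t ω := MemLp.add hv hw

lemma SqInt.const_mul {v : Time T → Ω → ℝ} (hv : SqInt μ v) (c : ℝ) :
    SqInt μ fun t ω => c * v t ω := MemLp.const_mul hv c

lemma sqInt_of_memLp {Z : Ω → ℝ} (hZ : MemLp Z 2 μ) : SqInt μ fun _ : Time T => Z :=
  hZ.comp_snd volume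

lemma sqInt_continuous {q : Time T → ℝ} (hq : Continuous q) :
    SqInt μ fun t (_ : Ω) => q t := by
  obtain ⟨C, hC⟩ := (isBddKernel_of_continuous (T := T)
    (k := fun u _ => q u) (hq.comp continuous_fst)).bdd
  exact MemLp.of_bound (hq.measurable.comp measurable_fst).aestronglyMeasurable C
    (Eventually.of_forall fun p => hC p.1 p.1)

lemma SqInt.congr {v w : Time T → Ω → ℝ} (hv : SqInt μ v) (h : AEEq μ v w) : SqInt μ w :=
  (memLp_congr_ae h).1 hv

lemma ae_neBot_time : (ae (volume : Measure (Time T))).NeBot := by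
  rw [ae_neBot]
  intro h
  have h1 : (volume : Measure (Time T)) Set.univ = volume (Set.Icc (0 : ℝ) T) :=
    Measure.Subtype.volume_univ measurableSet_Icc.nullMeasurableSet
  rw [h, Measure.coe_zero, Pi.zero_apply, Real.volume_Icc, sub_zero] at h1
  have : 0 < T := Fact.out
  exact (ENNReal.ofReal_pos.2 this).ne h1

lemma SqInt.ae_memLp_section {v : Time T → Ω → ℝ} (hv : SqInt μ v) :
    ∀ᵐ t : Time T, MemLp (v t) 2 μ := by
  have h2 : Integrable (fun p : Time T × Ω => v p.1 p.2 ^ 2) (timeProd T μ) := hv.integrable_sq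
  filter_upwards [hv.integrable.prod_right_ae, h2.prod_right_ae] with t h1 h2
  exact (memLp_two_iff_integrable_sq h1.1).2 h2

lemma SqInt.memLp_of_const {Z : Ω → ℝ} (h : SqInt μ fun _ : Time T => Z) : MemLp Z 2 μ := by
  have := ae_neBot_time (T := T)
  exact h.ae_memLp_section.exists.choose_spec

lemma isBddKernel_const (t : Time T) {k : Time T → Time T → ℝ} (hk : IsBddKernel k) :
    IsBddKernel fun _ s => k t s :=
  ⟨(hk.measurable.comp measurable_prodMk_left).comp measurable_snd,
    hk.bdd.imp fun _ h _ s => h t s⟩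

/-- Square integrability at one fixed time follows from the bound on `[0, T] × Ω` by freezing the
first kernel variable: the resulting process is constant in time, and almost every section of it is
in `L²`. -/
lemma SqInt.memLp_kop {k : Time T → Time T → ℝ} (hk : IsBddKernel k) {v : Time T → Ω → ℝ}
    (hv : SqInt μ v) (t : Time T) : MemLp (kop k v t) 2 μ :=
  SqInt.memLp_of_const (T := T) (hv.kernel (isBddKernel_const t hk))

lemma sqInt_inventory (x : ℝ) {v : Time T → Ω → ℝ} (hv : SqInt μ v) :
    SqInt μ (inventory x v) := by
  have e : inventory x v = fun t ω => x + (-1) * kop (decayKernel 0) v t ω := by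
    ext t ω; rw [inventory_eq_kop]; ring
  rw [e]
  exact (sqInt_continuous continuous_const).add ((hv.kernel (isBddKernel_decay 0)).const_mul _)

lemma memLp_inventory (x : ℝ) {v : Time T → Ω → ℝ} (hv : SqInt μ v) (t : Time T) :
    MemLp (inventory x v t) 2 μ := by
  have e : inventory x v t = fun ω => x - kop (decayKernel 0) v t ω := by
    ext ω; rw [inventory_eq_kop]
  rw [e]
  exact (memLp_const x).sub (hv.memLp_kop (isBddKernel_decay 0) t)

lemma sqInt_impact (θ : Params) {ν : Time T → Ω → ℝ} (hν : SqInt μ ν) :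
    SqInt μ (impact θ ν) := by
  have e : impact θ ν = fun (t : Time T) ω => Real.exp (-θ.rho * t) * θ.y
      + θ.gam * kop (decayKernel θ.rho) ν t ω := by
    ext t ω; rw [impact_eq_kop]
  rw [e]
  exact (sqInt_continuous (by fun_prop)).add ((hν.kernel (isBddKernel_decay _)).const_mul _)

lemma Indist.symm {X Y : Time T → Ω → ℝ} (h : Indist μ X Y) : Indist μ Y X := by
  filter_upwards [h] with ω hω t using (hω t).symm

lemma Indist.trans {X Y Z : Time T → Ω → ℝ} (h : Indist μ X Y) (h' : Indist μ Y Z) :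
    Indist μ X Z := by
  filter_upwards [h, h'] with ω h1 h2 t using (h1 t).trans (h2 t)

lemma CadlagAdapted.congr (h𝓕 : UsualConditions 𝓕 μ) {X Y : Time T → Ω → ℝ}
    (hX : CadlagAdapted 𝓕 μ X) (h : Indist μ X Y) : CadlagAdapted 𝓕 μ Y := by
  refine ⟨fun t => h𝓕.stronglyMeasurable_of_ae_eq (hX.adapted t) ?_, ?_⟩
  · filter_upwards [h] with ω hω using hω t
  · filter_upwards [h, hX.cadlag] with ω h1 h2
    have : (fun t => Y t ω) = fun t => X t ω := by ext t; exact (h1 t).symm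
    rw [this]; exact h2

lemma CadlagAdapted.exists_admissible (h𝓕 : UsualConditions 𝓕 μ) {X : Time T → Ω → ℝ}
    (hX : CadlagAdapted 𝓕 μ X) (h : SqInt μ X) : ∃ X' ∈ Admissible 𝓕 μ, Indist μ X X' := by
  obtain ⟨X', h1, -, h2⟩ := hX.exists_isCadlag h𝓕
  exact ⟨X', ⟨h1, h.congr h2.aeEq⟩, h2⟩

lemma solvesInventory_inventory (x : ℝ) {v : Time T → Ω → ℝ} (hv : v ∈ Admissible 𝓕 μ) :
    SolvesInventory 𝓕 μ x v (inventory x v) :=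
  ⟨cadlagAdapted_inventory x hv, Eventually.of_forall fun _ _ => rfl⟩

lemma SolvesInventory.indist {x : ℝ} {v X : Time T → Ω → ℝ} (h : SolvesInventory 𝓕 μ x v X) :
    Indist μ X (inventory x v) := h.eq

lemma indist_inventory (x : ℝ) {v w : Time T → Ω → ℝ} (h : AEEq μ v w) :
    Indist μ (inventory x v) (inventory x w) := by
  filter_upwards [ae_eq_kop (k := decayKernel 0) h] with ω hω t
  rw [inventory_eq_kop, inventory_eq_kop, hω t]

lemma indist_impact (θ : Params) {v w : Time T → Ω → ℝ} (h : AEEq μ v w) :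
    Indist μ (impact θ v) (impact θ w) := by
  filter_upwards [ae_eq_kop (k := decayKernel θ.rho) h] with ω hω t
  rw [impact_eq_kop, impact_eq_kop, hω t]

lemma solvesImpact_impact (θ : Params) {ν : Time T → Ω → ℝ} (hν : ν ∈ Admissible 𝓕 μ) :
    SolvesImpact θ 𝓕 μ ν (impact θ ν) := by
  refine ⟨cadlagAdapted_impact θ hν, ?_⟩
  filter_upwards [SqInt.ae_integrable hν.2] with ω hω t
  simp_rw [impact_eq_kop]
  exact relaxation_eq θ.rho_pos.ne' θ.y θ.gam hω t

/-- The difference of two solutions of the impact equation satisfies `Z = -ρ ∫ Z`, hence vanishes.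
-/
lemma SolvesImpact.indist {θ : Params} {ν Y : Time T → Ω → ℝ} (hν : ν ∈ Admissible 𝓕 μ)
    (h : SolvesImpact θ 𝓕 μ ν Y) : Indist μ Y (impact θ ν) := by
  filter_upwards [h.eq, (solvesImpact_impact θ hν).eq, h.cadlagAdapted.cadlag,
    (cadlagAdapted_impact θ hν).cadlag, SqInt.ae_integrable hν.2] with ω h1 h2 c1 c2 hi
  have int : ∀ {f : Time T → ℝ}, IsCadlag f → Integrable f := fun {f} hf => by
    obtain ⟨C, hC⟩ := hf.exists_bound
    exact Integrable.of_bound (C := C) hf.measurable.aestronglyMeasurable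
      (Eventually.of_forall hC)
  have hc : IsCadlag fun t => Y t ω + (-1) * impact θ ν t ω := c1.add (c2.const_mul _)
  have hsq : Integrable fun t => (Y t ω + (-1) * impact θ ν t ω) ^ 2 := by
    obtain ⟨C, hC⟩ := hc.exists_bound
    refine Integrable.of_bound (C := C ^ 2) (hc.measurable.pow_const 2).aestronglyMeasurable
      (Eventually.of_forall fun t => ?_)
    rw [Real.norm_eq_abs, abs_pow]
    exact pow_le_pow_left₀ (abs_nonneg _) (hC t) 2
  have hz := eq_zero_of_eq_neg_integral θ.rho_pos (int hc) hsq (fun t => by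
    rw [← integral_const_mul]
    have e : ∀ s, -θ.rho * (Y s ω + (-1) * impact θ ν s ω) =
        (-θ.rho * Y s ω + θ.gam * ν s ω) - (-θ.rho * impact θ ν s ω + θ.gam * ν s ω) :=
      fun s => by ring
    simp_rw [e]
    have i1 : Integrable fun s => -θ.rho * Y s ω + θ.gam * ν s ω :=
      ((int c1).const_mul _).add (hi.const_mul _)
    have i2 : Integrable fun s => -θ.rho * impact θ ν s ω + θ.gam * ν s ω :=
      ((int c2).const_mul _).add (hi.const_mul _)
    rw [integral_sub i1.integrableOn i2.integrableOn]
    have h1t := h1 t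
    have h2t := h2 t
    linarith)
  intro t
  have := hz t
  linarith

end StateProcesses

/-! ### The first order condition and its equivalence with the backward equation. -/

section FirstOrder

variable {Ω : Type*} {T : ℝ} [Fact (0 < T)] {mΩ : MeasurableSpace Ω} {μ : Measure Ω}
  [IsProbabilityMeasure μ] {𝓕 : Filtration (Time T) mΩ}

/-- The kernel of the quadratic inventory penalties. -/
def gameKernel (θ : Params) (t s : Time T) : ℝ :=
  2 * θ.phi * (T - max (t : ℝ) s) + 2 * θ.vrho

lemma isBddKernel_game (θ : Params) : IsBddKernel (gameKernel (T := T) θ) :=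
  isBddKernel_of_continuous (by unfold gameKernel; fun_prop)

lemma isPosKernel_game (θ : Params) : IsPosKernel (gameKernel (T := T) θ) := by
  have hm : IsBddKernel fun t s : Time T => T - max (t : ℝ) s :=
    isBddKernel_of_continuous (by fun_prop)
  have h1 : IsBddKernel fun _ _ : Time T => (1 : ℝ) := isBddKernel_of_continuous continuous_const
  have h2 : (0 : ℝ) ≤ 2 * θ.phi := by have := θ.phi_pos; positivity
  have h3 : (0 : ℝ) ≤ 2 * θ.vrho := by have := θ.vrho_pos; positivity
  have h := IsPosKernel.add (hm.const_mul (2 * θ.phi)) (h1.const_mul (2 * θ.vrho))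
    (isPosKernel_sub_max.const_mul h2) (isPosKernel_one.const_mul h3)
  simp only [mul_one] at h
  exact h

lemma gameKernel_comm (θ : Params) (t s : Time T) : gameKernel θ t s = gameKernel θ s t := by
  unfold gameKernel
  rw [max_comm]

/-- The affine part of the gradient of the performance functional. -/
def target (θ : Params) (P : Time T → Ω → ℝ) (x : ℝ) (Y : Time T → Ω → ℝ) : Time T → Ω → ℝ :=
  fun t ω => P t ω - P ⊤ ω - θ.kap * Y t ω + (2 * θ.phi * x * (T - t) + 2 * θ.vrho * x)

lemma sqInt_target (θ : Params) {P : Time T → Ω → ℝ} (h𝓕 : UsualConditions 𝓕 μ) (hP : IsH2 𝓕 μ P)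
    (x : ℝ) {Y : Time T → Ω → ℝ} (hY : SqInt μ Y) : SqInt μ (target θ P x Y) := by
  have h := (((hP.sqInt h𝓕).add ((sqInt_of_memLp (T := T) (hP.memLp ⊤)).const_mul (-1))).add
    (hY.const_mul (-θ.kap))).add (sqInt_continuous (μ := μ)
      (q := fun t : Time T => 2 * θ.phi * x * (T - t) + 2 * θ.vrho * x) (by fun_prop))
  refine h.congr (Eventually.of_forall fun p => ?_)
  simp only [target]
  ring

/-- The gradient of the performance functional at `v`, before projection on the admissible
rates. -/
def gap (θ : Params) (P : Time T → Ω → ℝ) (x : ℝ) (Y v : Time T → Ω → ℝ) : Time T → Ω → ℝ :=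
  fun t ω => target θ P x Y t ω - 2 * θ.lam * v t ω - kop (gameKernel θ) v t ω

lemma sqInt_gap (θ : Params) {P : Time T → Ω → ℝ} (h𝓕 : UsualConditions 𝓕 μ) (hP : IsH2 𝓕 μ P)
    (x : ℝ) {Y v : Time T → Ω → ℝ} (hY : SqInt μ Y) (hv : SqInt μ v) :
    SqInt μ (gap θ P x Y v) :=
  (((sqInt_target θ h𝓕 hP x hY).add (hv.const_mul (-(2 * θ.lam)))).add
    ((hv.kernel (isBddKernel_game θ)).const_mul (-1))).congr
    (Eventually.of_forall fun p => by simp only [gap]; ring)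

/-- The first order condition. -/
def FirstOrder (θ : Params) (𝓕 : Filtration (Time T) mΩ) (μ : Measure Ω) (P : Time T → Ω → ℝ)
    (x : ℝ) (Y v : Time T → Ω → ℝ) : Prop :=
  ∀ w ∈ Admissible 𝓕 μ, ∫ p, gap θ P x Y v p.1 p.2 * w p.1 p.2 ∂(timeProd T μ) = 0

lemma isWeakSol_toL2_iff {k : Time T → Time T → ℝ} (hk : IsBddKernel k) (c : ℝ)
    {F v : Time T → Ω → ℝ} (hF : SqInt μ F) (hv : v ∈ Admissible 𝓕 μ) :
    IsWeakSol (progL2 𝓕 μ) c (kernelOp hk μ) (toL2 F hF) (toL2 v hv.2) ↔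
      ∀ w ∈ Admissible 𝓕 μ,
        ∫ p, (F p.1 p.2 - c * v p.1 p.2 - kop k v p.1 p.2) * w p.1 p.2 ∂(timeProd T μ) = 0 := by
  have key : ∀ (w : Time T → Ω → ℝ) (hw : w ∈ Admissible 𝓕 μ),
      ∫ p, (F p.1 p.2 - c * v p.1 p.2 - kop k v p.1 p.2) * w p.1 p.2 ∂(timeProd T μ) =
      inner ℝ (toL2 F hF) (toL2 w hw.2) -
        inner ℝ (c • toL2 v hv.2 + kernelOp hk μ (toL2 v hv.2)) (toL2 w hw.2) := fun w hw => by
    rw [inner_add_left, inner_smul_left, kernelOp_toL2, inner_toL2, inner_toL2, inner_toL2,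
      RCLike.conj_to_real, ← integral_const_mul]
    have i1 := hF.integrable_mul (w := w) hw.2
    have i2 := (SqInt.integrable_mul (v := v) (w := w) hv.2 hw.2).const_mul c
    have i3 := (SqInt.kernel hk (v := v) hv.2).integrable_mul (w := w) hw.2
    have i12 : Integrable (fun p : Time T × Ω => F p.1 p.2 * w p.1 p.2
        - c * (v p.1 p.2 * w p.1 p.2)) (timeProd T μ) := i1.sub i2
    rw [← sub_sub, ← integral_sub i1 i2, ← integral_sub i12 i3]
    congr with p
    ring
  constructor
  · rintro ⟨-, h⟩ w hw
    rw [key w hw, h _ (toL2_mem_progL2 hw), sub_self]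
  · intro h
    refine ⟨toL2_mem_progL2 hv, fun W hW => ?_⟩
    obtain ⟨w, hw, rfl⟩ := exists_admissible_of_mem hW
    have := key w hw
    rw [h w hw] at this
    linarith

lemma firstOrder_iff_isWeakSol (θ : Params) {P : Time T → Ω → ℝ} (h𝓕 : UsualConditions 𝓕 μ)
    (hP : IsH2 𝓕 μ P) (x : ℝ) {Y v : Time T → Ω → ℝ} (hY : SqInt μ Y)
    (hv : v ∈ Admissible 𝓕 μ) :
    FirstOrder θ 𝓕 μ P x Y v ↔ IsWeakSol (progL2 𝓕 μ) (2 * θ.lam)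
      (kernelOp (isBddKernel_game θ) μ) (toL2 _ (sqInt_target θ h𝓕 hP x hY)) (toL2 v hv.2) :=
  (isWeakSol_toL2_iff (isBddKernel_game θ) (2 * θ.lam) (sqInt_target θ h𝓕 hP x hY) hv).symm

/-- The gradient looks into the future only through `P_T` and integrals up to `T`. Rewriting `∫_t^T
X` as `∫_0^T X - ∫_0^t X` collects these in a term free of `t`. -/
lemma gap_eq (θ : Params) (P : Time T → Ω → ℝ) (x : ℝ) (Y : Time T → Ω → ℝ)
    {v : Time T → Ω → ℝ} (hv : SqInt μ v) :
    ∀ᵐ ω ∂μ, ∀ t, gap θ P x Y v t ω =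
      (P t ω - θ.kap * Y t ω - 2 * θ.lam * v t ω
        - 2 * θ.phi * kop (decayKernel 0) (inventory x v) t ω)
      + (2 * θ.phi * kop (decayKernel 0) (inventory x v) ⊤ ω
        + 2 * θ.vrho * inventory x v ⊤ ω - P ⊤ ω) := by
  filter_upwards [hv.ae_integrable] with ω hω t
  have h := integral_sub_primitive x (2 * θ.phi) (2 * θ.vrho) hω t
  rw [kop_decayKernel_zero, kop_decayKernel_zero]
  simp only [gap, target, kop, gameKernel, inventory, Set.Iic_top, Measure.restrict_univ] at h ⊢
  linarith

lemma integral_mul_condExp {m : MeasurableSpace Ω} (hm : m ≤ mΩ) {Z w : Ω → ℝ}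
    (hZ : MemLp Z 2 μ) (hw : StronglyMeasurable[m] w) (hw2 : MemLp w 2 μ) :
    ∫ ω, Z ω * w ω ∂μ = ∫ ω, (μ[Z | m]) ω * w ω ∂μ := by
  have h1 : Integrable (w * Z) μ := MemLp.integrable_mul hw2 hZ
  have h2 := condExp_mul_of_stronglyMeasurable_left hw h1 (hZ.integrable one_le_two)
  calc ∫ ω, Z ω * w ω ∂μ = ∫ ω, (w * Z) ω ∂μ := by
        congr with ω; simp [mul_comm]
    _ = ∫ ω, (μ[w * Z | m]) ω ∂μ := (integral_condExp hm).symm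
    _ = ∫ ω, (μ[Z | m]) ω * w ω ∂μ := by
        refine integral_congr_ae ?_
        filter_upwards [h2] with ω hω
        rw [hω, Pi.mul_apply, mul_comm]

/-- At almost every time `t`, the variable `w t` is `𝓕 t`-measurable and square integrable, hence
orthogonal to `Z - E[Z | 𝓕 t]`. -/
lemma integral_sub_martingale_mul {Z : Ω → ℝ} (hZ : MemLp Z 2 μ) {M : Time T → Ω → ℝ}
    (hM : ∀ t, M t =ᵐ[μ] μ[Z | 𝓕 t]) (hD : SqInt μ fun t ω => Z ω - M t ω)
    {w : Time T → Ω → ℝ} (hw : w ∈ Admissible 𝓕 μ) :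
    ∫ p, (Z p.2 - M p.1 p.2) * w p.1 p.2 ∂(timeProd T μ) = 0 := by
  have h1 := integral_prod _ (hD.integrable_mul (w := w) hw.2)
  rw [h1]
  refine integral_eq_zero_of_ae ?_
  filter_upwards [SqInt.ae_memLp_section hw.2] with t ht
  have hwt : StronglyMeasurable[𝓕 t] (w t) := hw.1.stronglyAdapted t
  have hMt : MemLp (M t) 2 μ := (memLp_congr_ae (hM t)).2 (hZ.condExp one_le_two)
  simp only [sub_mul, Pi.zero_apply]
  have j1 : Integrable (fun ω => Z ω * w t ω) μ := MemLp.integrable_mul hZ ht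
  have j2 : Integrable (fun ω => M t ω * w t ω) μ := MemLp.integrable_mul hMt ht
  rw [integral_sub j1 j2,
    integral_mul_condExp (𝓕.le t) hZ hwt ht, sub_eq_zero]
  refine integral_congr_ae ?_
  filter_upwards [hM t] with ω hω
  rw [hω]

lemma SqIntMartingale.sqInt_process (h𝓕 : UsualConditions 𝓕 μ) {L : Time T → Ω → ℝ}
    (hL : SqIntMartingale 𝓕 μ L) : SqInt μ L := by
  refine CadlagAdapted.sqInt h𝓕 ⟨hL.martingale.1, hL.cadlag⟩ (hL.sqInt ⊤).2 fun t => ?_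
  rw [← eLpNorm_congr_ae (hL.martingale.2 t ⊤ le_top)]
  exact eLpNorm_condExp_le_eLpNorm _ one_le_two

lemma exists_sqIntMartingale (h𝓕 : UsualConditions 𝓕 μ) {Z : Ω → ℝ} (hZ : MemLp Z 2 μ) :
    ∃ M : Time T → Ω → ℝ, SqIntMartingale 𝓕 μ M ∧ ∀ t, M t =ᵐ[μ] μ[Z | 𝓕 t] := by
  obtain ⟨M, h1, h2, h3⟩ := exists_cadlag_condExp h𝓕 (hZ.integrable one_le_two)
  refine ⟨M, ⟨⟨h1, fun s t hst => ?_⟩, Eventually.of_forall h2, fun t =>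
    (memLp_congr_ae (h3 t)).2 (hZ.condExp one_le_two)⟩, h3⟩
  exact (condExp_congr_ae (h3 t)).trans
    ((condExp_condExp_of_le (𝓕.mono hst) (𝓕.le t)).trans (h3 s).symm)

lemma SqIntMartingale.const_mul {L : Time T → Ω → ℝ} (hL : SqIntMartingale 𝓕 μ L) (c : ℝ) :
    SqIntMartingale 𝓕 μ fun t ω => c * L t ω := by
  refine ⟨hL.martingale.smul c, ?_, fun t => (hL.sqInt t).const_mul c⟩
  filter_upwards [hL.cadlag] with ω hω using hω.const_mul c

/-- The gradient is an adapted process plus `Z - E[Z | 𝓕_t]`, and the second summand is orthogonal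
to every admissible rate. So the first order condition says that the adapted part vanishes, which is
the integrated backward equation. -/
theorem firstOrder_iff_solvesBackward (θ : Params) {P : Time T → Ω → ℝ}
    (h𝓕 : UsualConditions 𝓕 μ) (hP : IsH2 𝓕 μ P) (x : ℝ) {Y v : Time T → Ω → ℝ}
    (hYc : CadlagAdapted 𝓕 μ Y)
    (hY : SqInt μ Y) (hv : v ∈ Admissible 𝓕 μ) :
    FirstOrder θ 𝓕 μ P x Y v ↔ SolvesBackward 𝓕 μ v
      (fun t ω => (P t ω - θ.kap * Y t ω) / (2 * θ.lam)
        - ∫ s in Set.Iic t, θ.phi / θ.lam * inventory x v s ω)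
      (fun ω => θ.vrho / θ.lam * inventory x v ⊤ ω - θ.kap / (2 * θ.lam) * Y ⊤ ω) := by
  have hlam := θ.lam_pos.ne'
  set I := kop (decayKernel 0) (inventory x v) with hI
  have hIint : ∀ t ω, ∫ s in Set.Iic t, θ.phi / θ.lam * inventory x v s ω =
      θ.phi / θ.lam * I t ω := fun t ω => by
    rw [integral_const_mul, hI, kop_decayKernel_zero]
  simp only [hIint]
  have hXc : CadlagAdapted 𝓕 μ (inventory x v) := cadlagAdapted_inventory x hv
  have hX2 : SqInt μ (inventory x v) := sqInt_inventory x hv.2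
  have hIc : CadlagAdapted 𝓕 μ I := by
    -- The inventory is càdlàg only almost surely; passing to a progressive version makes its time
    -- integral adapted.
    obtain ⟨X', hX', hXX'⟩ := hXc.exists_admissible h𝓕 hX2
    exact (cadlagAdapted_kop hX' 0).congr h𝓕 (ae_eq_kop hXX'.symm.aeEq)
  have hI2 : ∀ t, MemLp (I t) 2 μ := fun t => hX2.memLp_kop (isBddKernel_decay 0) t
  let Z : Ω → ℝ := fun ω => 2 * θ.phi * I ⊤ ω + 2 * θ.vrho * inventory x v ⊤ ω - P ⊤ ω
  have hZ : MemLp Z 2 μ := (((hI2 ⊤).const_mul _).add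
    ((memLp_inventory x hv.2 ⊤).const_mul _)).sub (hP.memLp ⊤)
  have hgap := gap_eq θ P x Y hv.2
  constructor
  · intro h
    obtain ⟨M, hM, hMZ⟩ := exists_sqIntMartingale h𝓕 hZ
    have hM2 : SqInt μ M := hM.sqInt_process h𝓕
    have hMc : CadlagAdapted 𝓕 μ M := ⟨hM.martingale.1, hM.cadlag⟩
    -- `R` is `2λ` times the càdlàg version of `v` to be exhibited. The adapted part `w` of the
    -- gradient is `R' - 2λv`, where `R'` is a progressive version of `R`, so that `w` can itself
    -- serve as test rate and `∫ w² = 0`.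
    let R : Time T → Ω → ℝ := fun t ω =>
      ((P t ω + (-θ.kap) * Y t ω) + (-(2 * θ.phi)) * I t ω) + M t ω
    have hRc : CadlagAdapted 𝓕 μ R :=
      ((hP.cadlagAdapted.add (hYc.const_mul _)).add (hIc.const_mul _)).add hMc
    obtain ⟨R', hR', -, hRR'⟩ := hRc.exists_isCadlag h𝓕
    let w : Time T → Ω → ℝ := fun t ω => R' t ω - 2 * θ.lam * v t ω
    have hwp : IsStronglyProgressive 𝓕 w :=
      hR'.sub ((isStronglyProgressive_const 𝓕 (2 * θ.lam)).mul hv.1)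
    have hgw : AEEq μ (gap θ P x Y v) fun t ω => w t ω + (Z ω - M t ω) := by
      refine Indist.aeEq ?_
      filter_upwards [hgap, hRR'] with ω h1 h2 t
      rw [h1 t]
      simp only [w, ← h2 t, R, Z]
      ring
    have hD : SqInt μ fun t ω => Z ω - M t ω :=
      ((sqInt_of_memLp (T := T) hZ).add (hM2.const_mul (-1))).congr
        (Eventually.of_forall fun p => by simp only []; ring)
    have hgap2 : SqInt μ (gap θ P x Y v) := sqInt_gap θ h𝓕 hP x hY hv.2
    have hw2 : SqInt μ w := by
      refine (hgap2.add (hD.const_mul (-1))).congr ?_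
      filter_upwards [hgw] with p hp
      rw [hp]; ring
    have hwA : w ∈ Admissible 𝓕 μ := ⟨hwp, hw2⟩
    have e1 := h w hwA
    have e2 := integral_sub_martingale_mul hZ hMZ hD hwA
    have e3 : ∫ p, w p.1 p.2 ^ 2 ∂(timeProd T μ) = 0 := by
      have e0 := integral_sub (hgap2.integrable_mul hw2) (hD.integrable_mul hw2)
      rw [e1, e2, sub_zero] at e0
      refine (integral_congr_ae ?_).trans e0
      filter_upwards [hgw] with p hp
      rw [hp]; ring
    have e4 := (integral_eq_zero_iff_of_nonneg (fun p : Time T × Ω => sq_nonneg (w p.1 p.2))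
      (MemLp.integrable_sq hw2)).1 e3
    refine ⟨fun t ω => 1 / (2 * θ.lam) * R t ω, fun t ω => 1 / (2 * θ.lam) * M t ω,
      hRc.const_mul _, ?_, hM.const_mul _, ?_, ?_⟩
    · filter_upwards [e4, hRR'.aeEq] with p h1 h2
      have h3 : w p.1 p.2 = 0 := pow_eq_zero_iff two_ne_zero |>.1 h1
      simp only [w, ← h2] at h3
      rw [sub_eq_zero.1 h3]
      field_simp
    · refine Eventually.of_forall fun ω t => ?_
      simp only [R]
      field_simp
      ring
    -- Since `Z` is `𝓕_T`-measurable, the martingale equals `Z` at time `T`; inserting this in `R`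
    -- gives the terminal condition.
    · have hZm : StronglyMeasurable[𝓕 ⊤] Z :=
        (((hIc.adapted ⊤).const_mul _).add ((hXc.adapted ⊤).const_mul _)).sub
          (hP.cadlagAdapted.adapted ⊤)
      have hMT := hMZ ⊤
      rw [condExp_of_stronglyMeasurable (𝓕.le ⊤) hZm (hZ.integrable one_le_two)] at hMT
      filter_upwards [hMT] with ω hω
      simp only [R, hω, Z]
      field_simp
      ring
  · rintro ⟨v', L, hv'c, hv'v, hL, heq, hterm⟩ w hw
    have hL2 := hL.sqInt_process h𝓕
    have hD0 : SqInt μ fun t ω => L ⊤ ω - L t ω :=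
      ((sqInt_of_memLp (T := T) (hL.sqInt ⊤)).add (hL2.const_mul (-1))).congr
        (Eventually.of_forall fun p => by simp only []; ring)
    -- Subtracting the backward equation at `t` from the one at `T` leaves only the martingale
    -- increment, which is orthogonal to admissible rates.
    have h1 : AEEq μ (gap θ P x Y v) fun t ω => 2 * θ.lam * (L ⊤ ω - L t ω) := by
      have h2 : ∀ᵐ ω ∂μ, ∀ t, gap θ P x Y v t ω + 2 * θ.lam * (v t ω - v' t ω) =
          2 * θ.lam * (L ⊤ ω - L t ω) := by
        filter_upwards [hgap, heq, hterm] with ω h1 h2 h3 t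
        have h4 := h2 t
        have h5 := h2 ⊤
        rw [h3] at h5
        rw [h1 t]
        field_simp at h4 h5
        linarith
      filter_upwards [ae_timeProd_of_ae h2, hv'v] with p h3 h4
      rw [← h3, h4]; ring
    have h2 := integral_sub_martingale_mul (hL.sqInt ⊤)
      (fun t => (hL.martingale.2 t ⊤ le_top).symm) hD0 hw
    calc ∫ p, gap θ P x Y v p.1 p.2 * w p.1 p.2 ∂(timeProd T μ)
        = ∫ p, 2 * θ.lam * ((L ⊤ p.2 - L p.1 p.2) * w p.1 p.2) ∂(timeProd T μ) := by
          refine integral_congr_ae ?_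
          filter_upwards [h1] with p hp
          rw [hp]; ring
      _ = 0 := by rw [integral_const_mul, h2, mul_zero]

end FirstOrder

/-! ### The performance functional as a concave quadratic form. -/

section Objective

variable {T : ℝ} [Fact (0 < T)]

lemma integral_sub_mul {f : Time T → ℝ} (hf : Integrable f) :
    ∫ s : Time T, (T - s) * f s = ∫ s : Time T, ∫ u in Set.Iic s, f u := by
  have h := integral_sub_primitive 0 1 0 hf ⊥
  have e : ∀ s : Time T, (1 * (T - max ((⊥ : Time T) : ℝ) s) + 0) * f s = (T - s) * f s :=
    fun s => by
      have : ((⊥ : Time T) : ℝ) ≤ s := bot_le (a := s)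
      rw [max_eq_right this]; ring
  simp_rw [e] at h
  have h0 : ∫ s in Set.Iic (⊥ : Time T), (0 - ∫ u in Set.Iic s, f u) = 0 := by
    refine setIntegral_measure_zero _ ?_
    rw [Set.Iic_bot]
    exact volume_singleton_time ⊥
  rw [h0] at h
  simp only [zero_sub, integral_neg] at h
  linarith

lemma integral_mul_integral_sub_max {f : Time T → ℝ} (hf : Integrable f) :
    ∫ t : Time T, f t * ∫ s : Time T, (T - max (t : ℝ) s) * f s =
      ∫ t : Time T, (∫ u in Set.Iic t, f u) ^ 2 := by
  have h := integral_mul_integral_superposition (T := T) isBddKernel_indicator_one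
    (q := fun _ => 1) continuous_const hf
  simp_rw [integral_indicator_mul_indicator] at h
  rw [h]
  congr with u
  have e : ∫ s, (Set.Iic u).indicator (fun _ => (1 : ℝ)) s * f s = ∫ s in Set.Iic u, f s := by
    rw [← integral_indicator measurableSet_Iic]
    congr with s
    by_cases hs : s ∈ Set.Iic u <;> simp [Set.indicator, hs]
  rw [e]; ring

/-- Pathwise expansion in powers of the initial position and the rate: the cross terms in `x` enter
the linear part, and the squares of `∫ f` become the form of the game kernel. -/
lemma objective_path (θ : Params) (x q : ℝ) {f h : Time T → ℝ} (hf : Integrable f)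
    (hh : Integrable fun t => h t * f t) :
    (∫ t, h t * f t) - θ.lam * (∫ t, f t ^ 2)
      - θ.phi * (∫ t : Time T, (x - ∫ s in Set.Iic t, f s) ^ 2)
      + (x - ∫ s, f s) * (q - θ.vrho * (x - ∫ s, f s)) =
    (-θ.phi * (∫ _ : Time T, x ^ 2) + x * q - θ.vrho * x ^ 2)
      + (∫ t : Time T, (h t - q + (2 * θ.phi * x * (T - t) + 2 * θ.vrho * x)) * f t)
      - θ.lam * (∫ t, f t ^ 2) - 1 / 2 * ∫ t, (∫ s, gameKernel θ t s * f s) * f t := by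
  have hVc : Continuous fun t : Time T => ∫ s in Set.Iic t, f s := continuous_setIntegral_Iic hf
  have hm : IsBddKernel fun t s : Time T => T - max (t : ℝ) s :=
    isBddKernel_of_continuous (by fun_prop)
  have i1 : Integrable fun t : Time T => (T - t) * f t := by
    have hb : IsBddKernel fun _ s : Time T => T - (s : ℝ) :=
      isBddKernel_of_continuous (by fun_prop)
    exact hb.integrable_mul hf ⊥
  have i2 : Integrable fun t : Time T => h t * f t + (2 * θ.vrho * x - q) * f t :=
    hh.add (hf.const_mul _)
  have e1 : ∫ t : Time T, (h t - q + (2 * θ.phi * x * (T - t) + 2 * θ.vrho * x)) * f t =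
      (∫ t, h t * f t) + (2 * θ.vrho * x - q) * (∫ t, f t)
        + 2 * θ.phi * x * ∫ s : Time T, ∫ u in Set.Iic s, f u := by
    rw [← integral_sub_mul hf, ← integral_const_mul, ← integral_const_mul,
      ← integral_add hh (hf.const_mul _), ← integral_add i2 (i1.const_mul _)]
    congr with t; ring
  have i3 : Integrable fun t : Time T => f t * ∫ s : Time T, (T - max (t : ℝ) s) * f s := by
    obtain ⟨C, hC⟩ := hm.bdd
    exact hf.mul_bdd (c := C * ∫ s, |f s|) (hm.integrable_integral hf).1
      (Eventually.of_forall fun t => IsBddKernel.abs_integral_le hC hf t)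
  have e2 : ∫ t, (∫ s, gameKernel θ t s * f s) * f t =
      2 * θ.phi * (∫ t : Time T, (∫ u in Set.Iic t, f u) ^ 2) + 2 * θ.vrho * (∫ t, f t) ^ 2 := by
    rw [← integral_mul_integral_sub_max hf, ← integral_const_mul, pow_two, ← mul_assoc,
      ← integral_const_mul, ← integral_add (i3.const_mul _) (hf.const_mul _)]
    congr with t
    have e3 : ∫ s, gameKernel θ t s * f s =
        2 * θ.phi * (∫ s : Time T, (T - max (t : ℝ) s) * f s) + 2 * θ.vrho * ∫ s, f s := by
      rw [← integral_const_mul, ← integral_const_mul,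
        ← integral_add ((hm.integrable_mul hf t).const_mul _) (hf.const_mul _)]
      congr with s
      unfold gameKernel; ring
    rw [e3]; ring
  have j1 : Integrable fun t : Time T => x ^ 2 - 2 * x * ∫ u in Set.Iic t, f u :=
    integrable_of_bounded_continuous (continuous_const.sub (continuous_const.mul hVc))
  have e4 : ∫ t : Time T, (x - ∫ s in Set.Iic t, f s) ^ 2 = (∫ _ : Time T, x ^ 2)
      - 2 * x * (∫ s : Time T, ∫ u in Set.Iic s, f u)
      + ∫ t : Time T, (∫ u in Set.Iic t, f u) ^ 2 := by
    have j2 : Integrable fun t : Time T => 2 * x * ∫ u in Set.Iic t, f u :=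
      integrable_of_bounded_continuous (continuous_const.mul hVc)
    have j3 : Integrable fun t : Time T => (∫ u in Set.Iic t, f u) ^ 2 :=
      integrable_of_bounded_continuous (hVc.pow 2)
    rw [← integral_const_mul, ← integral_sub (integrable_const _) j2, ← integral_add j1 j3]
    congr with t; ring
  rw [e1, e2, e4]
  ring

variable {Ω : Type*} {mΩ : MeasurableSpace Ω} {μ : Measure Ω}
  [IsProbabilityMeasure μ] {𝓕 : Filtration (Time T) mΩ}

lemma SqInt.integrable_integral_mul {v w : Time T → Ω → ℝ} (hv : SqInt μ v) (hw : SqInt μ w) :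
    Integrable (fun ω => ∫ t, v t ω * w t ω) μ :=
  (hv.integrable_mul hw).integral_prod_right

lemma objective_eq (θ : Params) {P : Time T → Ω → ℝ} (h𝓕 : UsualConditions 𝓕 μ)
    (hP : IsH2 𝓕 μ P) (x : ℝ) {v ν : Time T → Ω → ℝ} (hν : SqInt μ ν) (hv : SqInt μ v) :
    objective θ μ P x v ν =
      (∫ ω, (-θ.phi * (∫ _ : Time T, x ^ 2) + x * P ⊤ ω - θ.vrho * x ^ 2) ∂μ)
      + (inner ℝ (toL2 _ (sqInt_target θ h𝓕 hP x (sqInt_impact θ hν))) (toL2 v hv)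
        - 2 * θ.lam / 2 * inner ℝ (toL2 v hv) (toL2 v hv)
        - 1 / 2 * inner ℝ (kernelOp (isBddKernel_game θ) μ (toL2 v hv)) (toL2 v hv)) := by
  have hF := sqInt_target θ h𝓕 hP x (sqInt_impact θ hν)
  have hK := hv.kernel (isBddKernel_game θ)
  have hPY : SqInt μ fun t ω => P t ω + (-θ.kap) * impact θ ν t ω :=
    (hP.sqInt h𝓕).add ((sqInt_impact θ hν).const_mul _)
  rw [kernelOp_toL2, inner_toL2_eq_integral, inner_toL2_eq_integral, inner_toL2_eq_integral,
    ← integral_const_mul (2 * θ.lam / 2), ← integral_const_mul (1 / 2 : ℝ)]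
  have j1 := hF.integrable_integral_mul hv
  have j2 := (hv.integrable_integral_mul hv).const_mul (2 * θ.lam / 2)
  have j3 := (hK.integrable_integral_mul hv).const_mul (1 / 2)
  have j4 : Integrable (fun ω => -θ.phi * (∫ _ : Time T, x ^ 2) + x * P ⊤ ω - θ.vrho * x ^ 2) μ :=
    ((integrable_const _).add (((hP.memLp ⊤).integrable one_le_two).const_mul x)).sub
      (integrable_const _)
  have j12 : Integrable (fun ω => (∫ t, target θ P x (impact θ ν) t ω * v t ω)
      - 2 * θ.lam / 2 * ∫ t, v t ω * v t ω) μ := j1.sub j2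
  have j123 : Integrable (fun ω => (∫ t, target θ P x (impact θ ν) t ω * v t ω)
      - 2 * θ.lam / 2 * (∫ t, v t ω * v t ω)
      - 1 / 2 * ∫ t, kop (gameKernel θ) v t ω * v t ω) μ := j12.sub j3
  rw [← integral_sub j1 j2, ← integral_sub j12 j3, ← integral_add j4 j123]
  refine integral_congr_ae ?_
  filter_upwards [hv.ae_integrable, (hPY.integrable_mul hv).prod_left_ae] with ω h1 h2
  have h3 := objective_path θ x (P ⊤ ω) (h := fun t => P t ω - θ.kap * impact θ ν t ω) h1
    (h2.congr (Eventually.of_forall fun t => by simp only []; ring))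
  have e1 : ∀ t, inventory x v t ω = x - ∫ s in Set.Iic t, v s ω := fun _ => rfl
  simp only [e1, Set.Iic_top, Measure.restrict_univ]
  rw [h3]
  have e2 : ∀ t : Time T, target θ P x (impact θ ν) t ω = P t ω - θ.kap * impact θ ν t ω - P ⊤ ω
      + (2 * θ.phi * x * (T - t) + 2 * θ.vrho * x) := fun t => by
    unfold target; ring
  simp only [e2, kop, pow_two]
  ring

/-- Maximizers of the performance functional are characterized by the first order condition. -/
theorem firstOrder_iff_maximizes (θ : Params) {P : Time T → Ω → ℝ} (h𝓕 : UsualConditions 𝓕 μ)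
    (hP : IsH2 𝓕 μ P) (x : ℝ) {v ν : Time T → Ω → ℝ} (hν : ν ∈ Admissible 𝓕 μ)
    (hv : v ∈ Admissible 𝓕 μ) :
    FirstOrder θ 𝓕 μ P x (impact θ ν) v ↔
      ∀ w ∈ Admissible 𝓕 μ, objective θ μ P x w ν ≤ objective θ μ P x v ν := by
  have hlam := θ.lam_pos
  rw [firstOrder_iff_isWeakSol θ h𝓕 hP x (sqInt_impact θ hν.2) hv,
    isWeakSol_iff_maximizes (by positivity)
      (inner_kernelOp_nonneg (isBddKernel_game θ) (isPosKernel_game θ))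
      (inner_kernelOp_comm (isBddKernel_game θ) (gameKernel_comm θ)) (toL2_mem_progL2 hv)]
  constructor
  · intro h w hw
    rw [objective_eq θ h𝓕 hP x hν.2 hw.2, objective_eq θ h𝓕 hP x hν.2 hv.2]
    have := h _ (toL2_mem_progL2 hw)
    linarith
  · intro h W hW
    obtain ⟨w, hw, rfl⟩ := exists_admissible_of_mem hW
    have := h w hw
    rw [objective_eq θ h𝓕 hP x hν.2 hw.2, objective_eq θ h𝓕 hP x hν.2 hv.2] at this
    linarith

end Objective

/-! ### The FBSDEs in terms of first order conditions, and the equilibrium. -/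

section Systems

variable {Ω : Type*} {T : ℝ} [Fact (0 < T)] {mΩ : MeasurableSpace Ω} {μ : Measure Ω}
  [IsProbabilityMeasure μ] {𝓕 : Filtration (Time T) mΩ}

lemma SolvesBackward.congr {v w D D' : Time T → Ω → ℝ} {ξ ξ' : Ω → ℝ}
    (h : SolvesBackward 𝓕 μ v D ξ) (hv : AEEq μ v w)
    (hD : ∀ᵐ ω ∂μ, ∀ t, D t ω - D ⊥ ω = D' t ω - D' ⊥ ω) (hξ : ∀ᵐ ω ∂μ, ξ ω = ξ' ω) :
    SolvesBackward 𝓕 μ w D' ξ' := by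
  obtain ⟨v', L, h1, h2, h3, h4, h5⟩ := h
  refine ⟨v', L, h1, h2.trans hv, h3, ?_, ?_⟩
  · filter_upwards [h4, hD] with ω e1 e2 t
    rw [e1 t, e2 t]
  · filter_upwards [h5, hξ] with ω e1 e2
    rw [e1, e2]

lemma FirstOrder.congr {θ : Params} {P : Time T → Ω → ℝ} {x : ℝ} {Y Y' v v' : Time T → Ω → ℝ}
    (h : FirstOrder θ 𝓕 μ P x Y v) (hY : AEEq μ Y Y') (hv : AEEq μ v v') :
    FirstOrder θ 𝓕 μ P x Y' v' := by
  intro w hw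
  refine (integral_congr_ae ?_).trans (h w hw)
  filter_upwards [hY, hv, (ae_eq_kop (k := gameKernel θ) hv).aeEq] with p h1 h2 h3
  simp only [gap, target, h1, h2, h3]

lemma SolvesImpact.sqInt {θ : Params} {ν Y : Time T → Ω → ℝ} (hν : ν ∈ Admissible 𝓕 μ)
    (h : SolvesImpact θ 𝓕 μ ν Y) : SqInt μ Y :=
  (sqInt_impact θ hν.2).congr (h.indist hν).symm.aeEq

theorem decoupledFBSDE_iff (θ : Params) {P : Time T → Ω → ℝ} (h𝓕 : UsualConditions 𝓕 μ)
    (hP : IsH2 𝓕 μ P) (x : ℝ) {X Y v : Time T → Ω → ℝ} (hYc : CadlagAdapted 𝓕 μ Y)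
    (hY : SqInt μ Y) (hv : v ∈ Admissible 𝓕 μ) :
    DecoupledFBSDE θ 𝓕 μ P Y x X v ↔
      SolvesInventory 𝓕 μ x v X ∧ FirstOrder θ 𝓕 μ P x Y v := by
  rw [firstOrder_iff_solvesBackward θ h𝓕 hP x hYc hY hv]
  constructor
  · rintro ⟨h1, h2⟩
    refine ⟨h1, h2.congr (EventuallyEq.refl _ _) ?_ ?_⟩
    · filter_upwards [h1.indist] with ω hω t
      simp only [hω]
    · filter_upwards [h1.indist] with ω hω
      simp only [hω]
  · rintro ⟨h1, h2⟩
    refine ⟨h1, h2.congr (EventuallyEq.refl _ _) ?_ ?_⟩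
    · filter_upwards [h1.indist] with ω hω t
      simp only [hω]
    · filter_upwards [h1.indist] with ω hω
      simp only [hω]

/-- The drift of the coupled system is that of the decoupled one up to a constant. -/
lemma agent_drift_eq (θ : Params) (P : Time T → Ω → ℝ) {x : ℝ} {X Y v ν : Time T → Ω → ℝ}
    (hν : ν ∈ Admissible 𝓕 μ) (hv : v ∈ Admissible 𝓕 μ) (hX : SolvesInventory 𝓕 μ x v X)
    (hY : SolvesImpact θ 𝓕 μ ν Y) :
    ∀ᵐ ω ∂μ, ∀ t, P t ω / (2 * θ.lam) + ∫ s in Set.Iic t,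
      (θ.kap * θ.rho / (2 * θ.lam) * Y s ω - θ.kap * θ.gam / (2 * θ.lam) * ν s ω
        - θ.phi / θ.lam * X s ω) =
      (P t ω - θ.kap * Y t ω) / (2 * θ.lam) - (∫ s in Set.Iic t, θ.phi / θ.lam * X s ω)
        + θ.kap * θ.y / (2 * θ.lam) := by
  have hX2 : SqInt μ X := (sqInt_inventory x hv.2).congr hX.indist.symm.aeEq
  filter_upwards [hY.eq, (hY.sqInt hν).ae_integrable, SqInt.ae_integrable hν.2,
    hX2.ae_integrable] with ω h1 i1 i2 i3 t
  have hlam := θ.lam_pos.ne'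
  have i12 : Integrable fun s => -θ.rho * Y s ω + θ.gam * ν s ω :=
    (i1.const_mul _).add (i2.const_mul _)
  have e : ∀ s, θ.kap * θ.rho / (2 * θ.lam) * Y s ω - θ.kap * θ.gam / (2 * θ.lam) * ν s ω
        - θ.phi / θ.lam * X s ω =
      -(θ.kap / (2 * θ.lam)) * (-θ.rho * Y s ω + θ.gam * ν s ω) - θ.phi / θ.lam * X s ω :=
    fun s => by ring
  simp_rw [e]
  rw [integral_sub (i12.const_mul _).integrableOn (i3.const_mul _).integrableOn,
    integral_const_mul, ← sub_eq_of_eq_add' (h1 t)]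
  ring

/-- The impact equation turns `κρY dt - κγν dt` into `-κ dY`, so given `Y` the coupled backward
equation is the decoupled one; their drifts differ by a constant, which increments do not see. -/
theorem agentFBSDE_iff (θ : Params) {P : Time T → Ω → ℝ} (h𝓕 : UsualConditions 𝓕 μ)
    (hP : IsH2 𝓕 μ P) (x : ℝ) {X Y v ν : Time T → Ω → ℝ} (hν : ν ∈ Admissible 𝓕 μ)
    (hv : v ∈ Admissible 𝓕 μ) :
    AgentFBSDE θ 𝓕 μ P x X v Y ν ↔
      SolvesInventory 𝓕 μ x v X ∧ SolvesImpact θ 𝓕 μ ν Y ∧ FirstOrder θ 𝓕 μ P x Y v := by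
  have key : SolvesImpact θ 𝓕 μ ν Y → (DecoupledFBSDE θ 𝓕 μ P Y x X v ↔
      SolvesInventory 𝓕 μ x v X ∧ FirstOrder θ 𝓕 μ P x Y v) := fun hY =>
    decoupledFBSDE_iff θ h𝓕 hP x hY.cadlagAdapted (hY.sqInt hν) hv
  constructor
  · rintro ⟨hX, hY, hb⟩
    refine ⟨hX, hY, ((key hY).1 ⟨hX, hb.congr (EventuallyEq.refl _ _) ?_
      (Eventually.of_forall fun _ => rfl)⟩).2⟩
    filter_upwards [agent_drift_eq θ P hν hv hX hY] with ω hω t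
    rw [hω, hω]; ring
  · rintro ⟨hX, hY, hF⟩
    refine ⟨hX, hY, ((key hY).2 ⟨hX, hF⟩).backward.congr (EventuallyEq.refl _ _) ?_
      (Eventually.of_forall fun _ => rfl)⟩
    filter_upwards [agent_drift_eq θ P hν hv hX hY] with ω hω t
    rw [hω, hω]; ring

lemma aggregatedFBSDE_iff (θ : Params) {P : Time T → Ω → ℝ} (x : ℝ) {X Y ν : Time T → Ω → ℝ} :
    AggregatedFBSDE θ 𝓕 μ P x X Y ν ↔ AgentFBSDE θ 𝓕 μ P x X ν Y ν :=
  ⟨fun h => ⟨h.1, h.2, h.3⟩, fun h => ⟨h.1, h.2, h.3⟩⟩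

/-! ### Solvability of the first order conditions -/

lemma exists_firstOrder (θ : Params) {P : Time T → Ω → ℝ} (h𝓕 : UsualConditions 𝓕 μ)
    (hP : IsH2 𝓕 μ P) (x : ℝ) {Y : Time T → Ω → ℝ} (hY : SqInt μ Y) :
    ∃ v ∈ Admissible 𝓕 μ, FirstOrder θ 𝓕 μ P x Y v := by
  have hlam : 0 < 2 * θ.lam := by have := θ.lam_pos; positivity
  obtain ⟨V, hV⟩ := exists_isWeakSol (H := progL2 𝓕 μ) hlam
    (inner_kernelOp_nonneg (μ := μ) (isBddKernel_game θ) (isPosKernel_game θ))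
    (toL2 _ (sqInt_target θ h𝓕 hP x hY))
  obtain ⟨v, hv, rfl⟩ := exists_admissible_of_mem hV.1
  exact ⟨v, hv, (firstOrder_iff_isWeakSol θ h𝓕 hP x hY hv).2 hV⟩

lemma FirstOrder.unique {θ : Params} {P : Time T → Ω → ℝ} (h𝓕 : UsualConditions 𝓕 μ)
    (hP : IsH2 𝓕 μ P) {x : ℝ} {Y v v' : Time T → Ω → ℝ} (hY : SqInt μ Y)
    (hv : v ∈ Admissible 𝓕 μ) (hv' : v' ∈ Admissible 𝓕 μ) (h : FirstOrder θ 𝓕 μ P x Y v)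
    (h' : FirstOrder θ 𝓕 μ P x Y v') : AEEq μ v v' := by
  have hlam : 0 < 2 * θ.lam := by have := θ.lam_pos; positivity
  exact (toL2_eq_iff hv.2 hv'.2).1 (((firstOrder_iff_isWeakSol θ h𝓕 hP x hY hv).1 h).unique hlam
    (inner_kernelOp_nonneg (isBddKernel_game θ) (isPosKernel_game θ))
    ((firstOrder_iff_isWeakSol θ h𝓕 hP x hY hv').1 h'))

/-- The kernel of the aggregated first order condition. -/
def aggregateKernel (θ : Params) (t s : Time T) : ℝ :=
  gameKernel θ t s + θ.kap * θ.gam * decayKernel θ.rho t s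

lemma isBddKernel_aggregate (θ : Params) : IsBddKernel (aggregateKernel (T := T) θ) :=
  (isBddKernel_game θ).add ((isBddKernel_decay θ.rho).const_mul _)

lemma isPosKernel_aggregate (θ : Params) : IsPosKernel (aggregateKernel (T := T) θ) :=
  IsPosKernel.add (isBddKernel_game θ) ((isBddKernel_decay θ.rho).const_mul _)
    (isPosKernel_game θ) ((isPosKernel_decay θ.rho_pos.le).const_mul
      (mul_pos θ.kap_pos θ.gam_pos).le)

lemma sqInt_initialImpact (θ : Params) :
    SqInt (T := T) μ fun t _ => Real.exp (-θ.rho * t) * θ.y :=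
  sqInt_continuous (q := fun t : Time T => Real.exp (-θ.rho * t) * θ.y) (by fun_prop)

/-- With `Y` driven by `ν` itself, only `e^{-ρt} y` stays on the affine side; the rest of the impact
is linear in `ν` and joins the kernel. -/
lemma aggregate_firstOrder_iff (θ : Params) {P : Time T → Ω → ℝ} (h𝓕 : UsualConditions 𝓕 μ)
    (hP : IsH2 𝓕 μ P) (x : ℝ) {ν : Time T → Ω → ℝ} (hν : ν ∈ Admissible 𝓕 μ) :
    FirstOrder θ 𝓕 μ P x (impact θ ν) ν ↔ IsWeakSol (progL2 𝓕 μ) (2 * θ.lam)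
      (kernelOp (isBddKernel_aggregate θ) μ)
      (toL2 _ (sqInt_target θ h𝓕 hP x (sqInt_initialImpact θ))) (toL2 ν hν.2) := by
  rw [isWeakSol_toL2_iff (hv := hν)]
  refine forall₂_congr fun w hw => ?_
  have e : AEEq μ (gap θ P x (impact θ ν) ν) fun t ω =>
      target θ P x (fun t _ => Real.exp (-θ.rho * t) * θ.y) t ω - 2 * θ.lam * ν t ω
        - kop (aggregateKernel θ) ν t ω := by
    refine Indist.aeEq ?_
    filter_upwards [SqInt.ae_integrable hν.2] with ω hω t
    have e1 : kop (aggregateKernel θ) ν t ω = kop (gameKernel θ) ν t ω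
        + θ.kap * θ.gam * kop (decayKernel θ.rho) ν t ω := by
      simp only [kop]
      rw [← integral_const_mul, ← integral_add ((isBddKernel_game θ).integrable_mul hω t)
        (((isBddKernel_decay θ.rho).integrable_mul hω t).const_mul _)]
      congr with s
      unfold aggregateKernel; ring
    simp only [gap, target, e1, impact_eq_kop]
    ring
  rw [integral_congr_ae (g := fun p : Time T × Ω =>
    (target θ P x (fun t _ => Real.exp (-θ.rho * t) * θ.y) p.1 p.2 - 2 * θ.lam * ν p.1 p.2
        - kop (aggregateKernel θ) ν p.1 p.2) * w p.1 p.2)]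
  filter_upwards [e] with p hp
  rw [hp]

lemma exists_aggregate (θ : Params) {P : Time T → Ω → ℝ} (h𝓕 : UsualConditions 𝓕 μ)
    (hP : IsH2 𝓕 μ P) (x : ℝ) :
    ∃ ν ∈ Admissible 𝓕 μ, FirstOrder θ 𝓕 μ P x (impact θ ν) ν := by
  have hlam : 0 < 2 * θ.lam := by have := θ.lam_pos; positivity
  obtain ⟨V, hV⟩ := exists_isWeakSol (H := progL2 𝓕 μ) hlam
    (inner_kernelOp_nonneg (μ := μ) (isBddKernel_aggregate θ) (isPosKernel_aggregate θ))
    (toL2 _ (sqInt_target θ h𝓕 hP x (sqInt_initialImpact θ)))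
  obtain ⟨ν, hν, rfl⟩ := exists_admissible_of_mem hV.1
  exact ⟨ν, hν, (aggregate_firstOrder_iff θ h𝓕 hP x hν).2 hV⟩

lemma aggregate_unique (θ : Params) {P : Time T → Ω → ℝ} (h𝓕 : UsualConditions 𝓕 μ)
    (hP : IsH2 𝓕 μ P) {x : ℝ} {ν ν' : Time T → Ω → ℝ} (hν : ν ∈ Admissible 𝓕 μ)
    (hν' : ν' ∈ Admissible 𝓕 μ) (h : FirstOrder θ 𝓕 μ P x (impact θ ν) ν)
    (h' : FirstOrder θ 𝓕 μ P x (impact θ ν') ν') : AEEq μ ν ν' := by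
  have hlam : 0 < 2 * θ.lam := by have := θ.lam_pos; positivity
  exact (toL2_eq_iff hν.2 hν'.2).1 (((aggregate_firstOrder_iff θ h𝓕 hP x hν).1 h).unique hlam
    (inner_kernelOp_nonneg (isBddKernel_aggregate θ) (isPosKernel_aggregate θ))
    ((aggregate_firstOrder_iff θ h𝓕 hP x hν').1 h'))

/-! ### Dependence on the initial position -/

/-- The derivative of `target` with respect to the initial position. -/
def positionSlope (θ : Params) (t : Time T) : ℝ := 2 * θ.phi * (T - t) + 2 * θ.vrho

lemma sqInt_positionSlope (θ : Params) :
    SqInt (T := T) μ fun t (_ : Ω) => positionSlope θ t :=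
  sqInt_continuous (by unfold positionSlope; fun_prop)

/-- `b` is the derivative of the best response with respect to the initial position; it depends
neither on the price nor on the net flow. -/
lemma exists_sensitivity (θ : Params) (𝓕 : Filtration (Time T) mΩ) :
    ∃ b ∈ Admissible 𝓕 μ, ∀ w ∈ Admissible 𝓕 μ, ∫ p : Time T × Ω,
      (positionSlope θ p.1 - 2 * θ.lam * b p.1 p.2 - kop (gameKernel θ) b p.1 p.2) * w p.1 p.2
        ∂(timeProd T μ) = 0 := by
  have hlam : 0 < 2 * θ.lam := by have := θ.lam_pos; positivity
  obtain ⟨V, hV⟩ := exists_isWeakSol (H := progL2 𝓕 μ) hlam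
    (inner_kernelOp_nonneg (μ := μ) (isBddKernel_game θ) (isPosKernel_game θ))
    (toL2 _ (sqInt_positionSlope θ))
  obtain ⟨b, hb, rfl⟩ := exists_admissible_of_mem hV.1
  exact ⟨b, hb, (isWeakSol_toL2_iff (isBddKernel_game θ) _ (sqInt_positionSlope θ) hb).1 hV⟩

lemma admissible_add_mul {v b : Time T → Ω → ℝ} (hv : v ∈ Admissible 𝓕 μ)
    (hb : b ∈ Admissible 𝓕 μ) (r : ℝ) : (fun t ω => v t ω + r * b t ω) ∈ Admissible 𝓕 μ :=
  ⟨hv.1.add ((isStronglyProgressive_const 𝓕 r).mul hb.1), SqInt.add hv.2 (SqInt.const_mul hb.2 r)⟩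

/-- The gradient is jointly affine in position and rate, so moving both by `r` and `r b` adds `r`
times the sensitivity equation. -/
lemma FirstOrder.add_mul {θ : Params} {P : Time T → Ω → ℝ} (h𝓕 : UsualConditions 𝓕 μ)
    (hP : IsH2 𝓕 μ P) {x : ℝ} {Y v b : Time T → Ω → ℝ} (hY : SqInt μ Y)
    (hv : v ∈ Admissible 𝓕 μ) (hb : b ∈ Admissible 𝓕 μ) (h : FirstOrder θ 𝓕 μ P x Y v)
    (hs : ∀ w ∈ Admissible 𝓕 μ, ∫ p : Time T × Ω,
      (positionSlope θ p.1 - 2 * θ.lam * b p.1 p.2 - kop (gameKernel θ) b p.1 p.2) * w p.1 p.2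
        ∂(timeProd T μ) = 0) (r : ℝ) :
    FirstOrder θ 𝓕 μ P (x + r) Y fun t ω => v t ω + r * b t ω := by
  intro w hw
  have hg : SqInt μ fun t ω => positionSlope θ t - 2 * θ.lam * b t ω - kop (gameKernel θ) b t ω :=
    (((sqInt_positionSlope θ).add (SqInt.const_mul (v := b) hb.2 (-(2 * θ.lam)))).add
      ((SqInt.kernel (isBddKernel_game θ) (v := b) hb.2).const_mul (-1))).congr
      (Eventually.of_forall fun p => by simp only []; ring)
  have h1 := integral_add ((sqInt_gap θ h𝓕 hP x hY hv.2).integrable_mul (w := w) hw.2)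
    ((hg.integrable_mul (w := w) hw.2).const_mul r)
  rw [h w hw, integral_const_mul, hs w hw, mul_zero, add_zero] at h1
  refine (integral_congr_ae ?_).trans h1
  have e : Indist μ (kop (gameKernel θ) fun t ω => v t ω + r * b t ω)
      (fun t ω => kop (gameKernel θ) v t ω + r * kop (gameKernel θ) b t ω) := by
    filter_upwards [kop_add_indist (isBddKernel_game θ) hv.2 (SqInt.const_mul hb.2 r)] with ω hω t
    rw [hω t]
    simp only [kop]
    rw [← integral_const_mul]
    congr 2 with s
    ring
  filter_upwards [e.aeEq] with p hp
  simp only [gap, target, positionSlope, hp]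
  ring

lemma tendsto_average_affine {x : ℕ → ℝ} {xlim : ℝ}
    (hx : Tendsto (fun N : ℕ => (N : ℝ)⁻¹ * ∑ i ∈ Finset.range N, x i) atTop (𝓝 xlim))
    (a b : ℝ) : Tendsto (fun N : ℕ => (N : ℝ)⁻¹ * ∑ i ∈ Finset.range N, (a + x i * b)) atTop
      (𝓝 (a + xlim * b)) := by
  refine ((hx.mul_const b).const_add a).congr' ?_
  filter_upwards [eventually_ne_atTop 0] with N hN
  have : (N : ℝ) ≠ 0 := Nat.cast_ne_zero.2 hN
  rw [Finset.sum_add_distrib, ← Finset.sum_mul, Finset.sum_const, Finset.card_range, nsmul_eq_mul]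
  field_simp

/-- The average of the optimal rates against a fixed net flow is optimal for the average initial
position. -/
lemma exists_firstOrder_average {θ : Params} {P : Time T → Ω → ℝ} (h𝓕 : UsualConditions 𝓕 μ)
    (hP : IsH2 𝓕 μ P) {x : ℕ → ℝ} {xlim : ℝ}
    (hx : Tendsto (fun N : ℕ => (N : ℝ)⁻¹ * ∑ i ∈ Finset.range N, x i) atTop (𝓝 xlim))
    {Y : Time T → Ω → ℝ} (hY : SqInt μ Y) {v : ℕ → Time T → Ω → ℝ}
    (hv : ∀ i, v i ∈ Admissible 𝓕 μ) (h : ∀ i, FirstOrder θ 𝓕 μ P (x i) Y (v i)) :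
    ∃ m ∈ Admissible 𝓕 μ, FirstOrder θ 𝓕 μ P xlim Y m ∧ Consistent μ v m := by
  -- With `a` the best response from position `0`, uniqueness identifies the rate of agent `i` with
  -- `a + xⁱ b`, so the averages converge pointwise along with those of the positions.
  obtain ⟨a, ha, hFa⟩ := exists_firstOrder θ h𝓕 hP 0 hY
  obtain ⟨b, hb, hFb⟩ := exists_sensitivity (μ := μ) θ 𝓕
  have hF : ∀ r : ℝ, FirstOrder θ 𝓕 μ P r Y fun t ω => a t ω + r * b t ω := fun r => by
    have := hFa.add_mul h𝓕 hP hY ha hb hFb r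
    rwa [zero_add] at this
  refine ⟨_, admissible_add_mul ha hb xlim, hF xlim, ?_⟩
  have hvi : ∀ i, AEEq μ (v i) fun t ω => a t ω + x i * b t ω := fun i =>
    (h i).unique h𝓕 hP hY (hv i) (admissible_add_mul ha hb (x i)) (hF (x i))
  filter_upwards [ae_all_iff.2 hvi] with p hp
  simp only [hp]
  exact tendsto_average_affine hx _ _

lemma Consistent.unique {v : ℕ → Time T → Ω → ℝ} {ν ν' : Time T → Ω → ℝ}
    (h : Consistent μ v ν) (h' : Consistent μ v ν') : AEEq μ ν ν' := by
  filter_upwards [h, h'] with p h1 h2 using tendsto_nhds_unique h1 h2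

lemma Consistent.congr {v : ℕ → Time T → Ω → ℝ} {ν ν' : Time T → Ω → ℝ}
    (h : Consistent μ v ν) (h' : AEEq μ ν ν') : Consistent μ v ν' := by
  filter_upwards [h, h'] with p h1 h2
  rwa [← h2]

/-- A family of best responses to `ν` is consistent with `ν` iff `ν` solves the aggregated first
order condition. -/
theorem consistent_iff {θ : Params} {P : Time T → Ω → ℝ} (h𝓕 : UsualConditions 𝓕 μ)
    (hP : IsH2 𝓕 μ P) {x : ℕ → ℝ} {xlim : ℝ}
    (hx : Tendsto (fun N : ℕ => (N : ℝ)⁻¹ * ∑ i ∈ Finset.range N, x i) atTop (𝓝 xlim))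
    {ν : Time T → Ω → ℝ} (hν : ν ∈ Admissible 𝓕 μ) {v : ℕ → Time T → Ω → ℝ}
    (hv : ∀ i, v i ∈ Admissible 𝓕 μ) (h : ∀ i, FirstOrder θ 𝓕 μ P (x i) (impact θ ν) (v i)) :
    Consistent μ v ν ↔ FirstOrder θ 𝓕 μ P xlim (impact θ ν) ν := by
  have hY := sqInt_impact θ hν.2
  obtain ⟨m, hm, hFm, hvm⟩ := exists_firstOrder_average h𝓕 hP hx hY hv h
  constructor
  · intro hc
    exact hFm.congr (EventuallyEq.refl _ _) (hvm.unique hc)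
  · intro hF
    exact hvm.congr (hFm.unique h𝓕 hP hY hm hν hF)

lemma isNash_iff {θ : Params} {P : Time T → Ω → ℝ} (h𝓕 : UsualConditions 𝓕 μ)
    (hP : IsH2 𝓕 μ P) {x : ℕ → ℝ} {v : ℕ → Time T → Ω → ℝ} :
    IsNash θ 𝓕 μ P x v ↔ (∀ i, v i ∈ Admissible 𝓕 μ) ∧ ∃ ν ∈ Admissible 𝓕 μ,
      (∀ i, FirstOrder θ 𝓕 μ P (x i) (impact θ ν) (v i)) ∧ Consistent μ v ν := by
  refine and_congr_right fun hv => exists_congr fun ν => and_congr_right fun hν =>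
    and_congr_left fun _ => forall_congr' fun i => ?_
  exact (firstOrder_iff_maximizes θ h𝓕 hP (x i) hν (hv i)).symm

/-- The net flows of two equilibria both solve the aggregated condition, hence agree; each agent
then has only one best response to the common flow. -/
theorem IsNash.isUniqueNash {θ : Params} {P : Time T → Ω → ℝ} (h𝓕 : UsualConditions 𝓕 μ)
    (hP : IsH2 𝓕 μ P) {x : ℕ → ℝ} {xlim : ℝ}
    (hx : Tendsto (fun N : ℕ => (N : ℝ)⁻¹ * ∑ i ∈ Finset.range N, x i) atTop (𝓝 xlim))
    {v : ℕ → Time T → Ω → ℝ} (h : IsNash θ 𝓕 μ P x v) : IsUniqueNash θ 𝓕 μ P x v := by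
  refine ⟨h, fun w hw i => ?_⟩
  obtain ⟨hv, ν, hν, hF, hc⟩ := (isNash_iff h𝓕 hP).1 h
  obtain ⟨hwA, ν', hν', hF', hc'⟩ := (isNash_iff h𝓕 hP).1 hw
  have e : AEEq μ ν' ν := aggregate_unique θ h𝓕 hP hν' hν
    ((consistent_iff h𝓕 hP hx hν' hwA hF').1 hc') ((consistent_iff h𝓕 hP hx hν hv hF).1 hc)
  exact ((hF' i).congr (indist_impact θ e).aeEq (EventuallyEq.refl _ _)).unique h𝓕 hP
    (sqInt_impact θ hν.2) (hwA i) (hv i) (hF i)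

end Systems

end PriceImpactGame

end

/-! ### Assembly of the theorem. -/

open PriceImpactGame

theorem lemma3p3 {Ω : Type*} [MeasurableSpace Ω] {T : ℝ} [Fact (0 < T)]
    (μ : MeasureTheory.Measure Ω) [MeasureTheory.IsProbabilityMeasure μ]
    (𝓕 : MeasureTheory.Filtration (PriceImpactGame.Time T) ‹MeasurableSpace Ω›)
    (h𝓕 : PriceImpactGame.UsualConditions 𝓕 μ)
    (θ : PriceImpactGame.Params)
    (P : PriceImpactGame.Time T → Ω → ℝ) (hP : PriceImpactGame.IsH2 𝓕 μ P)
    (x : ℕ → ℝ) (xlim : ℝ)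
    (hx : Tendsto (fun N : ℕ => (N : ℝ)⁻¹ * ∑ i ∈ Finset.range N, x i) atTop (𝓝 xlim)) :
    -- characterization of the equilibrium
    (∀ v : ℕ → PriceImpactGame.Time T → Ω → ℝ,
      (∀ i, v i ∈ PriceImpactGame.Admissible 𝓕 μ) →
      (PriceImpactGame.IsUniqueNash θ 𝓕 μ P x v ↔
        ∃ ν ∈ PriceImpactGame.Admissible 𝓕 μ,
          (∀ i, PriceImpactGame.AgentFBSDE θ 𝓕 μ P (x i)
            (PriceImpactGame.inventory (x i) (v i)) (v i) (PriceImpactGame.impact θ ν) ν) ∧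
          PriceImpactGame.Consistent μ v ν)) ∧
    -- existence and uniqueness for the aggregated system
    (∃ X Y ν, ν ∈ PriceImpactGame.Admissible 𝓕 μ ∧
      PriceImpactGame.AggregatedFBSDE θ 𝓕 μ P xlim X Y ν) ∧
    (∀ X Y ν X' Y' ν', ν ∈ PriceImpactGame.Admissible 𝓕 μ → ν' ∈ PriceImpactGame.Admissible 𝓕 μ →
      PriceImpactGame.AggregatedFBSDE θ 𝓕 μ P xlim X Y ν →
      PriceImpactGame.AggregatedFBSDE θ 𝓕 μ P xlim X' Y' ν' →
      PriceImpactGame.Indist μ X X' ∧ PriceImpactGame.Indist μ Y Y' ∧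
        PriceImpactGame.AEEq μ ν ν') ∧
    -- decoupling through the solution of the aggregated system
    (∀ X Y ν, ν ∈ PriceImpactGame.Admissible 𝓕 μ →
      PriceImpactGame.AggregatedFBSDE θ 𝓕 μ P xlim X Y ν →
      (∀ i, ∃ Xi vi, vi ∈ PriceImpactGame.Admissible 𝓕 μ ∧
        PriceImpactGame.DecoupledFBSDE θ 𝓕 μ P Y (x i) Xi vi) ∧
      (∀ i Xi vi Xi' vi', vi ∈ PriceImpactGame.Admissible 𝓕 μ →
        vi' ∈ PriceImpactGame.Admissible 𝓕 μ →
        PriceImpactGame.DecoupledFBSDE θ 𝓕 μ P Y (x i) Xi vi →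
        PriceImpactGame.DecoupledFBSDE θ 𝓕 μ P Y (x i) Xi' vi' →
        PriceImpactGame.Indist μ Xi Xi' ∧ PriceImpactGame.AEEq μ vi vi') ∧
      (∀ (Xs vs : ℕ → PriceImpactGame.Time T → Ω → ℝ),
        (∀ i, vs i ∈ PriceImpactGame.Admissible 𝓕 μ) →
        (∀ i, PriceImpactGame.DecoupledFBSDE θ 𝓕 μ P Y (x i) (Xs i) (vs i)) →
        (∀ i, PriceImpactGame.AgentFBSDE θ 𝓕 μ P (x i) (Xs i) (vs i) Y ν) ∧
        PriceImpactGame.Consistent μ vs ν ∧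
        PriceImpactGame.IsUniqueNash θ 𝓕 μ P x vs)) := by
  -- The aggregated system is the system of an agent starting at `x̃` whose own rate is the net
  -- flow; `Y` may be replaced by the explicit impact up to indistinguishability.
  have agg : ∀ {X Y ν}, ν ∈ Admissible 𝓕 μ → AggregatedFBSDE θ 𝓕 μ P xlim X Y ν →
      SolvesInventory 𝓕 μ xlim ν X ∧ SolvesImpact θ 𝓕 μ ν Y ∧
        FirstOrder θ 𝓕 μ P xlim (impact θ ν) ν := fun hν h => by
    obtain ⟨h1, h2, h3⟩ := (agentFBSDE_iff θ h𝓕 hP xlim hν hν).1 ((aggregatedFBSDE_iff θ xlim).1 h)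
    exact ⟨h1, h2, h3.congr (h2.indist hν).aeEq (EventuallyEq.refl _ _)⟩
  refine ⟨fun v hv => ?_, ?_, ?_, ?_⟩
  · have key : ∀ ν ∈ Admissible 𝓕 μ, ∀ i,
        AgentFBSDE θ 𝓕 μ P (x i) (inventory (x i) (v i)) (v i) (impact θ ν) ν ↔
          FirstOrder θ 𝓕 μ P (x i) (impact θ ν) (v i) := fun ν hν i => by
      rw [agentFBSDE_iff θ h𝓕 hP (x i) hν (hv i)]
      exact ⟨fun h => h.2.2, fun h =>
        ⟨solvesInventory_inventory (x i) (hv i), solvesImpact_impact θ hν, h⟩⟩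
    constructor
    -- Uniqueness can be dropped here, since every equilibrium is automatically the only one.
    · rintro ⟨h, -⟩
      obtain ⟨-, ν, hν, hF, hc⟩ := (isNash_iff h𝓕 hP).1 h
      exact ⟨ν, hν, fun i => (key ν hν i).2 (hF i), hc⟩
    · rintro ⟨ν, hν, hF, hc⟩
      exact IsNash.isUniqueNash h𝓕 hP hx ((isNash_iff h𝓕 hP).2
        ⟨hv, ν, hν, fun i => (key ν hν i).1 (hF i), hc⟩)
  · obtain ⟨ν, hν, hF⟩ := exists_aggregate θ h𝓕 hP xlim
    exact ⟨inventory xlim ν, impact θ ν, ν, hν, (aggregatedFBSDE_iff θ xlim).2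
      ((agentFBSDE_iff θ h𝓕 hP xlim hν hν).2
        ⟨solvesInventory_inventory xlim hν, solvesImpact_impact θ hν, hF⟩)⟩
  · intro X Y ν X' Y' ν' hν hν' h h'
    obtain ⟨h1, h2, h3⟩ := agg hν h
    obtain ⟨h1', h2', h3'⟩ := agg hν' h'
    have e := aggregate_unique θ h𝓕 hP hν hν' h3 h3'
    exact ⟨h1.indist.trans ((indist_inventory xlim e).trans h1'.indist.symm),
      (h2.indist hν).trans ((indist_impact θ e).trans (h2'.indist hν').symm), e⟩
  · intro X Y ν hν h
    obtain ⟨-, hY, hagg⟩ := agg hν h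
    have hY2 := hY.sqInt hν
    refine ⟨fun i => ?_, fun i Xi vi Xi' vi' hvi hvi' h1 h2 => ?_, fun Xs vs hvs hs => ?_⟩
    · obtain ⟨v, hv, hF⟩ := exists_firstOrder θ h𝓕 hP (x i) hY2
      exact ⟨inventory (x i) v, v, hv,
        (decoupledFBSDE_iff θ h𝓕 hP (x i) hY.cadlagAdapted hY2 hv).2
          ⟨solvesInventory_inventory (x i) hv, hF⟩⟩
    · obtain ⟨hX, hF⟩ := (decoupledFBSDE_iff θ h𝓕 hP (x i) hY.cadlagAdapted hY2 hvi).1 h1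
      obtain ⟨hX', hF'⟩ := (decoupledFBSDE_iff θ h𝓕 hP (x i) hY.cadlagAdapted hY2 hvi').1 h2
      have e := hF.unique h𝓕 hP hY2 hvi hvi' hF'
      exact ⟨hX.indist.trans ((indist_inventory (x i) e).trans hX'.indist.symm), e⟩
    · have hF := fun i =>
        (decoupledFBSDE_iff θ h𝓕 hP (x i) hY.cadlagAdapted hY2 (hvs i)).1 (hs i)
      have hF' : ∀ i, FirstOrder θ 𝓕 μ P (x i) (impact θ ν) (vs i) := fun i =>
        (hF i).2.congr (hY.indist hν).aeEq (EventuallyEq.refl _ _)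
      have hc : Consistent μ vs ν := (consistent_iff h𝓕 hP hx hν hvs hF').2 hagg
      exact ⟨fun i => (agentFBSDE_iff θ h𝓕 hP (x i) hν (hvs i)).2 ⟨(hF i).1, hY, (hF i).2⟩, hc,
        IsNash.isUniqueNash h𝓕 hP hx ((isNash_iff h𝓕 hP).2 ⟨hvs, ν, hν, hF', hc⟩)⟩
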